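/- Let $d\ge 1$, $\beta\ge 0$, and let $J=(J_{xy})$ be i.i.d. couplings on the nearest-neighbour edges of $\mathbb{Z}^d$ whose common law on $\mathbb{R}$ is symmetric; let $\nu$ be the law of $J$. For a box $\Lambda=\prod_i\{a_i,\dots,b_i\}$ let $G_{\Lambda,\beta,J}$ be the Gibbs measure on $\{-1,+1\}^{\Lambda}$ with weights proportional to $\exp(\beta\sum J_{xy}\sigma_x\sigma_y)$, the sum being over the edges of $\Lambda$ with periodic boundary conditions. Let $\mathcal{M}$ be the space of probability measures on $\{-1,+1\}^{\mathbb{Z}^d}$, with the $\sigma$-algebra generated by the evaluations $\Gamma\mapsto\Gamma(A)$, $A$ measurable, and let $J\mapsto\kappa_J$ be a metastate: a probability kernel from couplings to $\mathcal{M}$ such that, for some boxes $\Lambda_k\to\mathbb{Z}^d$, $$\nu(dJ)\prod_{i\in\mathbb{N}}G_{\Lambda_k,\beta,J}\;\longrightarrow\;\nu(dJ)\int\kappa_J(d\Gamma)\prod_{i\in\mathbb{N}}\Gamma$$ in the sense of finite-dimensional distributions. Let $\mathcal{G}_J\subset\mathcal{M}$ be the set of infinite-volume Gibbs measures of the Edwards–Anderson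 model at inverse temperature $\beta$ with couplings $J$ (solutions of the DLR equations), and call its extreme points pure states. Then the following hold. 1. For every $J$ and every $\Gamma\in\mathcal{G}_J$ there is exactly one probability measure $m_\Gamma$ on $\mathcal{M}$ that is carried by $\mathrm{ex}(\mathcal{G}_J)$ and satisfies $\Gamma=\int\rho\,m_\Gamma(d\rho)$. (The measure $m_\Gamma$ depends on $J$ too; put $m_\Gamma=0$ if $\Gamma\notin\mathcal{G}_J$.) Moreover $\Gamma\in\mathcal{G}_J$ for $\nu(dJ)\times\kappa_J(d\Gamma)$-almost every $(J,\Gamma)$. 2. For every measurable $B\subset\mathcal{M}\times\mathcal{M}$, the map $(J,\Gamma)\mapsto(m_\Gamma\times m_\Gamma)(B)$ is measurable. 3. For $\nu(dJ)\times\kappa_J(d\Gamma)$-almost every $(J,\Gamma)$ and $m_\Gamma\times m_\Gamma$-almost every $(\rho_1,\rho_2)$, with $\Lambda_n=\{-n,\dots,n\}^d$: (a) for $i=1,2$, $$\lim_{n\to\infty}\frac{1}{|\Lambda_n|^2}\sum_{x,y\in\Lambda_n}\bigl|\rho_i(\sigma_x\sigma_y)-\rho_i(\sigma_x)\rho_i(\sigma_y)\bigr|=0;$$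 (b) the edge overlap $$R(\sigma,\sigma')=\lim_{n\to\infty}\frac{1}{|\Lambda_n^*|}\sum_{\{x,y\}\in\Lambda_n^*}\sigma_x\sigma_y\sigma'_x\sigma'_y,$$ where $\Lambda_n^*$ is the set of nearest-neighbour edges with both endpoints in $\Lambda_n$, exists and is constant for $\rho_1\times\rho_2$-almost every $(\sigma,\sigma')$; likewise the spin overlap $\lim_{n}|\Lambda_n|^{-1}\sum_{x\in\Lambda_n}\sigma_x\sigma'_x$ exists and is $\rho_1\times\rho_2$-almost surely constant. -/

import Mathlib

open MeasureTheory ProbabilityTheory Filter Topology BoundedContinuousFunction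
open scoped NNReal ENNReal

namespace EA

/-- Sites of the lattice `ℤ^d`. -/
abbrev Site (d : ℕ) := Fin d → ℤ

/-- Nearest-neighbour edges of `ℤ^d`: the pair `(x, i)` is the edge `{x, x + eᵢ}`. Every
nearest-neighbour edge is of this form for exactly one pair. -/
abbrev Edge (d : ℕ) := Site d × Fin d

/-- Couplings `J = (J_{xy})` indexed by the edges of `ℤ^d`. -/
abbrev Couplings (d : ℕ) := Edge d → ℝ

/-- Spin configurations `σ ∈ {-1, +1}^{ℤ^d}`. -/
abbrev Config (d : ℕ) := Site d → ℤˣ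

/-- The space of probability measures on `{-1, +1}^{ℤ^d}`. -/
abbrev State (d : ℕ) := ProbabilityMeasure (Config d)

variable {d : ℕ}

/-- The spin `σ_x ∈ {-1, +1}` as a real number. -/
def spin (σ : Config d) (x : Site d) : ℝ := ((σ x : ℤ) : ℝ)

/-- The second endpoint `x + eᵢ` of the edge `(x, i)`. -/
def Edge.head (e : Edge d) : Site d := e.1 + Pi.single e.2 1

/-- The edge variable `σ_x σ_y`, `e = {x, y}`. -/
def edgeSpin (σ : Config d) (e : Edge d) : ℝ := spin σ e.1 * spin σ (Edge.head e)

/-- The edges with both endpoints in `W`. -/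
def innerEdges (W : Finset (Site d)) : Finset (Edge d) :=
  (W ×ˢ Finset.univ).filter (fun e => Edge.head e ∈ W)

/-- The edges with at least one endpoint in `W`. -/
def touchingEdges (W : Finset (Site d)) : Finset (Edge d) :=
  (W ×ˢ Finset.univ) ∪
    (W ×ˢ Finset.univ).image (fun e : Edge d => (e.1 - Pi.single e.2 1, e.2))

/-- The configuration equal to `η` in `W` and to `ω` outside `W`. -/
def glue (W : Finset (Site d)) (η : W → ℤˣ) (ω : Config d) : Config d :=
  fun x => if h : x ∈ W then η ⟨x, h⟩ else ω x

/-- The probability measure which gives to the configuration `η` in `W`, continued by `ω` outside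
`W`, the weight `exp (-β H) / Z`, where `Z` normalizes. -/
noncomputable def boltzmann (W : Finset (Site d)) (β : ℝ) (H : Config d → ℝ) (ω : Config d) :
    Measure (Config d) :=
  ∑ η : W → ℤˣ,
    ENNReal.ofReal (Real.exp (-β * H (glue W η ω)) /
        ∑ η' : W → ℤˣ, Real.exp (-β * H (glue W η' ω))) •
      Measure.dirac (glue W η ω)

/-! ### Finite-volume Gibbs measures with periodic boundary conditions -/

/-- The representative of `x` in the box `[a, b]`, viewed as a discrete torus. -/
def wrap (a b x : Site d) : Site d := fun i => a i + (x i - a i) % (b i - a i + 1)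

/-- The Edwards–Anderson Hamiltonian in the box `[a, b] = ∏ᵢ {aᵢ, …, bᵢ}` with periodic boundary
conditions: the edge which leaves the box at `x` in direction `eᵢ` carries its coupling
`J (x, i)` and is closed up to the opposite face. -/
noncomputable def periodicHamiltonian (J : Couplings d) (a b : Site d) (σ : Config d) : ℝ :=
  -∑ x ∈ Finset.Icc a b, ∑ i : Fin d,
    J (x, i) * spin σ x * spin σ (wrap a b (x + Pi.single i 1))

/-- The Gibbs measure `G_{Λ,β,J}` of the box `Λ = [a, b]` with periodic boundary conditions. It is
realized on the configurations of `ℤ^d` that are `+1` outside the box (this continuation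
plays no role in limits `Λ → ℤ^d`). -/
noncomputable def periodicGibbs (β : ℝ) (J : Couplings d) (a b : Site d) : Measure (Config d) :=
  boltzmann (Finset.Icc a b) β (periodicHamiltonian J a b) (fun _ => 1)

/-! ### Infinite-volume Gibbs measures and pure states -/

/-- The part of the Edwards–Anderson Hamiltonian that involves the spins in `W`. -/
noncomputable def localHamiltonian (J : Couplings d) (W : Finset (Site d)) (σ : Config d) : ℝ :=
  -∑ e ∈ touchingEdges W, J e * edgeSpin σ e

/-- The set `𝒢_J` of infinite-volume Gibbs measures: probability measures that satisfy the DLR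
equations for all finite `W`. -/
def gibbsMeasures (β : ℝ) (J : Couplings d) : Set (Measure (Config d)) :=
  {μ | IsProbabilityMeasure μ ∧
    ∀ (W : Finset (Site d)) (A : Set (Config d)), MeasurableSet A →
      μ A = ∫⁻ ω, boltzmann W β (localHamiltonian J W) ω A ∂μ}

/-- `Γ ∈ 𝒢_J`. -/
def IsGibbs (β : ℝ) (J : Couplings d) (Γ : State d) : Prop :=
  (Γ : Measure (Config d)) ∈ gibbsMeasures β J

/-- `ρ ∈ ex(𝒢_J)`: `ρ` is a pure state. -/
def IsPure (β : ℝ) (J : Couplings d) (ρ : State d) : Prop :=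
  (ρ : Measure (Config d)) ∈ Set.extremePoints ℝ≥0 (gibbsMeasures β J)

/-- `m` is a probability measure on states, carried by the pure states, with barycenter `Γ`. -/
def IsPureDecomposition (β : ℝ) (J : Couplings d) (Γ : State d) (m : Measure (State d)) : Prop :=
  IsProbabilityMeasure m ∧ (∀ᵐ ρ ∂m, IsPure β J ρ) ∧
    ∀ A : Set (Config d), MeasurableSet A →
      (Γ : Measure (Config d)) A = ∫⁻ ρ, (ρ : Measure (Config d)) A ∂m

open Classical in
/-- The measure `m_Γ` of the decomposition of `Γ` into pure states (and `0` if `Γ` has no such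
decomposition, that is, if `Γ ∉ 𝒢_J`). -/
noncomputable def pureDecomposition (β : ℝ) (J : Couplings d) (Γ : State d) :
    Measure (State d) :=
  if h : ∃ m, IsPureDecomposition β J Γ m then h.choose else 0

/-! ### Disorder and metastates -/

/-- The law `ν` of independent couplings with common distribution `μ₀`. -/
noncomputable def couplingLaw (d : ℕ) (μ₀ : Measure ℝ) [IsProbabilityMeasure μ₀] :
    Measure (Couplings d) :=
  Measure.infinitePi (fun _ : Edge d => μ₀)

/-- `κ` is a metastate (for periodic boundary conditions): along some sequence of boxes
`Λ_k = [a_k, b_k]` that converges to `ℤ^d`,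
`ν(dJ) × ∏_{i ∈ ℕ} G_{Λ_k,β,J} → ν(dJ) × ∫ κ_J(dΓ) ∏_{i ∈ ℕ} Γ`
in the sense of finite-dimensional distributions, that is, for the joint laws of the couplings in
every finite set `E` of edges and of `s` replicas in every finite `W ⊂ ℤ^d`. -/
def IsMetastate (β : ℝ) (ν : Measure (Couplings d)) (κ : Kernel (Couplings d) (State d)) : Prop :=
  ∃ a b : ℕ → Site d, (∀ k, a k ≤ b k) ∧ Tendsto a atTop atBot ∧ Tendsto b atTop atTop ∧
    ∀ (E : Finset (Edge d)) (W : Finset (Site d)) (s : ℕ)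
      (F : ((E → ℝ) × (Fin s → W → ℤˣ)) →ᵇ ℝ),
      Tendsto
        (fun k => ∫ J, ∫ σ : Fin s → Config d,
            F (fun e => J e, fun i x => σ i x)
          ∂Measure.pi (fun _ => periodicGibbs β J (a k) (b k)) ∂ν)
        atTop
        (𝓝 (∫ J, ∫ Γ, ∫ σ : Fin s → Config d,
            F (fun e => J e, fun i x => σ i x)
          ∂Measure.pi (fun _ => (Γ : Measure (Config d))) ∂(κ J) ∂ν))

/-! ### Overlaps -/

/-- The cube `{-n, …, n}^d`. -/
noncomputable def cube (d n : ℕ) : Finset (Site d) := Finset.Icc (fun _ => -(n : ℤ)) (fun _ => (n : ℤ))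

/-- The edge overlap `R^W(σ, σ')` in `W`. -/
noncomputable def edgeOverlap (W : Finset (Site d)) (σ σ' : Config d) : ℝ :=
  (∑ e ∈ innerEdges W, edgeSpin σ e * edgeSpin σ' e) / ((innerEdges W).card : ℝ)

/-- The spin overlap in `W`. -/
noncomputable def spinOverlap (W : Finset (Site d)) (σ σ' : Config d) : ℝ :=
  (∑ x ∈ W, spin σ x * spin σ' x) / (W.card : ℝ)

/-- The overlap `lim_{W → ℤ^d} R^W` (along cubes) exists and is equal to one constant for
`ρ₁ × ρ₂`-almost every pair of configurations. -/
def OverlapConstant (R : Finset (Site d) → Config d → Config d → ℝ) (ρ₁ ρ₂ : State d) : Prop :=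
  ∃ c : ℝ, ∀ᵐ p ∂((ρ₁ : Measure (Config d)).prod (ρ₂ : Measure (Config d))),
    Tendsto (fun n : ℕ => R (cube d n) p.1 p.2) atTop (𝓝 c)

/-- Correlations of the spins decay on average:
`|Λ|⁻² ∑_{x, y ∈ Λ} |ρ(σ_x σ_y) - ρ(σ_x) ρ(σ_y)| → 0` along cubes `Λ`. -/
def AveragedMixing (ρ : State d) : Prop :=
  Tendsto (fun n : ℕ =>
      (∑ x ∈ cube d n, ∑ y ∈ cube d n,
        |(∫ σ, spin σ x * spin σ y ∂(ρ : Measure (Config d))) -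
          (∫ σ, spin σ x ∂(ρ : Measure (Config d))) *
            (∫ σ, spin σ y ∂(ρ : Measure (Config d)))|) / ((cube d n).card : ℝ) ^ 2)
    atTop (𝓝 0)

end EA

namespace EA

variable {d : ℕ}

/-! ### Local specifications -/

/-! Let F_n be the conditional mean of f given the spins outside `cube d n`, computed from the
specification (`localMean`). Under a Gibbs measure the F_n form a reverse martingale, so ∫ F_n²
decreases and F_n converges in L² to a tail function. Purity is the statement that these limits are
constant. In quantitative form, the variance `tailVar` of F_n tends to 0: for all bounded measurable
f if the state is pure (`IsPure.tendsto_tailVar`), and conversely a Gibbs measure with this property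
for the events `allUp U` is pure (`isPure_of_tailVar`).

This criterion yields the decomposition. Conditioning Γ on the tail σ-algebra gives random states
that are almost surely Gibbs and satisfy the criterion, and their law is a decomposition. For
uniqueness, let m be any decomposition. The moments ∫ ∏ ρ(`allUp (u i)`) m(dρ) are the limits of the
Γ-means of products of conditional probabilities given the outside of a cube
(`IsPureDecomposition.tendsto_moment`). These means involve only J and Γ. So m is determined,
depends measurably on (J, Γ), and is equivariant under translations.

The metastate enters through two properties of P = ν ⊗ κ. The states are Gibbs: the squared defect
in a DLR equation is a two-replica observable, and it vanishes in all large periodic boxes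
(`ConvergesAlong.ae_isGibbs`). And P is translation invariant: the periodic measures are covariant
under rotations of the torus, i.i.d. couplings are invariant under every permutation of sites, and
near the origin a rotation of a large box is a translation (`ConvergesAlong.map_shiftPair`). Hence
the law of two independent pure states drawn from the decomposition is translation invariant, and so
is the law of two replicas drawn from them.

In a pure state the correlation of f with a distant observable is at most the square root of
`tailVar`, uniformly in that observable. The supremum over distances beyond r therefore tends to 0
as r grows. Along translates of the state it need not be uniformly small, but the maximal inequality
bounds its averages over all cubes at once, which gives averaged decay of correlations
(`IsPreservingAction.ae_tendsto_avgCorr`). The overlaps are averages over cubes in the translation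
invariant two-replica system, so they converge by the pointwise ergodic theorem. Their variance
under ρ₁ × ρ₂ is bounded by averaged correlations of ρ₁ and ρ₂, which tend to 0, so the limits are
constant (`exists_ae_tendsto_overlap`). -/

instance : MeasurableSingletonClass ℤˣ where
  measurableSet_singleton a :=
    ⟨{(a : ℤ)}, measurableSet_singleton _, by ext b; simp [Units.ext_iff]⟩

lemma glue_of_mem {W : Finset (Site d)} (η : W → ℤˣ) (ω : Config d) {x : Site d} (hx : x ∈ W) :
    glue W η ω x = η ⟨x, hx⟩ := by simp [glue, hx]

lemma glue_of_notMem {W : Finset (Site d)} (η : W → ℤˣ) (ω : Config d) {x : Site d} (hx : x ∉ W) :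
    glue W η ω x = ω x := by simp [glue, hx]

lemma glue_glue (W : Finset (Site d)) (η ζ : W → ℤˣ) (ω : Config d) :
    glue W η (glue W ζ ω) = glue W η ω := by
  funext x
  by_cases hx : x ∈ W <;> simp [glue, hx]

lemma measurable_glue (W : Finset (Site d)) (η : W → ℤˣ) : Measurable (glue W η) := by
  refine measurable_pi_lambda _ fun x => ?_
  by_cases hx : x ∈ W
  · simp [glue, hx]
  · simpa [glue, hx] using measurable_pi_apply x

/-- The weight which `boltzmann W β H ω` gives to `η`. -/
noncomputable def weight (W : Finset (Site d)) (β : ℝ) (H : Config d → ℝ) (ω : Config d)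
    (η : W → ℤˣ) : ℝ :=
  Real.exp (-β * H (glue W η ω)) / ∑ η' : W → ℤˣ, Real.exp (-β * H (glue W η' ω))

lemma weight_nonneg (W : Finset (Site d)) (β : ℝ) (H : Config d → ℝ) (ω : Config d)
    (η : W → ℤˣ) : 0 ≤ weight W β H ω η := by
  unfold weight; positivity

lemma sum_weight (W : Finset (Site d)) (β : ℝ) (H : Config d → ℝ) (ω : Config d) :
    ∑ η, weight W β H ω η = 1 := by
  unfold weight
  rw [← Finset.sum_div]
  exact div_self (Finset.sum_pos (fun _ _ => Real.exp_pos _) Finset.univ_nonempty).ne'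

lemma weight_glue (W : Finset (Site d)) (β : ℝ) (H : Config d → ℝ) (ω : Config d)
    (η ζ : W → ℤˣ) : weight W β H (glue W ζ ω) η = weight W β H ω η := by
  simp [weight, glue_glue]

lemma boltzmann_eq (W : Finset (Site d)) (β : ℝ) (H : Config d → ℝ) (ω : Config d) :
    boltzmann W β H ω =
      ∑ η : W → ℤˣ, ENNReal.ofReal (weight W β H ω η) • Measure.dirac (glue W η ω) := rfl

instance (W : Finset (Site d)) (β : ℝ) (H : Config d → ℝ) (ω : Config d) :
    IsProbabilityMeasure (boltzmann W β H ω) where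
  measure_univ := by
    simp only [boltzmann_eq, Measure.coe_finsetSum, Measure.coe_smul, Finset.sum_apply,
      Pi.smul_apply, measure_univ, smul_eq_mul, mul_one]
    rw [← ENNReal.ofReal_sum_of_nonneg fun _ _ => weight_nonneg _ _ _ _ _, sum_weight,
      ENNReal.ofReal_one]

lemma integral_boltzmann (W : Finset (Site d)) (β : ℝ) (H : Config d → ℝ) (ω : Config d)
    (f : Config d → ℝ) :
    ∫ σ, f σ ∂boltzmann W β H ω = ∑ η, weight W β H ω η * f (glue W η ω) := by
  rw [boltzmann_eq, integral_finsetSum_measure]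
  · refine Finset.sum_congr rfl fun η _ => ?_
    rw [integral_smul_measure, integral_dirac,
      ENNReal.toReal_ofReal (weight_nonneg _ _ _ _ _), smul_eq_mul]
  · intro η _
    exact (integrable_dirac (by simp)).smul_measure ENNReal.ofReal_ne_top

lemma lintegral_boltzmann (W : Finset (Site d)) (β : ℝ) (H : Config d → ℝ) (ω : Config d)
    (f : Config d → ℝ≥0∞) :
    ∫⁻ σ, f σ ∂boltzmann W β H ω = ∑ η, ENNReal.ofReal (weight W β H ω η) * f (glue W η ω) := by
  rw [boltzmann_eq, lintegral_finsetSum_measure]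
  simp [lintegral_smul_measure]

lemma measurable_spin (x : Site d) : Measurable fun σ : Config d => spin σ x :=
  (Measurable.of_discrete (f := fun u : ℤˣ => ((u : ℤ) : ℝ))).comp (measurable_pi_apply x)

lemma measurable_edgeSpin (e : Edge d) : Measurable fun σ : Config d => edgeSpin σ e :=
  (measurable_spin _).mul (measurable_spin _)

lemma measurable_localHamiltonian (W : Finset (Site d)) :
    Measurable fun p : Couplings d × Config d => localHamiltonian p.1 W p.2 := by
  unfold localHamiltonian
  refine (Finset.measurable_fun_sum _ fun e _ => ?_).neg
  exact ((measurable_pi_apply e).comp measurable_fst).mul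
    ((measurable_edgeSpin e).comp measurable_snd)

lemma measurable_weight (W : Finset (Site d)) (β : ℝ) (η : W → ℤˣ) :
    Measurable fun p : Couplings d × Config d =>
      weight W β (localHamiltonian p.1 W) p.2 η := by
  have h : ∀ ζ : W → ℤˣ, Measurable fun p : Couplings d × Config d =>
      Real.exp (-β * localHamiltonian p.1 W (glue W ζ p.2)) := fun ζ =>
    (((measurable_localHamiltonian W).comp
      (measurable_fst.prodMk ((measurable_glue W ζ).comp measurable_snd))).const_mul _).exp
  exact (h η).div (Finset.measurable_fun_sum _ fun ζ _ => h ζ)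

/-- The local specification as a kernel from couplings and boundary conditions. -/
noncomputable def gibbsKernel (β : ℝ) (W : Finset (Site d)) :
    Kernel (Couplings d × Config d) (Config d) where
  toFun p := boltzmann W β (localHamiltonian p.1 W) p.2
  measurable' := by
    refine Measure.measurable_of_measurable_coe _ fun A hA => ?_
    simp only [boltzmann_eq, Measure.coe_finsetSum, Measure.coe_smul, Finset.sum_apply,
      Pi.smul_apply, smul_eq_mul]
    refine Finset.measurable_fun_sum _ fun η _ => ?_
    refine (measurable_weight W β η).ennreal_ofReal.mul ?_
    exact (Measure.measurable_coe hA).comp (Measure.measurable_dirac.comp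
      ((measurable_glue W η).comp (measurable_snd (α := Couplings d))))

instance (β : ℝ) (W : Finset (Site d)) : IsMarkovKernel (gibbsKernel β W) :=
  ⟨fun p => inferInstanceAs (IsProbabilityMeasure (boltzmann W β (localHamiltonian p.1 W) p.2))⟩

/-- The conditional mean of `f` given the spins outside `W`, according to the specification. -/
noncomputable def localMean (β : ℝ) (J : Couplings d) (W : Finset (Site d)) (f : Config d → ℝ)
    (ω : Config d) : ℝ :=
  ∑ η, weight W β (localHamiltonian J W) ω η * f (glue W η ω)

lemma integral_boltzmann_localHamiltonian (β : ℝ) (J : Couplings d) (W : Finset (Site d))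
    (f : Config d → ℝ) (ω : Config d) :
    ∫ σ, f σ ∂boltzmann W β (localHamiltonian J W) ω = localMean β J W f ω :=
  integral_boltzmann _ _ _ _ _

lemma abs_localMean_le (β : ℝ) (J : Couplings d) (W : Finset (Site d)) {f : Config d → ℝ} {C : ℝ}
    (hf : ∀ σ, |f σ| ≤ C) (ω : Config d) : |localMean β J W f ω| ≤ C := by
  refine (Finset.abs_sum_le_sum_abs _ _).trans ?_
  calc ∑ η, |weight W β (localHamiltonian J W) ω η * f (glue W η ω)|
      ≤ ∑ η, weight W β (localHamiltonian J W) ω η * C := by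
        refine Finset.sum_le_sum fun η _ => ?_
        rw [abs_mul, abs_of_nonneg (weight_nonneg _ _ _ _ _)]
        exact mul_le_mul_of_nonneg_left (hf _) (weight_nonneg _ _ _ _ _)
    _ = C := by rw [← Finset.sum_mul, sum_weight, one_mul]

lemma measurable_uncurry_localMean (β : ℝ) (W : Finset (Site d)) {f : Config d → ℝ}
    (hf : Measurable f) :
    Measurable fun p : Couplings d × Config d => localMean β p.1 W f p.2 := by
  unfold localMean
  refine Finset.measurable_fun_sum _ fun η _ => ?_
  have h : Measurable fun p : Couplings d × Config d => f (glue W η p.2) :=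
    (hf.comp (measurable_glue W η)).comp measurable_snd
  exact (measurable_weight W β η).mul h

lemma measurable_localMean (β : ℝ) (J : Couplings d) (W : Finset (Site d)) {f : Config d → ℝ}
    (hf : Measurable f) : Measurable (localMean β J W f) := by
  have h := (measurable_uncurry_localMean β W hf).comp
    (measurable_prodMk_left (x := J) (β := Config d))
  simpa only [Function.comp_def] using h

/-- `g` does not depend on the spins in `W`. -/
def Exterior {α : Type*} (W : Finset (Site d)) (g : Config d → α) : Prop :=
  ∀ (η : W → ℤˣ) (ω : Config d), g (glue W η ω) = g ω

lemma Exterior.mono {α : Type*} {W V : Finset (Site d)} (hWV : W ⊆ V) {g : Config d → α}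
    (hg : Exterior V g) : Exterior W g := by
  intro η ω
  -- Resampling in the smaller set is a special resampling in the larger one.
  have h : glue V (fun x => glue W η ω x) ω = glue W η ω := by
    funext x
    by_cases hx : x ∈ V
    · rw [glue_of_mem _ _ hx]
    · rw [glue_of_notMem _ _ hx, glue_of_notMem _ _ fun h => hx (hWV h)]
  rw [← h, hg]

lemma exterior_localMean (β : ℝ) (J : Couplings d) (W : Finset (Site d)) (f : Config d → ℝ) :
    Exterior W (localMean β J W f) := by
  intro η ω
  simp [localMean, glue_glue, weight_glue]

lemma localMean_mul (β : ℝ) (J : Couplings d) {W : Finset (Site d)} {g : Config d → ℝ}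
    (hg : Exterior W g) (f : Config d → ℝ) (ω : Config d) :
    localMean β J W (fun σ => g σ * f σ) ω = g ω * localMean β J W f ω := by
  simp only [localMean, Finset.mul_sum]
  exact Finset.sum_congr rfl fun η _ => by rw [hg η ω]; ring

lemma Bounded.integrable {Ω : Type*} [MeasurableSpace Ω] {μ : Measure Ω} [IsFiniteMeasure μ]
    {f : Ω → ℝ} (hf : Measurable f) {C : ℝ} (hC : ∀ σ, |f σ| ≤ C) : Integrable f μ :=
  Integrable.of_bound hf.aestronglyMeasurable C (.of_forall hC)

lemma integral_measure_bind {X Y : Type*} [MeasurableSpace X] [MeasurableSpace Y] {μ : Measure X}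
    [SFinite μ] {K : Kernel X Y} [IsSFiniteKernel K] {f : Y → ℝ} (hf : Integrable f (K ∘ₘ μ)) :
    ∫ y, f y ∂(K ∘ₘ μ) = ∫ x, ∫ y, f y ∂K x ∂μ := by
  have h : (K ∘ₖ Kernel.const Unit μ) () = K ∘ₘ μ := by
    rw [Kernel.comp_apply, Kernel.const_apply]
  rw [← h, Kernel.integral_comp (by rwa [h]), Kernel.const_apply]

/-! ### Gibbs measures -/

/-- The DLR equation for `W` says that μ is invariant under the kernel of the specification in `W`.
The form for bare measures is needed for the components of a convex combination. -/
lemma integral_localMean_of_forall {β : ℝ} {J : Couplings d} {μ : Measure (Config d)}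
    [IsFiniteMeasure μ] {W : Finset (Site d)}
    (h : ∀ A, MeasurableSet A → μ A = ∫⁻ ω, boltzmann W β (localHamiltonian J W) ω A ∂μ)
    {f : Config d → ℝ} (hf : Measurable f) {C : ℝ} (hC : ∀ σ, |f σ| ≤ C) :
    ∫ ω, localMean β J W f ω ∂μ = ∫ ω, f ω ∂μ := by
  let K : Kernel (Config d) (Config d) :=
    (gibbsKernel β W).comap (fun ω => (J, ω)) (measurable_const.prodMk measurable_id)
  have hb : K ∘ₘ μ = μ := by
    refine Measure.ext fun A hA => ?_
    rw [Measure.bind_apply hA K.measurable.aemeasurable]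
    exact (h A hA).symm
  have hi : Integrable f (K ∘ₘ μ) := by rw [hb]; exact Bounded.integrable hf hC
  conv_rhs => rw [← hb]
  rw [integral_measure_bind hi]
  exact integral_congr_ae (.of_forall fun ω => (integral_boltzmann_localHamiltonian β J W f ω).symm)

lemma IsGibbs.integral_localMean {β : ℝ} {J : Couplings d} {Γ : State d} (h : IsGibbs β J Γ)
    (W : Finset (Site d)) {f : Config d → ℝ} (hf : Measurable f) {C : ℝ} (hC : ∀ σ, |f σ| ≤ C) :
    ∫ ω, localMean β J W f ω ∂(Γ : Measure (Config d)) = ∫ ω, f ω ∂(Γ : Measure (Config d)) :=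
  integral_localMean_of_forall (h.2 W) hf hC

/-- Exterior factors pass through the local mean. Thus `localMean` acts as a conditional expectation
given the spins outside `W`. -/
lemma IsGibbs.integral_mul_localMean {β : ℝ} {J : Couplings d} {Γ : State d} (h : IsGibbs β J Γ)
    {W : Finset (Site d)} {f g : Config d → ℝ} (hf : Measurable f) {C : ℝ} (hC : ∀ σ, |f σ| ≤ C)
    (hgm : Measurable g) {D : ℝ} (hD : ∀ σ, |g σ| ≤ D) (hg : Exterior W g) :
    ∫ ω, g ω * localMean β J W f ω ∂(Γ : Measure (Config d)) =
      ∫ ω, g ω * f ω ∂(Γ : Measure (Config d)) := by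
  rw [← h.integral_localMean W (f := fun ω => g ω * f ω) (hgm.mul hf) (C := D * C)]
  · simp_rw [localMean_mul β J hg f]
  · intro σ
    rw [abs_mul]
    exact mul_le_mul (hD σ) (hC σ) (abs_nonneg _) ((abs_nonneg _).trans (hD σ))

end EA

namespace EA

variable {d : ℕ}

/-! ### The multiparameter pointwise ergodic theorem -/

lemma mem_cube {n : ℕ} {x : Site d} : x ∈ cube d n ↔ ∀ i, |x i| ≤ n := by
  simp [cube, Pi.le_def, abs_le, forall_and]

lemma card_cube (d n : ℕ) : (cube d n).card = (2 * n + 1) ^ d := by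
  simp only [cube, Pi.card_Icc, Int.card_Icc, Finset.prod_const, Finset.card_univ,
    Fintype.card_fin]
  congr 1
  omega

lemma card_cube_pos (d n : ℕ) : (0 : ℝ) < (cube d n).card := by
  rw [card_cube]; positivity

lemma cube_mono {m n : ℕ} (h : m ≤ n) : cube d m ⊆ cube d n := fun x hx => by
  rw [mem_cube] at *
  exact fun i => (hx i).trans (by exact_mod_cast h)

lemma add_mem_cube {m n : ℕ} {x y : Site d} (hx : x ∈ cube d m) (hy : y ∈ cube d n) :
    x + y ∈ cube d (m + n) := by
  rw [mem_cube] at *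
  intro i
  have := abs_add_le (x i) (y i)
  have h1 := hx i
  have h2 := hy i
  push_cast
  simp only [Pi.add_apply]
  linarith

lemma neg_mem_cube {n : ℕ} {x : Site d} (hx : x ∈ cube d n) : -x ∈ cube d n := by
  rw [mem_cube] at *
  simpa using hx

lemma exists_mem_cube (x : Site d) : ∃ c, x ∈ cube d c := by
  refine ⟨∑ i, (x i).natAbs, mem_cube.2 fun i => ?_⟩
  rw [Int.abs_eq_natAbs]
  exact_mod_cast Finset.single_le_sum (f := fun i => (x i).natAbs) (fun _ _ => Nat.zero_le _)
    (Finset.mem_univ i)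

lemma exists_subset_cube (W : Finset (Site d)) : ∃ c, W ⊆ cube d c := by
  choose c hc using exists_mem_cube (d := d)
  exact ⟨W.sup c, fun x hx => cube_mono (Finset.le_sup hx) (hc x)⟩

lemma tendsto_card_cube_add_div (d c : ℕ) :
    Tendsto (fun n : ℕ => ((cube d (n + c)).card : ℝ) / (cube d n).card) atTop (𝓝 1) := by
  have h : Tendsto (fun n : ℕ => 1 + (2 * c : ℝ) / (2 * n + 1)) atTop (𝓝 (1 + 0)) := by
    refine tendsto_const_nhds.add (tendsto_const_nhds.div_atTop ?_)
    exact tendsto_atTop_add_const_right _ _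
      (tendsto_natCast_atTop_atTop.const_mul_atTop two_pos)
  have h2 := h.pow d
  simp only [add_zero, one_pow] at h2
  refine h2.congr fun n => ?_
  rw [card_cube, card_cube]
  push_cast
  rw [← div_pow]
  congr 1
  have : (2 * (n : ℝ) + 1) ≠ 0 := by positivity
  field_simp
  ring

lemma tendsto_card_cube_atTop (hd : 1 ≤ d) :
    Tendsto (fun n : ℕ => ((cube d n).card : ℝ)) atTop atTop := by
  refine tendsto_atTop_mono (fun n => ?_) tendsto_natCast_atTop_atTop
  rw [card_cube]
  have h1 : n ≤ 2 * n + 1 := by omega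
  exact_mod_cast h1.trans (Nat.le_self_pow (by omega) _)

/-- Vitali covering: among the cubes centred in `S` with large sums, a disjoint subfamily is
selected whose fivefold enlargements cover `S`. Disjointness means that each value of `a` is used at
most once. -/
lemma card_mul_le_of_covering (a : Site d → ℝ≥0∞) (t : ℝ≥0∞) (S : Finset (Site d)) {M N : ℕ}
    (hSM : S ⊆ cube d M)
    (hS : ∀ x ∈ S, ∃ n ≤ N, t * (cube d n).card ≤ ∑ y ∈ cube d n, a (y + x)) :
    t * S.card ≤ 5 ^ d * ∑ y ∈ cube d (M + N), a y := by
  classical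
  choose! n hnN hn using hS
  -- Balls of the sup metric are translated cubes, so the covering theorem for balls applies.
  have hball : ∀ (x y : Site d) (m : ℕ), y ∈ Metric.closedBall x (m : ℝ) ↔ y - x ∈ cube d m := by
    intro x y m
    rw [Metric.mem_closedBall, dist_pi_le_iff (by positivity), mem_cube]
    refine forall_congr' fun i => ?_
    rw [Int.dist_eq, Pi.sub_apply]
    norm_cast
  obtain ⟨u, huS, hdisj, hcov⟩ := Vitali.exists_disjoint_subfamily_covering_enlargement_closedBall
    (S : Set (Site d)) id (fun x => (n x : ℝ)) N (fun x hx => by exact_mod_cast hnN x hx) 5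
    (by norm_num)
  have hufin : u.Finite := S.finite_toSet.subset huS
  obtain ⟨v, rfl⟩ := hufin.exists_finset_coe
  let B : Site d → ℕ → Finset (Site d) := fun x m => (cube d m).map (addRightEmbedding x)
  have hB : ∀ x m y, y ∈ B x m ↔ y - x ∈ cube d m := by
    intro x m y
    simp only [B, Finset.mem_map, addRightEmbedding_apply]
    exact ⟨by rintro ⟨z, hz, rfl⟩; simpa using hz, fun h => ⟨y - x, h, by simp⟩⟩
  have hcard : S.card ≤ ∑ b ∈ v, 5 ^ d * (cube d (n b)).card := by
    have hsub : S ⊆ v.biUnion fun b => B b (5 * n b) := by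
      intro x hx
      obtain ⟨b, hb, hxb⟩ := hcov x hx
      rw [Finset.mem_biUnion]
      refine ⟨b, hb, (hB _ _ _).2 ((hball _ _ _).1 ?_)⟩
      have : x ∈ Metric.closedBall (id x) (n x : ℝ) := Metric.mem_closedBall_self (by positivity)
      simpa using hxb this
    refine (Finset.card_le_card hsub).trans (Finset.card_biUnion_le.trans ?_)
    refine Finset.sum_le_sum fun b _ => ?_
    simp only [B, Finset.card_map, card_cube, ← mul_pow]
    -- The side 2 · 5n + 1 of the enlarged cube is at most 5(2n + 1).
    exact Nat.pow_le_pow_left (by omega) d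
  calc t * S.card ≤ t * ((∑ b ∈ v, 5 ^ d * (cube d (n b)).card : ℕ) : ℝ≥0∞) := by gcongr
    _ = 5 ^ d * ∑ b ∈ v, t * (cube d (n b)).card := by
        push_cast
        rw [Finset.mul_sum, Finset.mul_sum]
        exact Finset.sum_congr rfl fun b _ => by ring
    _ ≤ 5 ^ d * ∑ b ∈ v, ∑ y ∈ B b (n b), a y := by
        gcongr with b hb
        simpa [B] using hn b (huS hb)
    _ = 5 ^ d * ∑ y ∈ v.biUnion fun b => B b (n b), a y := by
        rw [Finset.sum_biUnion]
        intro b hb c hc hbc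
        have := hdisj hb hc hbc
        rw [Function.onFun, Finset.disjoint_left]
        intro y hy hy'
        exact Set.disjoint_left.1 this ((hball _ _ _).2 ((hB _ _ _).1 hy))
          ((hball _ _ _).2 ((hB _ _ _).1 hy'))
    _ ≤ 5 ^ d * ∑ y ∈ cube d (M + N), a y := by
        gcongr
        intro y hy
        obtain ⟨b, hb, hyb⟩ := Finset.mem_biUnion.1 hy
        have h1 := (hB _ _ _).1 hyb
        have h2 := add_mem_cube (hSM (huS hb)) (cube_mono (hnN b (huS hb)) h1)
        simpa using h2

variable {Ω : Type*} [MeasurableSpace Ω]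

/-- `T` is an action of `ℤ^d` by measure preserving maps. -/
structure IsPreservingAction (T : Site d → Ω → Ω) (μ : Measure Ω) : Prop where
  zero : ∀ ω, T 0 ω = ω
  add : ∀ x y ω, T (x + y) ω = T x (T y ω)
  preserving : ∀ x, MeasurePreserving (T x) μ μ

/-- **Maximal inequality** over cubes. -/
lemma IsPreservingAction.maximal {T : Site d → Ω → Ω} {μ : Measure Ω} (hT : IsPreservingAction T μ)
    {f : Ω → ℝ≥0∞} (hf : Measurable f) (t : ℝ≥0∞) :
    t * μ {ω | ∃ n, t * (cube d n).card ≤ ∑ x ∈ cube d n, f (T x ω)} ≤ 5 ^ d * ∫⁻ ω, f ω ∂μ := by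
  classical
  have hTm : ∀ x, Measurable (T x) := fun x => (hT.preserving x).measurable
  -- Bounding the radius by `N` keeps all selected cubes inside a slightly larger window.
  let E : ℕ → Set Ω := fun N => {ω | ∃ n ≤ N, t * (cube d n).card ≤ ∑ x ∈ cube d n, f (T x ω)}
  have hEm : ∀ N, MeasurableSet (E N) := by
    intro N
    have : E N = ⋃ n ∈ Set.Iic N, {ω | t * (cube d n).card ≤ ∑ x ∈ cube d n, f (T x ω)} := by
      ext ω; simp [E]
    rw [this]
    refine MeasurableSet.biUnion (Set.to_countable _) fun n _ => ?_
    exact measurableSet_le measurable_const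
      (Finset.measurable_fun_sum _ fun x _ => hf.comp (hTm x))
  have hunion : {ω | ∃ n, t * (cube d n).card ≤ ∑ x ∈ cube d n, f (T x ω)} = ⋃ N, E N := by
    ext ω
    simp only [E, Set.mem_ofPred_eq, Set.mem_iUnion]
    exact ⟨fun ⟨n, h⟩ => ⟨n, n, le_rfl, h⟩, fun ⟨_, n, _, h⟩ => ⟨n, h⟩⟩
  have hmono : Monotone E := fun N N' h ω ⟨n, hn, hω⟩ => ⟨n, hn.trans h, hω⟩
  rw [hunion, hmono.measure_iUnion, ENNReal.mul_iSup]
  refine iSup_le fun N => ?_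
  -- Transference: the covering estimate is applied along the orbit of ω to the sites of `cube d M`
  -- that visit `E N`, then integrated. The cost of the wider window is a ratio of volumes tending
  -- to 1 as `M` grows.
  have key : ∀ M : ℕ, t * μ (E N) ≤
      ((cube d (M + N)).card : ℝ≥0∞) / (cube d M).card * (5 ^ d * ∫⁻ ω, f ω ∂μ) := by
    intro M
    have hpt : ∀ ω, t * ∑ x ∈ cube d M, (E N).indicator 1 (T x ω) ≤
        5 ^ d * ∑ y ∈ cube d (M + N), f (T y ω) := by
      intro ω
      have := card_mul_le_of_covering (fun y => f (T y ω)) t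
        ((cube d M).filter fun x => T x ω ∈ E N) (N := N) (Finset.filter_subset _ _) (by
          intro x hx
          obtain ⟨n, hn, h⟩ := (Finset.mem_filter.1 hx).2
          exact ⟨n, hn, by simpa only [hT.add] using h⟩)
      refine le_trans (le_of_eq ?_) this
      rw [Finset.card_filter]
      push_cast
      simp [Set.indicator_apply]
    have hint := lintegral_mono (μ := μ) hpt
    have hEi : Measurable ((E N).indicator (1 : Ω → ℝ≥0∞)) := measurable_one.indicator (hEm N)
    have hEc : ∀ x, Measurable fun ω => (E N).indicator (1 : Ω → ℝ≥0∞) (T x ω) :=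
      fun x => hEi.comp (hTm x)
    have hfc : ∀ x, Measurable fun ω => f (T x ω) := fun x => hf.comp (hTm x)
    rw [lintegral_const_mul _ (Finset.measurable_fun_sum _ fun x _ => hEc x),
      lintegral_const_mul _ (Finset.measurable_fun_sum _ fun x _ => hfc x),
      lintegral_finsetSum _ fun x _ => hEc x, lintegral_finsetSum _ fun x _ => hfc x] at hint
    simp only [(hT.preserving _).lintegral_comp hEi, (hT.preserving _).lintegral_comp hf,
      lintegral_indicator_one (hEm N), Finset.sum_const, nsmul_eq_mul] at hint
    have hc : ((cube d M).card : ℝ≥0∞) ≠ 0 := by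
      rw [card_cube]; simp
    rw [ENNReal.mul_comm_div, mul_div_assoc', ENNReal.le_div_iff_mul_le (Or.inl hc) (by simp)]
    calc t * μ (E N) * (cube d M).card = t * ((cube d M).card * μ (E N)) := by ring
      _ ≤ _ := hint
      _ = _ := by ring
  by_cases htop : 5 ^ d * ∫⁻ ω, f ω ∂μ = ∞
  · rw [htop]
    exact le_top
  refine ge_of_tendsto' (a := 5 ^ d * ∫⁻ ω, f ω ∂μ) (x := atTop) ?_ key
  have hlim : Tendsto (fun M : ℕ => ((cube d (M + N)).card : ℝ≥0∞) / (cube d M).card) atTop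
      (𝓝 1) := by
    have := (ENNReal.continuous_ofReal.tendsto 1).comp (tendsto_card_cube_add_div d N)
    rw [ENNReal.ofReal_one] at this
    refine this.congr fun M => ?_
    simp only [Function.comp_apply]
    rw [ENNReal.ofReal_div_of_pos (card_cube_pos d M), ENNReal.ofReal_natCast,
      ENNReal.ofReal_natCast]
  simpa using ENNReal.Tendsto.mul_const hlim (Or.inr htop)

end EA

/-! ### Almost sure convergence of averages over cubes -/

namespace EA

variable {d : ℕ} {Ω : Type*}

/-- The average of `f` over the translates by the sites of `cube d n`. -/
noncomputable def cubeAvg (T : Site d → Ω → Ω) (f : Ω → ℝ) (n : ℕ) (ω : Ω) : ℝ :=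
  (∑ x ∈ cube d n, f (T x ω)) / (cube d n).card

lemma cubeAvg_add (T : Site d → Ω → Ω) (f g : Ω → ℝ) (n : ℕ) (ω : Ω) :
    cubeAvg T (fun ω => f ω + g ω) n ω = cubeAvg T f n ω + cubeAvg T g n ω := by
  simp only [cubeAvg, Finset.sum_add_distrib, add_div]

lemma cubeAvg_const_mul (T : Site d → Ω → Ω) (c : ℝ) (f : Ω → ℝ) (n : ℕ) (ω : Ω) :
    cubeAvg T (fun ω => c * f ω) n ω = c * cubeAvg T f n ω := by
  simp only [cubeAvg, ← Finset.mul_sum, mul_div_assoc]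

lemma abs_cubeAvg_le (T : Site d → Ω → Ω) {f : Ω → ℝ} {C : ℝ} (hC : ∀ ω, |f ω| ≤ C) (n : ℕ)
    (ω : Ω) : |cubeAvg T f n ω| ≤ C := by
  rw [cubeAvg, abs_div, abs_of_pos (card_cube_pos d n), div_le_iff₀ (card_cube_pos d n)]
  refine (Finset.abs_sum_le_sum_abs _ _).trans ((Finset.sum_le_sum fun x _ => hC _).trans ?_)
  simp [mul_comm]

lemma abs_cubeAvg_sub_le (T : Site d → Ω → Ω) (f g : Ω → ℝ) (n : ℕ) (ω : Ω) :
    |cubeAvg T f n ω - cubeAvg T g n ω| ≤ cubeAvg T (fun ω => |f ω - g ω|) n ω := by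
  simp only [cubeAvg]
  rw [← sub_div, abs_div, abs_of_pos (card_cube_pos d n), ← Finset.sum_sub_distrib]
  gcongr
  exact Finset.abs_sum_le_sum_abs _ _

variable [MeasurableSpace Ω] {T : Site d → Ω → Ω} {μ : Measure Ω}

lemma measurable_cubeAvg (hT : ∀ x, Measurable (T x)) {f : Ω → ℝ}
    (hf : Measurable f) (n : ℕ) : Measurable (cubeAvg T f n) :=
  (Finset.measurable_fun_sum _ fun x _ => hf.comp (hT x)).div_const _

lemma IsPreservingAction.ae_forall (hT : IsPreservingAction T μ) {p : Ω → Prop}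
    (hp : ∀ᵐ ω ∂μ, p ω) : ∀ᵐ ω ∂μ, ∀ x, p (T x ω) :=
  ae_all_iff.2 fun x => (hT.preserving x).quasiMeasurePreserving.ae hp

lemma IsPreservingAction.ae_cubeAvg_eq (hT : IsPreservingAction T μ) {f g : Ω → ℝ}
    (h : f =ᵐ[μ] g) : ∀ᵐ ω ∂μ, ∀ n, cubeAvg T f n ω = cubeAvg T g n ω := by
  filter_upwards [hT.ae_forall h] with ω hω n
  simp only [cubeAvg, hω]

lemma IsPreservingAction.measure_exists_le_cubeAvg (hT : IsPreservingAction T μ) {f : Ω → ℝ}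
    (hf : Measurable f) (hf0 : ∀ ω, 0 ≤ f ω) {ε : ℝ} (hε : 0 < ε) :
    μ {ω | ∃ n, ε ≤ cubeAvg T f n ω} ≤
      5 ^ d * (∫⁻ ω, ENNReal.ofReal (f ω) ∂μ) / ENNReal.ofReal ε := by
  rw [ENNReal.le_div_iff_mul_le (by simp [hε]) (by simp), mul_comm]
  convert hT.maximal hf.ennreal_ofReal (ENNReal.ofReal ε) using 3
  ext ω
  simp only [Set.mem_ofPred_eq]
  refine exists_congr fun n => ?_
  rw [cubeAvg, le_div_iff₀ (card_cube_pos d n), ← ENNReal.ofReal_sum_of_nonneg fun _ _ => hf0 _,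
    ← ENNReal.ofReal_natCast, ← ENNReal.ofReal_mul hε.le,
    ENNReal.ofReal_le_ofReal_iff (Finset.sum_nonneg fun _ _ => hf0 _)]

/-- Both windows lie in `cube d (n + c)` and miss the same negligible fraction of it. So the
averages of coboundaries tend to 0 at every point. -/
lemma tendsto_cubeAvg_sub_comp (hT : IsPreservingAction T μ) {g : Ω → ℝ} {C : ℝ}
    (hC : ∀ ω, |g ω| ≤ C) (v : Site d) (ω : Ω) :
    Tendsto (fun n => cubeAvg T (fun ω => g (T v ω)) n ω - cubeAvg T g n ω) atTop (𝓝 0) := by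
  classical
  obtain ⟨c, hc⟩ := exists_mem_cube v
  have hC0 : 0 ≤ C := (abs_nonneg _).trans (hC ω)
  have hbound : ∀ n, |cubeAvg T (fun ω => g (T v ω)) n ω - cubeAvg T g n ω| ≤
      2 * C * (((cube d (n + c)).card : ℝ) / (cube d n).card - 1) := by
    intro n
    let B := (cube d n).map (addLeftEmbedding v)
    have h1 : ∑ x ∈ cube d n, g (T v (T x ω)) = ∑ y ∈ B, g (T y ω) := by
      simp [B, hT.add]
    have hB : B ⊆ cube d (n + c) := by
      intro y hy
      simp only [B, Finset.mem_map, addLeftEmbedding_apply] at hy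
      obtain ⟨x, hx, rfl⟩ := hy
      simpa [add_comm] using add_mem_cube hx hc
    have hdiff : ∀ S ⊆ cube d (n + c), S.card = (cube d n).card →
        |∑ y ∈ cube d (n + c), g (T y ω) - ∑ y ∈ S, g (T y ω)| ≤
          C * ((cube d (n + c)).card - (cube d n).card) := by
      intro S hS hcard
      rw [← Finset.sum_sdiff hS, add_sub_cancel_right]
      refine (Finset.abs_sum_le_sum_abs _ _).trans ((Finset.sum_le_sum fun y _ => hC _).trans ?_)
      rw [Finset.sum_const, Finset.card_sdiff_of_subset hS, hcard, nsmul_eq_mul,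
        Nat.cast_sub (by rw [← hcard]; exact Finset.card_le_card hS), mul_comm]
    have h2 := hdiff B hB (by simp [B])
    have h3 := hdiff _ (cube_mono (Nat.le_add_right n c)) rfl
    have hpos := card_cube_pos d n
    rw [cubeAvg, cubeAvg, h1, ← sub_div, abs_div, abs_of_pos hpos, div_le_iff₀ hpos]
    have h4 : 2 * C * (((cube d (n + c)).card : ℝ) / (cube d n).card - 1) * (cube d n).card =
        2 * C * ((cube d (n + c)).card - (cube d n).card) := by
      field_simp
    rw [h4]
    rw [abs_le] at h2 h3 ⊢
    constructor <;> linarith [h2.1, h2.2, h3.1, h3.2]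
  refine squeeze_zero_norm hbound ?_
  simpa using ((tendsto_card_cube_add_div d c).sub_const 1).const_mul (2 * C)

/-- The averages of `f` over cubes converge almost surely. -/
def AvgConverges (T : Site d → Ω → Ω) (μ : Measure Ω) (f : Ω → ℝ) : Prop :=
  ∀ᵐ ω ∂μ, ∃ c, Tendsto (fun n => cubeAvg T f n ω) atTop (𝓝 c)

lemma AvgConverges.congr (hT : IsPreservingAction T μ) {f g : Ω → ℝ} (hf : AvgConverges T μ f)
    (h : f =ᵐ[μ] g) : AvgConverges T μ g := by
  filter_upwards [hf, hT.ae_cubeAvg_eq h] with ω ⟨c, hc⟩ hω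
  exact ⟨c, hc.congr hω⟩

/-- Banach's principle: off a set whose measure the maximal inequality makes small, all averages of
|f - g| are below ε, so the oscillation of the averages of `f` is eventually below 3ε. -/
lemma avgConverges_of_approx (hT : IsPreservingAction T μ) {f : Ω → ℝ} (hf : Measurable f)
    (h : ∀ δ : ℝ≥0∞, 0 < δ → ∃ g : Ω → ℝ, Measurable g ∧ AvgConverges T μ g ∧
      ∫⁻ ω, ENNReal.ofReal |f ω - g ω| ∂μ ≤ δ) :
    AvgConverges T μ f := by
  have hosc : ∀ ε : ℝ, 0 < ε → ∀ᵐ ω ∂μ, ∃ N, ∀ m ≥ N, ∀ n ≥ N,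
      |cubeAvg T f m ω - cubeAvg T f n ω| < 3 * ε := by
    intro ε hε
    rw [ae_iff, ← nonpos_iff_eq_zero]
    refine ENNReal.le_of_forall_pos_le_add fun δ hδ _ => ?_
    have hε' : ENNReal.ofReal ε ≠ 0 := by simp [hε]
    -- This error cancels the factor 5^d / ε of the maximal inequality.
    obtain ⟨g, hg, hgc, hfg⟩ := h (ENNReal.ofReal ε * δ / 5 ^ d)
      (ENNReal.div_pos (mul_ne_zero hε' (by exact_mod_cast hδ.ne')) (by simp))
    have hmax := hT.measure_exists_le_cubeAvg (f := fun ω => |f ω - g ω|)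
      (hf.sub hg).abs (fun _ => abs_nonneg _) hε
    have hle : 5 ^ d * (∫⁻ ω, ENNReal.ofReal |f ω - g ω| ∂μ) / ENNReal.ofReal ε ≤ δ := by
      refine ENNReal.div_le_of_le_mul ?_
      calc 5 ^ d * (∫⁻ ω, ENNReal.ofReal |f ω - g ω| ∂μ)
          ≤ 5 ^ d * (ENNReal.ofReal ε * δ / 5 ^ d) := by gcongr
        _ = ENNReal.ofReal ε * δ := ENNReal.mul_div_cancel (by simp) (by simp)
        _ = δ * ENNReal.ofReal ε := mul_comm _ _
    rw [zero_add]
    refine (measure_mono_ae ?_).trans (hmax.trans hle)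
    filter_upwards [hgc] with ω ⟨c, hc⟩ hω
    by_contra hcon
    replace hcon : ∀ n, cubeAvg T (fun ω => |f ω - g ω|) n ω < ε :=
      fun n => not_le.1 fun h => hcon ⟨n, h⟩
    refine hω ?_
    obtain ⟨N, hN⟩ := Metric.cauchySeq_iff.1 hc.cauchySeq ε hε
    refine ⟨N, fun m hm n hn => ?_⟩
    have h1 := (abs_cubeAvg_sub_le T f g m ω).trans_lt (hcon m)
    have h2 := (abs_cubeAvg_sub_le T f g n ω).trans_lt (hcon n)
    have h3 := hN m hm n hn
    rw [Real.dist_eq] at h3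
    rw [abs_lt] at h1 h2 h3 ⊢
    constructor <;> linarith [h1.1, h1.2, h2.1, h2.2, h3.1, h3.2]
  have hall : ∀ᵐ ω ∂μ, ∀ k : ℕ, ∃ N, ∀ m ≥ N, ∀ n ≥ N,
      |cubeAvg T f m ω - cubeAvg T f n ω| < 3 * (1 / ((k : ℝ) + 1)) :=
    ae_all_iff.2 fun k => hosc _ Nat.one_div_pos_of_nat
  filter_upwards [hall] with ω hω
  refine cauchySeq_tendsto_of_complete (Metric.cauchySeq_iff.2 fun ε hε => ?_)
  obtain ⟨k, hk⟩ := exists_nat_one_div_lt (show 0 < ε / 3 by positivity)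
  obtain ⟨N, hN⟩ := hω k
  refine ⟨N, fun m hm n hn => ?_⟩
  rw [Real.dist_eq]
  exact (hN m hm n hn).trans (by linarith)

lemma avgConverges_of_invariant {h : Ω → ℝ}
    (hh : ∀ v, (fun ω => h (T v ω)) =ᵐ[μ] h) : AvgConverges T μ h := by
  filter_upwards [ae_all_iff.2 hh] with ω hω
  refine ⟨h ω, tendsto_const_nhds.congr fun n => ?_⟩
  simp only [cubeAvg, hω]
  simp [(card_cube_pos d n).ne']

variable [IsProbabilityMeasure μ]

/-- The square integrable functions whose averages converge almost surely. -/
def convergentSubmodule (hT : IsPreservingAction T μ) : Submodule ℝ (Lp ℝ 2 μ) where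
  carrier := {f | AvgConverges T μ f}
  zero_mem' := by
    refine AvgConverges.congr hT (f := fun _ => 0) ?_ (Lp.coeFn_zero ℝ 2 μ).symm
    exact .of_forall fun ω => ⟨0, by simp [cubeAvg]⟩
  add_mem' := by
    intro f g hf hg
    refine AvgConverges.congr hT (f := fun ω => f ω + g ω) ?_ (Lp.coeFn_add f g).symm
    filter_upwards [hf, hg] with ω ⟨c, hc⟩ ⟨c', hc'⟩
    exact ⟨c + c', by simpa only [cubeAvg_add] using hc.add hc'⟩
  smul_mem' := by
    intro a f hf
    refine AvgConverges.congr hT (f := fun ω => a * f ω) ?_ (Lp.coeFn_smul a f).symm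
    filter_upwards [hf] with ω ⟨c, hc⟩
    exact ⟨a * c, by simpa only [cubeAvg_const_mul] using hc.const_mul a⟩

lemma isClosed_convergentSubmodule (hT : IsPreservingAction T μ) :
    IsClosed (convergentSubmodule hT : Set (Lp ℝ 2 μ)) := by
  refine isClosed_of_closure_subset fun f hf => ?_
  refine avgConverges_of_approx hT (Lp.stronglyMeasurable f).measurable fun δ hδ => ?_
  obtain ⟨g, hg, hfg⟩ := EMetric.mem_closure_iff.1 hf δ hδ
  refine ⟨g, (Lp.stronglyMeasurable g).measurable, hg, ?_⟩
  rw [Lp.edist_def] at hfg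
  have h1 := eLpNorm_le_eLpNorm_of_exponent_le (μ := μ) (p := 1) (q := 2) (by norm_num)
    ((Lp.aestronglyMeasurable f).sub (Lp.aestronglyMeasurable g))
  refine le_trans (le_of_eq ?_) (h1.trans hfg.le)
  rw [eLpNorm_one_eq_lintegral_enorm]
  simp [Real.enorm_eq_ofReal_abs]

/-- The submodule is closed and contains the bounded coboundaries. A vector orthogonal to them is
invariant, so its own averages converge. It then lies in the submodule and is orthogonal to itself.
-/
lemma convergentSubmodule_eq_top (hT : IsPreservingAction T μ) : convergentSubmodule hT = ⊤ := by
  have hcl := isClosed_convergentSubmodule hT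
  have : CompleteSpace (convergentSubmodule hT) := hcl.completeSpace_coe
  rw [← Submodule.orthogonal_eq_bot_iff, Submodule.eq_bot_iff]
  intro h hh
  rw [Submodule.mem_orthogonal] at hh
  have hhi : Integrable h μ := (Lp.memLp h).integrable (by norm_num)
  have hinv : ∀ v, (fun ω => h (T v ω)) =ᵐ[μ] h := by
    intro v
    refine Integrable.ae_eq_of_forall_setIntegral_eq _ _
      ((hT.preserving v).integrable_comp_of_integrable hhi) hhi fun s hs _ => ?_
    have hTv : Measurable (T (-v)) := (hT.preserving (-v)).measurable
    let a : Ω → ℝ := s.indicator 1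
    have ha : ∀ ω, |a ω| ≤ 1 := fun ω => by
      by_cases hω : ω ∈ s <;> simp [a, hω]
    have ham : Measurable a := measurable_one.indicator hs
    let g : Ω → ℝ := fun ω => a (T (-v) ω) - a ω
    have hgm : MemLp g 2 μ := by
      refine MemLp.of_bound ((ham.comp hTv).sub ham).aestronglyMeasurable 2 (.of_forall fun ω => ?_)
      have h1 := ha (T (-v) ω)
      have h2 := ha ω
      rw [Real.norm_eq_abs]
      refine (abs_sub _ _).trans (by linarith)
    have hg : hgm.toLp g ∈ convergentSubmodule hT := by
      refine AvgConverges.congr hT (f := g) ?_ (MemLp.coeFn_toLp hgm).symm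
      refine .of_forall fun ω => ⟨0, (tendsto_cubeAvg_sub_comp hT ha (-v) ω).congr fun n => ?_⟩
      simp only [g, cubeAvg, Finset.sum_sub_distrib, sub_div]
    have h0 := hh _ hg
    rw [L2.inner_def] at h0
    have h1 : ∫ ω, (h ω * a (T (-v) ω) - h ω * a ω) ∂μ = 0 := by
      rw [← h0]
      refine integral_congr_ae ?_
      filter_upwards [MemLp.coeFn_toLp hgm] with ω hω
      simp only [hω, g, RCLike.inner_apply, conj_trivial]
      ring
    have hi1 : Integrable (fun ω => h ω * a (T (-v) ω)) μ :=
      hhi.mul_bdd (c := 1) (ham.comp hTv).aestronglyMeasurable (.of_forall fun ω => ha _)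
    have hi2 : Integrable (fun ω => h ω * a ω) μ :=
      hhi.mul_bdd (c := 1) ham.aestronglyMeasurable (.of_forall fun ω => ha _)
    rw [integral_sub hi1 hi2, sub_eq_zero] at h1
    -- Change of variables by `T v`, which turns orthogonality to the coboundary of 1_s into
    -- equality of the integrals of `h ∘ T v` and `h` over s.
    have h2 : ∫ ω, h ω * a (T (-v) ω) ∂μ = ∫ ω, h (T v ω) * a ω ∂μ := by
      have h3 : ∀ ω, T (-v) (T v ω) = ω := fun ω => by
        rw [← hT.add, neg_add_cancel, hT.zero]
      have h4 : ∀ ω, T v (T (-v) ω) = ω := fun ω => by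
        rw [← hT.add, add_neg_cancel, hT.zero]
      let e : Ω ≃ᵐ Ω := ⟨⟨T v, T (-v), h3, h4⟩, (hT.preserving v).measurable, hTv⟩
      rw [← (show MeasurePreserving e μ μ from hT.preserving v).integral_comp'
        (g := fun ω => h ω * a (T (-v) ω))]
      exact integral_congr_ae (.of_forall fun ω => by
        simp only [e, MeasurableEquiv.coe_mk, Equiv.coe_fn_mk, h3])
    have hind : ∀ f : Ω → ℝ, ∫ ω in s, f ω ∂μ = ∫ ω, f ω * a ω ∂μ := fun f => by
      rw [← integral_indicator hs]
      refine integral_congr_ae (.of_forall fun ω => ?_)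
      by_cases hω : ω ∈ s <;> simp [a, hω]
    rw [hind, hind, ← h2, h1]
  have := hh h (avgConverges_of_invariant hinv)
  exact inner_self_eq_zero.1 this

/-- **Pointwise ergodic theorem** for bounded functions. -/
theorem IsPreservingAction.ae_exists_tendsto_cubeAvg (hT : IsPreservingAction T μ) {f : Ω → ℝ}
    (hf : Measurable f) {C : ℝ} (hC : ∀ ω, |f ω| ≤ C) :
    ∀ᵐ ω ∂μ, ∃ c, Tendsto (fun n => cubeAvg T f n ω) atTop (𝓝 c) := by
  have hm : MemLp f 2 μ := MemLp.of_bound hf.aestronglyMeasurable C (.of_forall hC)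
  have h : hm.toLp f ∈ convergentSubmodule hT := by
    rw [convergentSubmodule_eq_top]; trivial
  exact AvgConverges.congr hT h (MemLp.coeFn_toLp hm)

end EA

namespace EA

variable {d : ℕ}

/-! ### Measures on the space of states -/

/-- The event that all spins in `U` are up. -/
def allUp (U : Finset (Site d)) : Set (Config d) := {σ | ∀ x ∈ U, σ x = 1}

lemma allUp_empty : allUp (∅ : Finset (Site d)) = Set.univ := by simp [allUp]

lemma measurableSet_allUp (U : Finset (Site d)) : MeasurableSet (allUp U) := by
  have : allUp U = ⋂ x ∈ U, (fun σ : Config d => σ x) ⁻¹' {1} := by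
    ext σ; simp [allUp]
  rw [this]
  exact U.measurableSet_biInter fun x _ => measurable_pi_apply x (measurableSet_singleton 1)

lemma isPiSystem_allUp : IsPiSystem (Set.range (allUp (d := d))) := by
  classical
  rintro _ ⟨U, rfl⟩ _ ⟨V, rfl⟩ _
  refine ⟨U ∪ V, ?_⟩
  ext σ
  simp only [allUp, Finset.mem_union, Set.mem_inter_iff, Set.mem_ofPred_eq]
  exact ⟨fun h => ⟨fun x hx => h x (Or.inl hx), fun x hx => h x (Or.inr hx)⟩,
    fun h x hx => hx.elim (h.1 x) (h.2 x)⟩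

lemma generateFrom_allUp :
    (MeasurableSpace.pi : MeasurableSpace (Config d)) =
      MeasurableSpace.generateFrom (Set.range allUp) := by
  refine le_antisymm (iSup_le fun x => ?_) (MeasurableSpace.generateFrom_le ?_)
  · rw [← measurable_iff_comap_le]
    have h1 : MeasurableSet[MeasurableSpace.generateFrom (Set.range allUp)]
        ((fun σ : Config d => σ x) ⁻¹' {1}) := by
      refine MeasurableSpace.measurableSet_generateFrom ⟨{x}, ?_⟩
      ext σ; simp [allUp]
    refine @measurable_to_countable' ℤˣ (Config d) _ _ (MeasurableSpace.generateFrom (Set.range allUp)) _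
      fun u => ?_
    rcases Int.units_eq_one_or u with rfl | rfl
    · exact h1
    · convert h1.compl using 1
      ext σ
      rcases Int.units_eq_one_or (σ x) with h | h <;> simp [h]
  · rintro _ ⟨U, rfl⟩
    exact measurableSet_allUp U

lemma measure_ext_allUp {μ μ' : Measure (Config d)} [IsFiniteMeasure μ]
    (h : ∀ U, μ (allUp U) = μ' (allUp U)) : μ = μ' := by
  refine ext_of_generate_finite _ generateFrom_allUp isPiSystem_allUp ?_ ?_
  · rintro _ ⟨U, rfl⟩; exact h U
  · simpa [allUp_empty] using h ∅

lemma measurable_state {X : Type*} [MeasurableSpace X] {f : X → State d}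
    (h : ∀ U, Measurable fun x => (f x : Measure (Config d)) (allUp U)) : Measurable f := by
  refine Measurable.subtype_mk (f := fun x => (f x : Measure (Config d))) ?_
  refine Measurable.measure_of_isPiSystem_of_isProbabilityMeasure generateFrom_allUp
    isPiSystem_allUp ?_
  rintro _ ⟨U, rfl⟩
  exact h U

lemma measurable_state_apply {A : Set (Config d)} (hA : MeasurableSet A) :
    Measurable fun ρ : State d => (ρ : Measure (Config d)) A :=
  (Measure.measurable_coe hA).comp measurable_subtype_coe

lemma measurable_state_real {A : Set (Config d)} (hA : MeasurableSet A) :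
    Measurable fun ρ : State d => (ρ : Measure (Config d)).real A :=
  (measurable_state_apply hA).ennreal_toReal

/-- A state, as a kernel. -/
def stateKernel (d : ℕ) : Kernel (State d) (Config d) := ⟨fun ρ => ρ, measurable_subtype_coe⟩

instance : IsMarkovKernel (stateKernel d) :=
  ⟨fun ρ => inferInstanceAs (IsProbabilityMeasure (ρ : Measure (Config d)))⟩

lemma measurable_lintegral_state {X : Type*} [MeasurableSpace X] {f : X × Config d → ℝ≥0∞}
    (hf : Measurable f) :
    Measurable fun p : X × State d => ∫⁻ ω, f (p.1, ω) ∂(p.2 : Measure (Config d)) := by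
  have h : Measurable fun q : (X × State d) × Config d => f (q.1.1, q.2) :=
    hf.comp ((measurable_fst.comp measurable_fst).prodMk measurable_snd)
  exact h.lintegral_kernel_prod_right' (κ := (stateKernel d).comap Prod.snd measurable_snd)

lemma measurable_integral_state {X : Type*} [MeasurableSpace X] {f : X × Config d → ℝ}
    (hf : Measurable f) :
    Measurable fun p : X × State d => ∫ ω, f (p.1, ω) ∂(p.2 : Measure (Config d)) := by
  have h : Measurable fun q : (X × State d) × Config d => f (q.1.1, q.2) :=
    hf.comp ((measurable_fst.comp measurable_fst).prodMk measurable_snd)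
  exact (h.stronglyMeasurable.integral_kernel_prod_right'
    (κ := (stateKernel d).comap Prod.snd measurable_snd)).measurable

/-- Since the events `allUp U` determine a measure, countably many equations suffice. This makes the
Gibbs property measurable and lets it be checked almost surely, one equation at a time. -/
lemma isGibbs_iff {β : ℝ} {J : Couplings d} {Γ : State d} :
    IsGibbs β J Γ ↔ ∀ (W U : Finset (Site d)), (Γ : Measure (Config d)) (allUp U) =
      ∫⁻ ω, gibbsKernel β W (J, ω) (allUp U) ∂(Γ : Measure (Config d)) := by
  refine ⟨fun h W U => h.2 W _ (measurableSet_allUp U), fun h => ⟨inferInstance, fun W A hA => ?_⟩⟩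
  let K : Kernel (Config d) (Config d) :=
    (gibbsKernel β W).comap (fun ω => (J, ω)) (measurable_const.prodMk measurable_id)
  have hb : (Γ : Measure (Config d)) = K ∘ₘ (Γ : Measure (Config d)) := by
    refine measure_ext_allUp fun U => ?_
    rw [Measure.bind_apply (measurableSet_allUp U) K.measurable.aemeasurable]
    exact h W U
  conv_lhs => rw [hb]
  rw [Measure.bind_apply hA K.measurable.aemeasurable]
  rfl

lemma measurableSet_isGibbs (β : ℝ) :
    MeasurableSet {p : Couplings d × State d | IsGibbs β p.1 p.2} := by
  simp only [isGibbs_iff, Set.ofPred_forall]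
  refine MeasurableSet.iInter fun W => MeasurableSet.iInter fun U => measurableSet_eq_fun ?_ ?_
  · exact (measurable_state_apply (measurableSet_allUp U)).comp measurable_snd
  · exact measurable_lintegral_state (f := fun q => gibbsKernel β W q (allUp U))
      ((gibbsKernel β W).measurable_coe (measurableSet_allUp U))

/-- Induction for continuous functions on a product of intervals: it is enough to consider the
monomials. -/
lemma continuousMap_induction {ι : Type*} {P : C(ι → unitInterval, ℝ) → Prop}
    (mono : ∀ (s : ℕ) (u : Fin s → ι) (g : C(ι → unitInterval, ℝ)),
      (∀ z, g z = ∏ i, (z (u i) : ℝ)) → P g)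
    (add : ∀ f g, P f → P g → P (f + g)) (smul : ∀ (c : ℝ) f, P f → P (c • f))
    (lim : ∀ (g : ℕ → C(ι → unitInterval, ℝ)) (f), (∀ n, P (g n)) → Tendsto g atTop (𝓝 f) → P f)
    (f : C(ι → unitInterval, ℝ)) : P f := by
  let co : ι → C(ι → unitInterval, ℝ) := fun i =>
    ⟨fun z => (z i : ℝ), continuous_subtype_val.comp (continuous_apply i)⟩
  let S : Subalgebra ℝ C(ι → unitInterval, ℝ) := Algebra.adjoin ℝ (Set.range co)
  -- The coordinates separate points, so Stone–Weierstrass makes the polynomials dense.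
  have hsep : S.SeparatesPoints := by
    intro z w hzw
    obtain ⟨i, hi⟩ := Function.ne_iff.1 hzw
    exact ⟨co i, ⟨co i, Algebra.subset_adjoin ⟨i, rfl⟩, rfl⟩, fun h => hi (Subtype.ext h)⟩
  have htop := ContinuousMap.subalgebra_topologicalClosure_eq_top_of_separatesPoints S hsep
  have hS : ∀ g ∈ S, P g := by
    intro g hg
    have hg' : g ∈ Submodule.span ℝ (Submonoid.closure (Set.range co) : Set _) := by
      rw [← Algebra.adjoin_eq_span]; exact hg
    clear hg
    induction hg' using Submodule.span_induction with
    | mem g hg =>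
      obtain ⟨l, hl, rfl⟩ := Submonoid.exists_list_of_mem_closure hg
      choose u hu using fun i : Fin l.length => hl _ (l.get_mem i)
      refine mono l.length u _ fun z => ?_
      have : ∀ l : List C(ι → unitInterval, ℝ), (l.prod) z = (l.map fun f => f z).prod := by
        intro l
        induction l with
        | nil => simp
        | cons a l ih => simp [ih]
      rw [this, ← List.prod_ofFn]
      congr 1
      refine List.ext_get (by simp) fun n h1 h2 => ?_
      simp only [List.get_eq_getElem, List.getElem_map, List.getElem_ofFn]
      have h3 : n < l.length := by simpa using h1
      have := hu ⟨n, h3⟩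
      rw [List.get_eq_getElem] at this
      rw [← this]
      rfl
    -- The zero function is 0 times the empty monomial.
    | zero => simpa using smul 0 _ (mono 0 Fin.elim0 1 (by simp))
    | add f g _ _ hf hg => exact add f g hf hg
    | smul c f _ hf => exact smul c f hf
  have hmem : f ∈ closure (S : Set C(ι → unitInterval, ℝ)) := by
    have : f ∈ S.topologicalClosure := by rw [htop]; trivial
    exact this
  obtain ⟨g, hg, hlim⟩ := mem_closure_iff_seq_limit.1 hmem
  exact lim g f (fun n => hS _ (hg n)) hlim

/-- The probabilities of the events `allUp U` in a state. -/
noncomputable def upProb (ρ : State d) (U : Finset (Site d)) : unitInterval :=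
  ⟨(ρ : Measure (Config d)).real (allUp U), measureReal_nonneg, measureReal_le_one⟩

lemma measurable_upProb : Measurable (upProb (d := d)) :=
  measurable_pi_lambda _ fun U => (measurable_state_real (measurableSet_allUp U)).subtype_mk

/-- States are coded by points of a compact cube with countably many coordinates. Questions about
measures on states become questions about moments there. -/
lemma comap_upProb :
    MeasurableSpace.comap (upProb (d := d)) MeasurableSpace.pi =
      (inferInstance : MeasurableSpace (State d)) := by
  refine le_antisymm measurable_upProb.comap_le ?_
  have : @Measurable _ _ (MeasurableSpace.comap (upProb (d := d)) MeasurableSpace.pi) _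
      (id : State d → State d) := by
    let _ : MeasurableSpace (State d) := MeasurableSpace.comap (upProb (d := d)) MeasurableSpace.pi
    refine @measurable_state d (State d) _ id fun U => ?_
    have h1 : Measurable (upProb (d := d)) := comap_measurable _
    have h2 : Measurable fun ρ : State d => ENNReal.ofReal (upProb ρ U : ℝ) :=
      (measurable_subtype_coe.comp ((measurable_pi_apply U).comp h1)).ennreal_ofReal
    refine (congrArg _ (funext fun ρ => ?_)).mp h2
    exact ENNReal.ofReal_toReal (measure_ne_top _ _)
  simpa using this.comap_le

lemma exists_preimage_upProb {B : Set (State d)} (hB : MeasurableSet B) :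
    ∃ C : Set (Finset (Site d) → unitInterval), MeasurableSet C ∧ upProb ⁻¹' C = B := by
  have : MeasurableSet[MeasurableSpace.comap (upProb (d := d)) MeasurableSpace.pi] B := by
    rw [comap_upProb]; exact hB
  exact this

/-- The random probability of the joint occurrence of the events `allUp (u i)` in independent
replicas. -/
noncomputable def upProd {s : ℕ} (u : Fin s → Finset (Site d)) (ρ : State d) : ℝ :=
  ∏ i, (ρ : Measure (Config d)).real (allUp (u i))

lemma measurable_upProd {s : ℕ} (u : Fin s → Finset (Site d)) : Measurable (upProd u) :=
  Finset.measurable_fun_prod _ fun i _ => measurable_state_real (measurableSet_allUp (u i))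

/-- Induction for the integrals of continuous functions of the probabilities `upProb`. -/
lemma integral_upProb_induction {X : Type*} (m : X → Measure (State d)) [∀ x, IsFiniteMeasure (m x)]
    {P : (X → ℝ) → Prop}
    (mono : ∀ (s : ℕ) (u : Fin s → Finset (Site d)), P fun x => ∫ ρ, upProd u ρ ∂m x)
    (add : ∀ f g, P f → P g → P fun x => f x + g x)
    (smul : ∀ (c : ℝ) f, P f → P fun x => c * f x)
    (lim : ∀ (g : ℕ → X → ℝ) (f : X → ℝ), (∀ n, P (g n)) →
      (∀ x, Tendsto (fun n => g n x) atTop (𝓝 (f x))) → P f)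
    (f : C(Finset (Site d) → unitInterval, ℝ)) : P fun x => ∫ ρ, f (upProb ρ) ∂m x := by
  have hint : ∀ (f : C(Finset (Site d) → unitInterval, ℝ)) x,
      Integrable (fun ρ => f (upProb ρ)) (m x) := fun f x =>
    Bounded.integrable (f.continuous.measurable.comp measurable_upProb) fun ρ =>
      f.norm_coe_le_norm (upProb ρ)
  induction f using continuousMap_induction with
  | mono s u g hg => simpa only [hg, upProd, upProb] using mono s u
  | add f g hf hg =>
    refine (congrArg P (funext fun x => ?_)).mp (add _ _ hf hg)
    rw [← integral_add (hint f x) (hint g x)]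
    rfl
  | smul c f hf =>
    refine (congrArg P (funext fun x => ?_)).mp (smul c _ hf)
    rw [← integral_const_mul]
    rfl
  | lim g f hg hlim =>
    refine lim _ _ hg fun x => ?_
    rw [tendsto_iff_norm_sub_tendsto_zero]
    have h0 : Tendsto (fun n => ‖g n - f‖ * (m x).real Set.univ) atTop (𝓝 (0 * (m x).real Set.univ)) :=
      (tendsto_iff_norm_sub_tendsto_zero.1 hlim).mul_const _
    rw [zero_mul] at h0
    refine squeeze_zero (fun _ => norm_nonneg _) (fun n => ?_) h0
    rw [← integral_sub (hint _ x) (hint _ x)]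
    exact norm_integral_le_of_norm_le_const (.of_forall fun ρ => (g n - f).norm_coe_le_norm _)

/-- A finite measure on states is determined by its moments. -/
lemma measure_state_ext {P Q : Measure (State d)} [IsFiniteMeasure P] [IsFiniteMeasure Q]
    (h : ∀ (s : ℕ) (u : Fin s → Finset (Site d)), ∫ ρ, upProd u ρ ∂P = ∫ ρ, upProd u ρ ∂Q) :
    P = Q := by
  -- The two measures form one family indexed by `Bool`, and the property carried through the
  -- induction is equality of its two values.
  let m : Bool → Measure (State d) := fun b => cond b P Q
  have : ∀ b, IsFiniteMeasure (m b) := fun b => by cases b <;> assumption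
  have key : ∀ f : C(Finset (Site d) → unitInterval, ℝ),
      ∫ ρ, f (upProb ρ) ∂P = ∫ ρ, f (upProb ρ) ∂Q := by
    refine integral_upProb_induction m (P := fun F => F true = F false) h ?_ ?_ ?_
    · intro f g hf hg; simp only [hf, hg]
    · intro c f hf; simp only [hf]
    · intro g f hg hlim
      exact tendsto_nhds_unique (hlim true) (by simpa only [hg] using hlim false)
  have hmap : P.map upProb = Q.map upProb := by
    refine ext_of_forall_integral_eq_of_IsFiniteMeasure fun f => ?_
    rw [integral_map measurable_upProb.aemeasurable f.continuous.measurable.aestronglyMeasurable,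
      integral_map measurable_upProb.aemeasurable f.continuous.measurable.aestronglyMeasurable]
    exact key f.toContinuousMap
  ext B hB
  obtain ⟨C, hC, rfl⟩ := exists_preimage_upProb hB
  rw [← Measure.map_apply measurable_upProb hC, hmap, Measure.map_apply measurable_upProb hC]

/-- A family of finite measures on states is measurable if its moments are. -/
lemma measurable_of_moments {X : Type*} [MeasurableSpace X] (m : X → Measure (State d))
    [∀ x, IsFiniteMeasure (m x)]
    (h : ∀ (s : ℕ) (u : Fin s → Finset (Site d)), Measurable fun x => ∫ ρ, upProd u ρ ∂m x) :
    Measurable m := by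
  have key : ∀ f : C(Finset (Site d) → unitInterval, ℝ),
      Measurable fun x => ∫ ρ, f (upProb ρ) ∂m x :=
    integral_upProb_induction m h (fun f g hf hg => hf.add hg) (fun c f hf => hf.const_mul c)
      fun g f hg hlim => measurable_of_tendsto_metrizable hg (tendsto_pi_nhds.2 hlim)
  -- The indicator of a closed set is a limit of continuous functions. Closed sets form a generating
  -- π-system, which then gives all Borel sets.
  have hclosed : ∀ F : Set (Finset (Site d) → unitInterval), IsClosed F →
      Measurable fun x => (m x).map upProb F := by
    intro F hF
    refine measurable_of_tendsto_metrizable (f := fun n x => ∫⁻ z, hF.apprSeq n z ∂(m x).map upProb)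
      (fun n => ?_) (tendsto_pi_nhds.2 fun x => HasOuterApproxClosed.tendsto_lintegral_apprSeq hF _)
    refine (congrArg Measurable (funext fun x => ?_)).mp
      (key ⟨fun z => (hF.apprSeq n z : ℝ), by fun_prop⟩).ennreal_ofReal
    rw [lintegral_map (by fun_prop) measurable_upProb]
    have hm : Measurable fun ρ => (hF.apprSeq n (upProb (d := d) ρ) : ℝ) :=
      Measurable.comp (g := fun z => (hF.apprSeq n z : ℝ)) (by fun_prop) measurable_upProb
    simp only [ContinuousMap.coe_mk]
    rw [ofReal_integral_eq_lintegral_ofReal (Bounded.integrable hm (C := 1) fun ρ => ?_)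
      (.of_forall fun _ => NNReal.coe_nonneg _)]
    · simp only [ENNReal.ofReal_coe_nnreal]
    · rw [abs_of_nonneg (NNReal.coe_nonneg _)]
      exact_mod_cast HasOuterApproxClosed.apprSeq_apply_le_one hF n _
  have hmap : Measurable fun x => (m x).map upProb := by
    refine Measurable.measure_of_isPiSystem (S := {F | IsClosed F})
      (BorelSpace.measurable_eq.trans borel_eq_generateFrom_isClosed) isPiSystem_isClosed (fun F hF => hclosed F hF)
      (hclosed _ isClosed_univ)
  refine Measure.measurable_of_measurable_coe _ fun B hB => ?_
  obtain ⟨C, hC, rfl⟩ := exists_preimage_upProb hB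
  simp only [← Measure.map_apply measurable_upProb hC]
  exact (Measure.measurable_coe hC).comp hmap

end EA

namespace EA

variable {d : ℕ}

/-! ### Tail limits of conditional means -/

/-- The indicator of `allUp U`. -/
noncomputable def upInd (U : Finset (Site d)) : Config d → ℝ := (allUp U).indicator 1

lemma measurable_upInd (U : Finset (Site d)) : Measurable (upInd U) :=
  measurable_one.indicator (measurableSet_allUp U)

lemma abs_upInd_le (U : Finset (Site d)) (σ : Config d) : |upInd U σ| ≤ 1 := by
  by_cases h : σ ∈ allUp U <;> simp [upInd, h]

lemma integral_upInd (μ : Measure (Config d)) (U : Finset (Site d)) :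
    ∫ σ, upInd U σ ∂μ = μ.real (allUp U) :=
  integral_indicator_one (measurableSet_allUp U)

lemma isGibbs_iff_integral {β : ℝ} {J : Couplings d} {Γ : State d} :
    IsGibbs β J Γ ↔ ∀ (W U : Finset (Site d)),
      ∫ ω, localMean β J W (upInd U) ω ∂(Γ : Measure (Config d)) =
        ∫ ω, upInd U ω ∂(Γ : Measure (Config d)) := by
  refine ⟨fun h W U => h.integral_localMean W (measurable_upInd U) (abs_upInd_le U), fun h => ?_⟩
  refine isGibbs_iff.2 fun W U => ?_
  have h1 : ∀ ω, gibbsKernel β W (J, ω) (allUp U) =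
      ENNReal.ofReal (localMean β J W (upInd U) ω) := by
    intro ω
    rw [← integral_boltzmann_localHamiltonian, integral_upInd]
    exact (ENNReal.ofReal_toReal (measure_ne_top _ _)).symm
  have h2 : ∀ ω, 0 ≤ localMean β J W (upInd U) ω := fun ω => by
    rw [← integral_boltzmann_localHamiltonian, integral_upInd]
    exact measureReal_nonneg
  simp only [h1]
  rw [← ofReal_integral_eq_lintegral_ofReal (Bounded.integrable
    (measurable_localMean β J W (measurable_upInd U))
    (abs_localMean_le β J W (abs_upInd_le U))) (.of_forall h2), h W U, integral_upInd]
  exact (ENNReal.ofReal_toReal (measure_ne_top _ _)).symm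

/-- A function which does not depend on finitely many spins. -/
def IsTail {α : Type*} (g : Config d → α) : Prop := ∀ W, Exterior W g

lemma isTail_of_cube {α : Type*} {g : Config d → α} (h : ∀ n, Exterior (cube d n) g) :
    IsTail g := fun W => by
  obtain ⟨c, hc⟩ := exists_subset_cube W
  exact (h c).mono hc

section Limits

variable {β : ℝ} {J : Couplings d} {Γ : State d} {f : Config d → ℝ} {C : ℝ}

lemma integral_sub_sub {Ω : Type*} [MeasurableSpace Ω] {μ : Measure Ω} {a b c : Ω → ℝ}
    (ha : Integrable a μ) (hb : Integrable b μ) (hc : Integrable c μ) :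
    ∫ ω, (a ω - (b ω - c ω)) ∂μ = ∫ ω, a ω ∂μ - (∫ ω, b ω ∂μ - ∫ ω, c ω ∂μ) := by
  rw [← integral_sub hb hc]
  exact integral_sub ha (hb.sub hc)

lemma integral_sub_integral_sq {Ω : Type*} [MeasurableSpace Ω] {μ : Measure Ω}
    [IsProbabilityMeasure μ] {x : Ω → ℝ} (hx : Measurable x) (hC : ∀ ω, |x ω| ≤ C) :
    ∫ ω, (x ω - ∫ ω', x ω' ∂μ) ^ 2 ∂μ = ∫ ω, x ω ^ 2 ∂μ - (∫ ω, x ω ∂μ) ^ 2 := by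
  have hi : Integrable x μ := Bounded.integrable hx hC
  have hi2 : Integrable (fun ω => x ω ^ 2) μ := Bounded.integrable (hx.pow_const 2) (C := C ^ 2)
    fun ω => by rw [abs_pow]; exact pow_le_pow_left₀ (abs_nonneg _) (hC ω) 2
  set c := ∫ ω', x ω' ∂μ with hc
  have : ∀ ω, (x ω - c) ^ 2 = x ω ^ 2 - (2 * c * x ω - c ^ 2) := fun ω => by ring
  simp only [this]
  rw [integral_sub_sub hi2 (hi.const_mul _) (integrable_const _), integral_const_mul, ← hc]
  simp
  ring

lemma sq_integral_le {Ω : Type*} [MeasurableSpace Ω] {μ : Measure Ω} [IsProbabilityMeasure μ]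
    {x : Ω → ℝ} (hx : Measurable x) (hC : ∀ ω, |x ω| ≤ C) :
    (∫ ω, x ω ∂μ) ^ 2 ≤ ∫ ω, x ω ^ 2 ∂μ := by
  have h : 0 ≤ ∫ ω, (x ω - ∫ ω', x ω' ∂μ) ^ 2 ∂μ := integral_nonneg fun _ => sq_nonneg _
  rw [integral_sub_integral_sq hx hC] at h
  linarith

/-- The mean over the larger cube is exterior to both cubes, so both integrals equal its integral
against `f`. This is the orthogonality of reverse martingale increments. -/
lemma IsGibbs.integral_mul_cube (h : IsGibbs β J Γ) (hf : Measurable f) (hC : ∀ σ, |f σ| ≤ C)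
    {n m : ℕ} (hnm : n ≤ m) :
    ∫ ω, localMean β J (cube d m) f ω * localMean β J (cube d n) f ω ∂(Γ : Measure (Config d)) =
      ∫ ω, localMean β J (cube d m) f ω ^ 2 ∂(Γ : Measure (Config d)) := by
  have hm := measurable_localMean β J (cube d m) hf
  have hb := abs_localMean_le β J (cube d m) hC
  have he := exterior_localMean β J (cube d m) f
  simp only [sq]
  rw [h.integral_mul_localMean hf hC hm hb (he.mono (cube_mono hnm)),
    h.integral_mul_localMean hf hC hm hb he]

lemma integrable_localMean_mul (hf : Measurable f) (hC : ∀ σ, |f σ| ≤ C) (V W : Finset (Site d)) :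
    Integrable (fun ω => localMean β J V f ω * localMean β J W f ω) (Γ : Measure (Config d)) :=
  Bounded.integrable ((measurable_localMean β J V hf).mul (measurable_localMean β J W hf))
    (C := C * C) fun ω => by
      rw [abs_mul]
      exact mul_le_mul (abs_localMean_le β J V hC ω) (abs_localMean_le β J W hC ω) (abs_nonneg _)
        ((abs_nonneg _).trans (hC ω))

lemma IsGibbs.integral_sq_sub (h : IsGibbs β J Γ) (hf : Measurable f) (hC : ∀ σ, |f σ| ≤ C)
    {n m : ℕ} (hnm : n ≤ m) :
    ∫ ω, (localMean β J (cube d n) f ω - localMean β J (cube d m) f ω) ^ 2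
        ∂(Γ : Measure (Config d)) =
      ∫ ω, localMean β J (cube d n) f ω ^ 2 ∂(Γ : Measure (Config d)) -
        ∫ ω, localMean β J (cube d m) f ω ^ 2 ∂(Γ : Measure (Config d)) := by
  have hi := fun V W => integrable_localMean_mul (β := β) (J := J) (Γ := Γ) hf hC V W
  have h1 := h.integral_mul_cube hf hC hnm
  have : ∀ ω, (localMean β J (cube d n) f ω - localMean β J (cube d m) f ω) ^ 2 =
      localMean β J (cube d n) f ω * localMean β J (cube d n) f ω -
        (2 * (localMean β J (cube d m) f ω * localMean β J (cube d n) f ω) -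
          localMean β J (cube d m) f ω * localMean β J (cube d m) f ω) := fun ω => by ring
  simp only [this]
  rw [integral_sub_sub (hi _ _) ((hi _ _).const_mul 2) (hi _ _), integral_const_mul, h1]
  simp only [sq]
  ring

lemma IsGibbs.antitone_integral_sq (h : IsGibbs β J Γ) (hf : Measurable f)
    (hC : ∀ σ, |f σ| ≤ C) :
    Antitone fun n => ∫ ω, localMean β J (cube d n) f ω ^ 2 ∂(Γ : Measure (Config d)) := by
  intro n m hnm
  have := h.integral_sq_sub hf hC hnm
  have h2 : 0 ≤ ∫ ω, (localMean β J (cube d n) f ω - localMean β J (cube d m) f ω) ^ 2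
        ∂(Γ : Measure (Config d)) := integral_nonneg fun _ => sq_nonneg _
  simp only
  linarith

/-- The conditional means in growing cubes have a tail measurable limit. -/
lemma IsGibbs.exists_tail_limit (h : IsGibbs β J Γ) (hf : Measurable f) (hC : ∀ σ, |f σ| ≤ C) :
    ∃ g : Config d → ℝ, Measurable g ∧ (∀ σ, |g σ| ≤ C) ∧ IsTail g ∧
      Tendsto (fun n => ∫ ω, localMean β J (cube d n) f ω ^ 2 ∂(Γ : Measure (Config d))) atTop
        (𝓝 (∫ ω, g ω ^ 2 ∂(Γ : Measure (Config d)))) ∧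
      ∀ k : Config d → ℝ, Measurable k → (∃ D, ∀ σ, |k σ| ≤ D) → IsTail k →
        ∫ ω, k ω * g ω ∂(Γ : Measure (Config d)) = ∫ ω, k ω * f ω ∂(Γ : Measure (Config d)) := by
  set μ : Measure (Config d) := (Γ : Measure (Config d)) with hμ
  let F : ℕ → Config d → ℝ := fun n => localMean β J (cube d n) f
  have hFm : ∀ n, Measurable (F n) := fun n => measurable_localMean β J _ hf
  have hFb : ∀ n σ, |F n σ| ≤ C := fun n => abs_localMean_le β J _ hC
  have hC0 : 0 ≤ C := (abs_nonneg _).trans (hC (fun _ => 1))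
  have hL : ∀ n, MemLp (F n) 2 μ := fun n =>
    MemLp.of_bound (hFm n).aestronglyMeasurable C (.of_forall (hFb n))
  have hanti := h.antitone_integral_sq hf hC
  have hbdd : BddBelow (Set.range fun n => ∫ ω, F n ω ^ 2 ∂μ) :=
    ⟨0, by rintro _ ⟨n, rfl⟩; exact integral_nonneg fun _ => sq_nonneg _⟩
  have hlim := tendsto_atTop_ciInf hanti hbdd
  have hnorm : ∀ n m, dist ((hL n).toLp) ((hL m).toLp) ^ 2 = ∫ ω, (F n ω - F m ω) ^ 2 ∂μ := by
    intro n m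
    rw [dist_eq_norm, ← real_inner_self_eq_norm_sq, L2.inner_def]
    refine integral_congr_ae ?_
    filter_upwards [Lp.coeFn_sub ((hL n).toLp) ((hL m).toLp), (hL n).coeFn_toLp,
      (hL m).coeFn_toLp] with ω h1 h2 h3
    rw [h1, Pi.sub_apply, h2, h3]
    simp [sq]
  -- Squared distances are differences of the decreasing, bounded sequence ∫ F_n².
  have hcauchy : CauchySeq fun n => (hL n).toLp := by
    rw [Metric.cauchySeq_iff']
    intro ε hε
    obtain ⟨N, hN⟩ := Metric.cauchySeq_iff'.1 hlim.cauchySeq (ε ^ 2) (by positivity)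
    refine ⟨N, fun n hn => ?_⟩
    refine lt_of_pow_lt_pow_left₀ 2 hε.le ?_
    rw [dist_comm, hnorm, h.integral_sq_sub hf hC hn]
    have := hN n hn
    rw [dist_comm, Real.dist_eq] at this
    exact (le_abs_self _).trans_lt this
  obtain ⟨G, hG⟩ := cauchySeq_tendsto_of_complete hcauchy
  obtain ⟨ns, hns, hae⟩ := (tendstoInMeasure_of_tendsto_Lp hG).exists_seq_tendsto_ae
  have hae' : ∀ᵐ ω ∂μ, Tendsto (fun i => F (ns i) ω) atTop (𝓝 (G ω)) := by
    filter_upwards [hae, ae_all_iff.2 fun i => (hL (ns i)).coeFn_toLp] with ω h1 h2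
    exact h1.congr h2
  -- The L² limit is only a class modulo null sets. A pointwise limsup is bounded and tail
  -- measurable at every configuration.
  let g : Config d → ℝ := fun ω => limsup (fun i => F (ns i) ω) atTop
  have hcob : ∀ ω, IsCoboundedUnder (· ≤ ·) atTop fun i => F (ns i) ω := fun ω =>
    IsCoboundedUnder.of_frequently_ge (a := -C)
      (Frequently.of_forall fun i => (abs_le.1 (hFb (ns i) ω)).1)
  have hbd : ∀ ω, IsBoundedUnder (· ≤ ·) atTop fun i => F (ns i) ω := fun ω =>
    isBoundedUnder_of ⟨C, fun i => (abs_le.1 (hFb (ns i) ω)).2⟩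
  have hgm : Measurable g := Measurable.limsup fun i => hFm (ns i)
  have hgb : ∀ σ, |g σ| ≤ C := fun σ => abs_le.2
    ⟨le_limsup_of_frequently_le (Frequently.of_forall fun i => (abs_le.1 (hFb (ns i) σ)).1) (hbd σ),
      limsup_le_of_le (hcob σ) (.of_forall fun i => (abs_le.1 (hFb (ns i) σ)).2)⟩
  -- Changing spins in `cube d n` affects no term with `i ≥ n`, because `ns i ≥ i`.
  have hgt : IsTail g := isTail_of_cube fun n η ω => by
    refine limsup_congr ?_
    filter_upwards [eventually_ge_atTop n] with i hi
    exact ((exterior_localMean β J _ f).mono (cube_mono (hi.trans (hns.id_le i)))) η ω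
  have hconv : ∀ᵐ ω ∂μ, Tendsto (fun i => F (ns i) ω) atTop (𝓝 (g ω)) := by
    filter_upwards [hae'] with ω hω
    have : g ω = G ω := hω.limsup_eq
    rwa [this]
  have hsq : Tendsto (fun i => ∫ ω, F (ns i) ω ^ 2 ∂μ) atTop (𝓝 (∫ ω, g ω ^ 2 ∂μ)) := by
    refine tendsto_integral_of_dominated_convergence (fun _ => C ^ 2)
      (fun i => ((hFm _).pow_const 2).aestronglyMeasurable) (integrable_const _)
      (fun i => .of_forall fun ω => ?_) ?_
    · rw [Real.norm_eq_abs, abs_pow]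
      exact pow_le_pow_left₀ (abs_nonneg _) (hFb _ ω) 2
    · filter_upwards [hconv] with ω hω using hω.pow 2
  refine ⟨g, hgm, hgb, hgt, ?_, fun k hk ⟨D, hD⟩ hkt => ?_⟩
  · rw [tendsto_nhds_unique hsq (hlim.comp hns.tendsto_atTop)]
    exact hlim
  · have h1 : Tendsto (fun i => ∫ ω, k ω * F (ns i) ω ∂μ) atTop (𝓝 (∫ ω, k ω * g ω ∂μ)) := by
      refine tendsto_integral_of_dominated_convergence (fun _ => D * C)
        (fun i => (hk.mul (hFm _)).aestronglyMeasurable) (integrable_const _)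
        (fun i => .of_forall fun ω => ?_) ?_
      · rw [Real.norm_eq_abs, abs_mul]
        exact mul_le_mul (hD ω) (hFb _ ω) (abs_nonneg _) ((abs_nonneg _).trans (hD ω))
      · filter_upwards [hconv] with ω hω using hω.const_mul _
    refine tendsto_nhds_unique h1 ?_
    simp only [F, hμ, h.integral_mul_localMean hf hC hk hD (hkt _)]
    exact tendsto_const_nhds

end Limits

end EA

namespace EA

variable {d : ℕ}

/-! ### Pure states -/

/-- The variance under `ρ` of the conditional mean of `f` given the spins outside a cube. -/
noncomputable def tailVar (β : ℝ) (J : Couplings d) (ρ : State d) (f : Config d → ℝ) (n : ℕ) : ℝ :=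
  ∫ ω, localMean β J (cube d n) f ω ^ 2 ∂(ρ : Measure (Config d)) -
    (∫ ω, f ω ∂(ρ : Measure (Config d))) ^ 2

section Pure

variable {β : ℝ} {J : Couplings d} {ρ : State d} {f : Config d → ℝ} {C : ℝ}

lemma IsGibbs.tailVar_eq (h : IsGibbs β J ρ) (hf : Measurable f) (hC : ∀ σ, |f σ| ≤ C) (n : ℕ) :
    ∫ ω, (localMean β J (cube d n) f ω - ∫ ω', f ω' ∂(ρ : Measure (Config d))) ^ 2
      ∂(ρ : Measure (Config d)) = tailVar β J ρ f n := by
  rw [tailVar, ← h.integral_localMean (cube d n) hf hC]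
  exact integral_sub_integral_sq (measurable_localMean _ _ _ hf) (abs_localMean_le _ _ _ hC)

lemma IsGibbs.tailVar_nonneg (h : IsGibbs β J ρ) (hf : Measurable f) (hC : ∀ σ, |f σ| ≤ C)
    (n : ℕ) : 0 ≤ tailVar β J ρ f n := by
  rw [← h.tailVar_eq hf hC]
  exact integral_nonneg fun _ => sq_nonneg _

/-- Let ρ = aα + bα'. The conditional means concentrate under ρ at c = ρ(`allUp U`), hence also
under α, at the price of a factor 1/a. Their α-mean is α(`allUp U`) by DLR, so α agrees with ρ on
every `allUp U`. -/
lemma isPure_of_tailVar (h : IsGibbs β J ρ)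
    (hv : ∀ U, Tendsto (tailVar β J ρ (upInd U)) atTop (𝓝 0)) : IsPure β J ρ := by
  refine mem_extremePoints_iff_left.2 ⟨h, ?_⟩
  rintro α hα α' hα' ⟨a, b, ha, hb, hab, hαα'⟩
  have := hα.1
  have := hα'.1
  refine measure_ext_allUp fun U => ?_
  rw [← measureReal_eq_measureReal_iff]
  set c := (ρ : Measure (Config d)).real (allUp U) with hc
  have hm := measurable_upInd U
  have hb1 := abs_upInd_le U
  have hx : ∀ n, Measurable fun ω => localMean β J (cube d n) (upInd U) ω - c := fun n =>
    (measurable_localMean β J _ hm).sub_const c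
  have hc1 : |c| ≤ 1 := by
    rw [abs_of_nonneg measureReal_nonneg]; exact measureReal_le_one
  have hxb : ∀ n ω, |localMean β J (cube d n) (upInd U) ω - c| ≤ 2 := fun n ω => by
    have h1 := abs_localMean_le β J (cube d n) hb1 ω
    exact (abs_sub _ _).trans (by linarith)
  have hle : ∀ n, (α.real (allUp U) - c) ^ 2 ≤ (a : ℝ)⁻¹ * tailVar β J ρ (upInd U) n := by
    intro n
    have h1 : ∫ ω, (localMean β J (cube d n) (upInd U) ω - c) ∂α = α.real (allUp U) - c := by
      rw [integral_sub (Bounded.integrable (measurable_localMean β J _ hm)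
        (abs_localMean_le β J _ hb1)) (integrable_const _),
        integral_localMean_of_forall (hα.2 _) hm hb1, integral_upInd]
      simp
    have h2 := sq_integral_le (μ := α) (hx n) (hxb n)
    rw [h1] at h2
    refine h2.trans ?_
    have hi : ∀ (μ : Measure (Config d)) [IsFiniteMeasure μ],
        Integrable (fun ω => (localMean β J (cube d n) (upInd U) ω - c) ^ 2) μ := fun μ _ =>
      Bounded.integrable ((hx n).pow_const 2) (C := 2 ^ 2) fun ω => by
        rw [abs_pow]; exact pow_le_pow_left₀ (abs_nonneg _) (hxb n ω) 2
    have h3 := h.tailVar_eq hm hb1 n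
    rw [integral_upInd, ← hc, ← hαα', integral_add_measure (hi _) (hi _),
      integral_smul_nnreal_measure, integral_smul_nnreal_measure] at h3
    have h4 : 0 ≤ ∫ ω, (localMean β J (cube d n) (upInd U) ω - c) ^ 2 ∂α' :=
      integral_nonneg fun _ => sq_nonneg _
    have ha' : (0 : ℝ) < a := ha
    have hb' : (0 : ℝ) < b := hb
    rw [← h3]
    simp only [NNReal.smul_def, smul_eq_mul]
    rw [mul_add, ← mul_assoc, inv_mul_cancel₀ ha'.ne', one_mul]
    have := mul_nonneg (inv_nonneg.2 ha'.le) (mul_nonneg hb'.le h4)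
    linarith
  have hlim : Tendsto (fun n => (a : ℝ)⁻¹ * tailVar β J ρ (upInd U) n) atTop (𝓝 0) := by
    simpa using (hv U).const_mul (a : ℝ)⁻¹
  have h0 : (α.real (allUp U) - c) ^ 2 ≤ 0 := ge_of_tendsto' hlim hle
  have := pow_eq_zero_iff (two_ne_zero) |>.1 (le_antisymm h0 (sq_nonneg _))
  linarith

/-- Tilting a Gibbs measure by a tail function. -/
lemma IsGibbs.withDensity (h : IsGibbs β J ρ) {k : Config d → ℝ} (hk : Measurable k)
    (hk1 : ∀ σ, |k σ| ≤ 1) (hkt : IsTail k) (hk0 : ∫ ω, k ω ∂(ρ : Measure (Config d)) = 0) :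
    (ρ : Measure (Config d)).withDensity (fun ω => ENNReal.ofReal (1 + k ω)) ∈
      gibbsMeasures β J := by
  set μ : Measure (Config d) := (ρ : Measure (Config d)) with hμ
  have hkp : ∀ σ, 0 ≤ 1 + k σ := fun σ => by linarith [(abs_le.1 (hk1 σ)).1]
  have hki : Integrable k μ := Bounded.integrable hk hk1
  have hki1 : Integrable (fun ω => 1 + k ω) μ := (integrable_const _).add hki
  have hprob : IsProbabilityMeasure (μ.withDensity fun ω => ENNReal.ofReal (1 + k ω)) := by
    constructor
    rw [withDensity_apply _ MeasurableSet.univ, Measure.restrict_univ,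
      ← ofReal_integral_eq_lintegral_ofReal hki1 (.of_forall hkp),
      integral_add (integrable_const _) hki, hk0]
    simp
  have hint : ∀ g : Config d → ℝ,
      ∫ ω, g ω ∂(μ.withDensity fun ω => ENNReal.ofReal (1 + k ω)) = ∫ ω, (1 + k ω) * g ω ∂μ := by
    intro g
    rw [integral_withDensity_eq_integral_toReal_smul (hk.const_add 1).ennreal_ofReal
      (.of_forall fun _ => ENNReal.ofReal_lt_top)]
    simp only [ENNReal.toReal_ofReal (hkp _), smul_eq_mul]
  let τ : State d := ⟨_, hprob⟩
  refine (isGibbs_iff_integral (Γ := τ)).2 fun W U => ?_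
  simp only [τ, ProbabilityMeasure.coe_mk, hint]
  -- The density is exterior to every finite set, so it passes through the local mean.
  refine h.integral_mul_localMean (measurable_upInd U) (abs_upInd_le U) (hk.const_add 1) (D := 2)
    (fun σ => ?_) fun η ω => by rw [hkt W η ω]
  exact (abs_add_le _ _).trans (by rw [abs_one]; linarith [hk1 σ])

lemma IsPure.isGibbs (h : IsPure β J ρ) : IsGibbs β J ρ := h.1

/-- Let k be the centred and rescaled tail limit. Tilting ρ by 1 + k and 1 - k gives two Gibbs
measures with midpoint ρ. Extremality makes the tilt trivial, so k vanishes in L² and the variances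
tend to 0. -/
lemma IsPure.tendsto_tailVar (h : IsPure β J ρ) (hf : Measurable f) (hC : ∀ σ, |f σ| ≤ C) :
    Tendsto (tailVar β J ρ f) atTop (𝓝 0) := by
  have hG := h.isGibbs
  obtain ⟨g, hg, hgC, hgt, hlim, hgf⟩ := hG.exists_tail_limit hf hC
  set μ : Measure (Config d) := (ρ : Measure (Config d)) with hμ
  have hC0 : 0 ≤ C := (abs_nonneg _).trans (hC (fun _ => 1))
  have hgc : ∫ ω, g ω ∂μ = ∫ ω, f ω ∂μ := by
    simpa using hgf (fun _ => 1) measurable_const ⟨1, by simp⟩ fun _ _ _ => rfl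
  set c := ∫ ω, f ω ∂μ with hc
  have hcC : |c| ≤ C := by
    have := norm_integral_le_of_norm_le_const (μ := μ) (f := f) (C := C) (.of_forall hC)
    simpa using this
  -- Division by 2C + 1 gives |k| ≤ 1, and the added 1 covers C = 0.
  have hD : (0 : ℝ) < 2 * C + 1 := by linarith
  let k : Config d → ℝ := fun ω => (g ω - c) / (2 * C + 1)
  have hk : Measurable k := (hg.sub_const c).div_const _
  have hk1 : ∀ σ, |k σ| ≤ 1 := fun σ => by
    simp only [k]
    rw [abs_div, abs_of_pos hD, div_le_one hD]
    exact (abs_sub _ _).trans (by linarith [hgC σ])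
  have hkt : IsTail k := fun W η ω => by simp only [k, hgt W η ω]
  have hgi : Integrable g μ := Bounded.integrable hg hgC
  have hki : Integrable k μ := Bounded.integrable hk hk1
  have hk0 : ∫ ω, k ω ∂μ = 0 := by
    simp only [k]
    rw [integral_div, integral_sub hgi (integrable_const _), hgc]
    simp
  have h1 := hG.withDensity hk hk1 hkt hk0
  have h2 := hG.withDensity (k := fun ω => -k ω) hk.neg (fun σ => by rw [abs_neg]; exact hk1 σ)
    (fun W η ω => by simp only [hkt W η ω]) (by rw [integral_neg]; simp [hk0, ← hμ])
  rw [← hμ] at h1 h2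
  have hmid : μ ∈ openSegment ℝ≥0 (μ.withDensity fun ω => ENNReal.ofReal (1 + k ω))
      (μ.withDensity fun ω => ENNReal.ofReal (1 + -k ω)) := by
    refine ⟨1 / 2, 1 / 2, by positivity, by positivity, add_halves 1, ?_⟩
    rw [← smul_add, ← withDensity_add_left (hk.const_add 1).ennreal_ofReal]
    have : ((fun ω => ENNReal.ofReal (1 + k ω)) + fun ω => ENNReal.ofReal (1 + -k ω)) =
        fun _ => 2 := by
      funext ω
      have h3 := abs_le.1 (hk1 ω)
      rw [Pi.add_apply, ← ENNReal.ofReal_add (by linarith) (by linarith),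
        show 1 + k ω + (1 + -k ω) = 2 by ring]
      norm_num
    rw [this, withDensity_const]
    ext A hA
    simp only [Measure.smul_apply, smul_eq_mul, ENNReal.smul_def]
    rw [← mul_assoc]
    have : (((1 / 2 : ℝ≥0) : ℝ≥0∞)) * 2 = 1 := by
      rw [one_div, ENNReal.coe_inv two_ne_zero]
      exact ENNReal.inv_mul_cancel (by norm_num) (by norm_num)
    rw [this, one_mul]
  have heq := (mem_extremePoints_iff_left.1 h).2 _ h1 _ h2 hmid
  -- The left side is the mean of k under the tilted measure, which equals μ; expanding it leaves ∫
  -- k² = 0.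
  have hint : ∫ ω, (1 + k ω) * k ω ∂μ = 0 := by
    have h3 := integral_withDensity_eq_integral_toReal_smul (μ := μ)
      (f := fun ω => ENNReal.ofReal (1 + k ω)) (hk.const_add 1).ennreal_ofReal
      (.of_forall fun _ => ENNReal.ofReal_lt_top) k
    rw [heq, hk0] at h3
    rw [h3]
    refine integral_congr_ae (.of_forall fun ω => ?_)
    simp only [smul_eq_mul]
    rw [ENNReal.toReal_ofReal (by linarith [(abs_le.1 (hk1 ω)).1])]
  have hk2 : ∫ ω, k ω ^ 2 ∂μ = 0 := by
    have hki2 : Integrable (fun ω => k ω ^ 2) μ := Bounded.integrable (hk.pow_const 2) (C := 1)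
      fun ω => by rw [abs_pow]; exact pow_le_one₀ (abs_nonneg _) (hk1 ω)
    have : ∀ ω, (1 + k ω) * k ω = k ω + k ω ^ 2 := fun ω => by ring
    simp only [this] at hint
    rwa [integral_add hki hki2, hk0, zero_add] at hint
  have hvar : ∫ ω, (g ω - c) ^ 2 ∂μ = 0 := by
    have : ∀ ω, (g ω - c) ^ 2 = (2 * C + 1) ^ 2 * k ω ^ 2 := fun ω => by
      simp only [k]; field_simp
    simp only [this]
    rw [integral_const_mul, hk2, mul_zero]
  have hg2 : ∫ ω, g ω ^ 2 ∂μ = c ^ 2 := by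
    have := integral_sub_integral_sq (μ := μ) hg hgC
    rw [hgc, hvar] at this
    linarith
  have := hlim.sub_const (c ^ 2)
  rw [hg2, sub_self] at this
  exact this

end Pure

end EA

namespace EA

variable {d : ℕ}

/-! ### Existence of the decomposition into pure states -/

/-- The tail σ-algebra. -/
@[reducible] def tailSigma (d : ℕ) : MeasurableSpace (Config d) where
  MeasurableSet' A := MeasurableSet A ∧ IsTail (· ∈ A)
  measurableSet_empty := ⟨MeasurableSet.empty, fun _ _ _ => rfl⟩
  measurableSet_compl A h := ⟨h.1.compl, fun W η ω => by
    have := h.2 W η ω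
    simp only [eq_iff_iff] at this
    simp only [Set.mem_compl_iff, this]⟩
  measurableSet_iUnion A h := ⟨MeasurableSet.iUnion fun i => (h i).1, fun W η ω => by
    simp only [Set.mem_iUnion, eq_iff_iff]
    exact exists_congr fun i => by simpa only [eq_iff_iff] using (h i).2 W η ω⟩

lemma tailSigma_le : tailSigma d ≤ (MeasurableSpace.pi : MeasurableSpace (Config d)) :=
  fun _ h => h.1

lemma IsTail.measurable_tailSigma {g : Config d → ℝ} (hg : Measurable g) (ht : IsTail g) :
    Measurable[tailSigma d] g := fun S hS =>
  ⟨hg hS, fun W η ω => by simp only [Set.mem_preimage, ht W η ω]⟩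

section Existence

variable {β : ℝ} {J : Couplings d} {Γ : State d} {f : Config d → ℝ} {C : ℝ}

lemma isTail_indicator {A : Set (Config d)} (hA : IsTail (· ∈ A)) :
    IsTail (A.indicator (1 : Config d → ℝ)) := fun W η ω => by
  have := hA W η ω
  simp only [eq_iff_iff] at this
  by_cases h : ω ∈ A <;> simp [h, this]

lemma setIntegral_eq_integral_indicator_mul {μ : Measure (Config d)} {A : Set (Config d)}
    (hA : MeasurableSet A) (f : Config d → ℝ) :
    ∫ ω in A, f ω ∂μ = ∫ ω, A.indicator (1 : Config d → ℝ) ω * f ω ∂μ := by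
  rw [← integral_indicator hA]
  refine integral_congr_ae (.of_forall fun ω => ?_)
  by_cases h : ω ∈ A <;> simp [h]

lemma abs_indicator_one_le (A : Set (Config d)) (σ : Config d) :
    |A.indicator (1 : Config d → ℝ) σ| ≤ 1 := by
  by_cases h : σ ∈ A <;> simp [h]

/-- It is used with g a local mean of f, to show that tail states are Gibbs, and with g the tail
limit of f, to identify the tail conditional expectation of f. -/
lemma condExp_tail_congr {g : Config d → ℝ} {μ : Measure (Config d)} [IsFiniteMeasure μ]
    (hf : Measurable f) (hC : ∀ σ, |f σ| ≤ C) (hg : Measurable g) (hgC : ∀ σ, |g σ| ≤ C)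
    (h : ∀ k : Config d → ℝ, Measurable k → (∃ D, ∀ σ, |k σ| ≤ D) → IsTail k →
        ∫ ω, k ω * g ω ∂μ = ∫ ω, k ω * f ω ∂μ) :
    μ[g | tailSigma d] =ᵐ[μ] μ[f | tailSigma d] := by
  have hgi : Integrable g μ := Bounded.integrable hg hgC
  refine ae_eq_condExp_of_forall_setIntegral_eq tailSigma_le (Bounded.integrable hf hC)
    (fun s _ _ => integrable_condExp.integrableOn) (fun s hs _ => ?_)
    stronglyMeasurable_condExp.aestronglyMeasurable
  rw [setIntegral_condExp tailSigma_le hgi hs, setIntegral_eq_integral_indicator_mul hs.1,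
    setIntegral_eq_integral_indicator_mul hs.1]
  exact h _ (measurable_one.indicator hs.1) ⟨1, abs_indicator_one_le s⟩ (isTail_indicator hs.2)

/-- The regular conditional distribution given the tail, as a random state. -/
noncomputable def tailState (Γ : State d) (ω : Config d) : State d :=
  ⟨condExpKernel (Γ : Measure (Config d)) (tailSigma d) ω, inferInstance⟩

lemma measurable_tailState (Γ : State d) : Measurable (tailState Γ) :=
  Measurable.subtype_mk ((condExpKernel (Γ : Measure (Config d)) (tailSigma d)).measurable.mono
    tailSigma_le le_rfl)

lemma integral_tailState_ae (Γ : State d) (hf : Measurable f) (hC : ∀ σ, |f σ| ≤ C) :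
    (fun ω => ∫ σ, f σ ∂(tailState Γ ω : Measure (Config d))) =ᵐ[(Γ : Measure (Config d))]
      (Γ : Measure (Config d))[f | tailSigma d] :=
  (condExp_ae_eq_integral_condExpKernel tailSigma_le (Bounded.integrable hf hC)).symm

lemma measurable_integral_tailState (Γ : State d) (hf : Measurable f) :
    Measurable fun ω => ∫ σ, f σ ∂(tailState Γ ω : Measure (Config d)) := by
  have h := (measurable_integral_state (d := d) (X := Unit) (f := fun p => f p.2)
    (hf.comp measurable_snd))
  exact h.comp (measurable_const.prodMk (measurable_tailState Γ) :
    Measurable fun ω => ((), tailState Γ ω))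

lemma integral_integral_tailState (Γ : State d) (hf : Measurable f) (hC : ∀ σ, |f σ| ≤ C) :
    ∫ ω, ∫ σ, f σ ∂(tailState Γ ω : Measure (Config d)) ∂(Γ : Measure (Config d)) =
      ∫ ω, f ω ∂(Γ : Measure (Config d)) := by
  rw [integral_congr_ae (integral_tailState_ae Γ hf hC), integral_condExp tailSigma_le]

/-- A function and its local mean have the same conditional expectation given the tail. Only
countably many such identities are needed. -/
lemma IsGibbs.ae_isGibbs_tailState (h : IsGibbs β J Γ) :
    ∀ᵐ ω ∂(Γ : Measure (Config d)), IsGibbs β J (tailState Γ ω) := by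
  simp only [isGibbs_iff_integral]
  refine ae_all_iff.2 fun W => ae_all_iff.2 fun U => ?_
  have hm := measurable_upInd U
  have hb := abs_upInd_le U
  have hlm := measurable_localMean β J W hm
  have hlb := abs_localMean_le β J W hb
  have := condExp_tail_congr (μ := (Γ : Measure (Config d))) hm hb hlm hlb
    fun k hk ⟨D, hD⟩ hkt => h.integral_mul_localMean hm hb hk hD (hkt W)
  filter_upwards [this, integral_tailState_ae Γ hm hb, integral_tailState_ae Γ hlm hlb]
    with ω h1 h2 h3
  rw [h2, h3, h1]

lemma abs_integral_le {μ : Measure (Config d)} [IsProbabilityMeasure μ] (hC : ∀ σ, |f σ| ≤ C) :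
    |∫ σ, f σ ∂μ| ≤ C := by
  have := norm_integral_le_of_norm_le_const (μ := μ) (f := f) (C := C) (.of_forall hC)
  simpa using this

lemma abs_pow_two_le {x : ℝ} (h : |x| ≤ C) : |x ^ 2| ≤ C ^ 2 := by
  rw [abs_pow]; exact pow_le_pow_left₀ (abs_nonneg _) h 2

/-- Averaged over Γ, the variance in the tail state is ∫ F_n² - ∫ g², where g is the tail limit, and
this tends to 0. For almost every tail state the variances decrease to a nonnegative limit, whose
integral is then 0. -/
lemma IsGibbs.ae_tendsto_tailVar_tailState (h : IsGibbs β J Γ) (hf : Measurable f)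
    (hC : ∀ σ, |f σ| ≤ C) :
    ∀ᵐ ω ∂(Γ : Measure (Config d)), Tendsto (tailVar β J (tailState Γ ω) f) atTop (𝓝 0) := by
  set μ : Measure (Config d) := (Γ : Measure (Config d)) with hμ
  obtain ⟨g, hg, hgC, hgt, hlim, hgf⟩ := h.exists_tail_limit hf hC
  have hfm := measurable_integral_tailState Γ hf
  have hae : (fun ω => ∫ σ, f σ ∂(tailState Γ ω : Measure (Config d))) =ᵐ[μ] g := by
    refine (integral_tailState_ae Γ hf hC).trans
      ((condExp_tail_congr hf hC hg hgC hgf).symm.trans (.of_eq ?_))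
    exact condExp_of_stronglyMeasurable tailSigma_le
      (IsTail.measurable_tailSigma hg hgt).stronglyMeasurable (Bounded.integrable hg hgC)
  have hsqm : ∀ n, Measurable fun ω => localMean β J (cube d n) f ω ^ 2 := fun n =>
    (measurable_localMean β J _ hf).pow_const 2
  have hsqb : ∀ n ω, |localMean β J (cube d n) f ω ^ 2| ≤ C ^ 2 := fun n ω =>
    abs_pow_two_le (abs_localMean_le β J _ hC ω)
  have hvm : ∀ n, Measurable fun ω => tailVar β J (tailState Γ ω) f n := fun n =>
    (measurable_integral_tailState Γ (hsqm n)).sub (hfm.pow_const 2)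
  have hvb : ∀ n ω, |tailVar β J (tailState Γ ω) f n| ≤ C ^ 2 + C ^ 2 := fun n ω =>
    (abs_sub _ _).trans (add_le_add (abs_integral_le (hsqb n))
      (abs_pow_two_le (abs_integral_le hC)))
  have hvint : ∀ n, ∫ ω, tailVar β J (tailState Γ ω) f n ∂μ =
      ∫ ω, localMean β J (cube d n) f ω ^ 2 ∂μ - ∫ ω, g ω ^ 2 ∂μ := by
    intro n
    simp only [tailVar]
    rw [integral_sub (Bounded.integrable (measurable_integral_tailState Γ (hsqm n))
      fun ω => abs_integral_le (hsqb n)) (Bounded.integrable (hfm.pow_const 2)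
      fun ω => abs_pow_two_le (abs_integral_le hC)), integral_integral_tailState Γ (hsqm n) (hsqb n)]
    congr 1
    refine integral_congr_ae ?_
    filter_upwards [hae] with ω hω
    rw [hω]
  have hv0 : Tendsto (fun n => ∫ ω, tailVar β J (tailState Γ ω) f n ∂μ) atTop (𝓝 0) := by
    simp only [hvint]
    have h0 := hlim.sub_const (∫ ω, g ω ^ 2 ∂μ)
    rw [← hμ, sub_self] at h0
    exact h0
  let v : Config d → ℝ := fun ω => ⨅ n, tailVar β J (tailState Γ ω) f n
  have hconv : ∀ᵐ ω ∂μ, 0 ≤ v ω ∧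
      Tendsto (tailVar β J (tailState Γ ω) f) atTop (𝓝 (v ω)) := by
    filter_upwards [h.ae_isGibbs_tailState] with ω hω
    have hanti : Antitone (tailVar β J (tailState Γ ω) f) := fun n m hnm =>
      sub_le_sub_right (hω.antitone_integral_sq hf hC hnm) _
    have h0 := hω.tailVar_nonneg hf hC
    exact ⟨le_ciInf h0, tendsto_atTop_ciInf hanti ⟨0, by rintro _ ⟨n, rfl⟩; exact h0 n⟩⟩
  have hvmeas : Measurable v := Measurable.iInf hvm
  have hvC : ∀ᵐ ω ∂μ, ‖v ω‖ ≤ C ^ 2 + C ^ 2 := by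
    filter_upwards [hconv] with ω hω
    exact le_of_tendsto' hω.2.norm fun n => hvb n ω
  have hv1 : Tendsto (fun n => ∫ ω, tailVar β J (tailState Γ ω) f n ∂μ) atTop
      (𝓝 (∫ ω, v ω ∂μ)) :=
    tendsto_integral_of_dominated_convergence (fun _ => C ^ 2 + C ^ 2)
      (fun n => (hvm n).aestronglyMeasurable) (integrable_const _)
      (fun n => .of_forall (hvb n)) (hconv.mono fun _ hω => hω.2)
  have hv2 : ∫ ω, v ω ∂μ = 0 := tendsto_nhds_unique hv1 hv0
  rw [integral_eq_zero_iff_of_nonneg_ae (hconv.mono fun _ hω => hω.1)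
    (Integrable.of_bound hvmeas.aestronglyMeasurable _ hvC)] at hv2
  filter_upwards [hconv, hv2] with ω h1 h2
  rw [h2] at h1
  exact h1.2

/-- The variance criterion, unlike the definition by extremality, is visibly measurable. It can
therefore be carried over to the image measure that defines the decomposition. -/
lemma measurableSet_pure_criterion (β : ℝ) (J : Couplings d) :
    MeasurableSet {ρ : State d | IsGibbs β J ρ ∧
      ∀ U, Tendsto (tailVar β J ρ (upInd U)) atTop (𝓝 0)} := by
  simp only [Set.ofPred_and, Set.ofPred_forall]
  refine MeasurableSet.inter ?_ ?_
  · exact (measurableSet_isGibbs β).preimage measurable_prodMk_left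
  · refine MeasurableSet.iInter fun U => measurableSet_tendsto _ fun n => ?_
    have h1 := (measurable_integral_state (d := d) (X := Unit)
      (f := fun p => localMean β J (cube d n) (upInd U) p.2 ^ 2)
      (((measurable_localMean β J _ (measurable_upInd U)).comp measurable_snd).pow_const 2)).comp
      (measurable_prodMk_left (x := ()))
    have h2 := (measurable_integral_state (d := d) (X := Unit) (f := fun p => upInd U p.2)
      ((measurable_upInd U).comp measurable_snd)).comp (measurable_prodMk_left (x := ()))
    exact h1.sub (h2.pow_const 2)

/-- Almost every tail state satisfies the purity criterion, and the barycenter identity is the tower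
property of conditional expectation. -/
lemma IsGibbs.isPureDecomposition_map (h : IsGibbs β J Γ) :
    IsPureDecomposition β J Γ ((Γ : Measure (Config d)).map (tailState Γ)) := by
  have hm := measurable_tailState Γ
  refine ⟨Measure.isProbabilityMeasure_map hm.aemeasurable, ?_, fun A hA => ?_⟩
  · have hae : ∀ᵐ ω ∂(Γ : Measure (Config d)), tailState Γ ω ∈ {ρ : State d | IsGibbs β J ρ ∧
        ∀ U, Tendsto (tailVar β J ρ (upInd U)) atTop (𝓝 0)} := by
      filter_upwards [h.ae_isGibbs_tailState, ae_all_iff.2 fun U =>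
        h.ae_tendsto_tailVar_tailState (measurable_upInd U) (abs_upInd_le U)] with ω h1 h2
      exact ⟨h1, h2⟩
    filter_upwards [(ae_map_iff hm.aemeasurable (measurableSet_pure_criterion β J)).2 hae]
      with ρ hρ using isPure_of_tailVar hρ.1 hρ.2
  · rw [lintegral_map (measurable_state_apply hA) hm]
    have h1 := condExpKernel_comp_trim (μ := (Γ : Measure (Config d))) (tailSigma_le (d := d))
    conv_lhs => rw [← h1]
    rw [Measure.bind_apply hA (Kernel.aemeasurable _), lintegral_trim _
      ((condExpKernel (Γ : Measure (Config d)) (tailSigma d)).measurable_coe hA)]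
    rfl

end Existence

end EA

namespace EA

variable {d : ℕ}

/-! ### Uniqueness and measurability of the decomposition -/

lemma abs_prod_sub_prod_le {ι : Type*} (s : Finset ι) (x y : ι → ℝ) (hx : ∀ i, |x i| ≤ 1)
    (hy : ∀ i, |y i| ≤ 1) : |∏ i ∈ s, x i - ∏ i ∈ s, y i| ≤ ∑ i ∈ s, |x i - y i| := by
  classical
  induction s using Finset.induction_on with
  | empty => simp
  | insert a s ha ih =>
    rw [Finset.prod_insert ha, Finset.prod_insert ha, Finset.sum_insert ha]
    have h1 : x a * ∏ i ∈ s, x i - y a * ∏ i ∈ s, y i =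
        (x a - y a) * ∏ i ∈ s, y i + x a * (∏ i ∈ s, x i - ∏ i ∈ s, y i) := by ring
    rw [h1]
    refine (abs_add_le _ _).trans (add_le_add ?_ ?_)
    · rw [abs_mul, Finset.abs_prod]
      exact mul_le_of_le_one_right (abs_nonneg _)
        (Finset.prod_le_one (fun _ _ => abs_nonneg _) fun i _ => hy i)
    · rw [abs_mul]
      exact (mul_le_of_le_one_left (abs_nonneg _) (hx a)).trans ih

section Uniqueness

variable {β : ℝ} {J : Couplings d} {Γ ρ : State d} {f : Config d → ℝ} {C : ℝ}
  {m : Measure (State d)}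

lemma IsPure.integral_abs_localMean_sub_le (h : IsPure β J ρ) (hf : Measurable f)
    (hC : ∀ σ, |f σ| ≤ C) (n : ℕ) :
    ∫ ω, |localMean β J (cube d n) f ω - ∫ σ, f σ ∂(ρ : Measure (Config d))|
      ∂(ρ : Measure (Config d)) ≤ √(tailVar β J ρ f n) := by
  refine Real.le_sqrt_of_sq_le ?_
  rw [← h.isGibbs.tailVar_eq hf hC]
  have h1 := sq_integral_le (μ := (ρ : Measure (Config d))) (C := C + C)
    (((measurable_localMean β J (cube d n) hf).sub_const
      (∫ σ, f σ ∂(ρ : Measure (Config d)))).abs) fun ω => by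
      rw [abs_abs]
      exact (abs_sub _ _).trans
        (add_le_add (abs_localMean_le β J _ hC ω) (abs_integral_le hC))
  simpa only [sq_abs] using h1

/-- The product of the conditional probabilities of the events `allUp (u i)` given the spins outside
a cube. -/
noncomputable def upCond (β : ℝ) (J : Couplings d) {s : ℕ} (u : Fin s → Finset (Site d)) (n : ℕ)
    (ω : Config d) : ℝ :=
  ∏ i, localMean β J (cube d n) (upInd (u i)) ω

lemma measurable_upCond {s : ℕ} (u : Fin s → Finset (Site d)) (n : ℕ) :
    Measurable fun p : Couplings d × Config d => upCond β p.1 u n p.2 :=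
  Finset.measurable_fun_prod _ fun i _ =>
    measurable_uncurry_localMean β _ (measurable_upInd (u i))

lemma measurable_upCond_right {s : ℕ} (u : Fin s → Finset (Site d)) (n : ℕ) :
    Measurable (upCond β J u n) :=
  Finset.measurable_fun_prod _ fun i _ => measurable_localMean β J _ (measurable_upInd (u i))

lemma abs_upCond_le {s : ℕ} (u : Fin s → Finset (Site d)) (n : ℕ) (ω : Config d) :
    |upCond β J u n ω| ≤ 1 := by
  rw [upCond, Finset.abs_prod]
  exact Finset.prod_le_one (fun _ _ => abs_nonneg _)
    fun i _ => abs_localMean_le β J _ (abs_upInd_le (u i)) ω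

/-- In a pure state each conditional probability converges in L¹ to its constant mean, and products
of factors bounded by 1 inherit the convergence. -/
lemma IsPure.tendsto_integral_upCond (h : IsPure β J ρ) {s : ℕ} (u : Fin s → Finset (Site d)) :
    Tendsto (fun n => ∫ ω, upCond β J u n ω ∂(ρ : Measure (Config d))) atTop
      (𝓝 (upProd u ρ)) := by
  set μ : Measure (Config d) := (ρ : Measure (Config d)) with hμ
  have hx : ∀ n i, Measurable fun ω =>
      |localMean β J (cube d n) (upInd (u i)) ω - μ.real (allUp (u i))| := fun n i =>
    ((measurable_localMean β J _ (measurable_upInd _)).sub_const _).abs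
  have hr : ∀ i, |μ.real (allUp (u i))| ≤ 1 := fun i => by
    rw [abs_of_nonneg measureReal_nonneg]; exact measureReal_le_one
  have hb : ∀ n i ω, |localMean β J (cube d n) (upInd (u i)) ω| ≤ 1 := fun n i =>
    abs_localMean_le β J _ (abs_upInd_le (u i))
  have hxi : ∀ n i, Integrable (fun ω =>
      |localMean β J (cube d n) (upInd (u i)) ω - μ.real (allUp (u i))|) μ := fun n i =>
    Bounded.integrable (hx n i) (C := 1 + 1) fun ω => by
      rw [abs_abs]
      exact (abs_sub _ _).trans (add_le_add (hb n i ω) (hr i))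
  have hle : ∀ n, |∫ ω, upCond β J u n ω ∂μ - upProd u ρ| ≤
      ∑ i, √(tailVar β J ρ (upInd (u i)) n) := by
    intro n
    have h1 : ∫ ω, upCond β J u n ω ∂μ - upProd u ρ = ∫ ω, (upCond β J u n ω - upProd u ρ) ∂μ := by
      rw [integral_sub (Bounded.integrable (measurable_upCond_right u n) (abs_upCond_le u n))
        (integrable_const _)]
      simp
    rw [h1]
    calc |∫ ω, (upCond β J u n ω - upProd u ρ) ∂μ|
        ≤ ∫ ω, |upCond β J u n ω - upProd u ρ| ∂μ := abs_integral_le_integral_abs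
      _ ≤ ∫ ω, ∑ i, |localMean β J (cube d n) (upInd (u i)) ω - μ.real (allUp (u i))| ∂μ := by
          refine integral_mono_of_nonneg (.of_forall fun _ => abs_nonneg _)
            (integrable_finsetSum _ fun i _ => hxi n i) (.of_forall fun ω => ?_)
          exact abs_prod_sub_prod_le _ _ _ (fun i => hb n i ω) hr
      _ = ∑ i, ∫ ω, |localMean β J (cube d n) (upInd (u i)) ω - μ.real (allUp (u i))| ∂μ :=
          integral_finsetSum _ fun i _ => hxi n i
      _ ≤ _ := by
          refine Finset.sum_le_sum fun i _ => ?_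
          have := h.integral_abs_localMean_sub_le (measurable_upInd (u i)) (abs_upInd_le (u i)) n
          rwa [integral_upInd] at this
  have h0 : Tendsto (fun n => ∑ i, √(tailVar β J ρ (upInd (u i)) n)) atTop (𝓝 0) := by
    have : Tendsto (fun n => ∑ i, √(tailVar β J ρ (upInd (u i)) n)) atTop
        (𝓝 (∑ _i : Fin s, √0)) := tendsto_finsetSum _ fun i _ =>
      (Real.continuous_sqrt.tendsto 0).comp
        (h.tendsto_tailVar (measurable_upInd (u i)) (abs_upInd_le (u i)))
    simpa using this
  exact tendsto_iff_norm_sub_tendsto_zero.2 (squeeze_zero (fun _ => norm_nonneg _) hle h0)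

lemma IsPureDecomposition.bind_eq (h : IsPureDecomposition β J Γ m) :
    stateKernel d ∘ₘ m = (Γ : Measure (Config d)) := by
  refine Measure.ext fun A hA => ?_
  rw [Measure.bind_apply hA (Kernel.aemeasurable _), h.2.2 A hA]
  rfl

lemma IsPureDecomposition.integral_eq (h : IsPureDecomposition β J Γ m) (hf : Measurable f)
    (hC : ∀ σ, |f σ| ≤ C) :
    ∫ ω, f ω ∂(Γ : Measure (Config d)) = ∫ ρ, ∫ ω, f ω ∂(ρ : Measure (Config d)) ∂m := by
  have := h.1
  have hi : Integrable f (stateKernel d ∘ₘ m) := by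
    rw [h.bind_eq]; exact Bounded.integrable hf hC
  rw [← h.bind_eq, integral_measure_bind hi]
  rfl

lemma IsPureDecomposition.isGibbs (h : IsPureDecomposition β J Γ m) : IsGibbs β J Γ := by
  refine isGibbs_iff_integral.2 fun W U => ?_
  rw [h.integral_eq (measurable_localMean β J W (measurable_upInd U))
    (abs_localMean_le β J W (abs_upInd_le U)), h.integral_eq (measurable_upInd U) (abs_upInd_le U)]
  refine integral_congr_ae ?_
  filter_upwards [h.2.1] with ρ hρ
  exact hρ.isGibbs.integral_localMean W (measurable_upInd U) (abs_upInd_le U)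

/-- The sequence on the left involves only J and Γ, while the limit is a moment of `m`. Uniqueness
and measurability of the decomposition both come from this. -/
lemma IsPureDecomposition.tendsto_moment (h : IsPureDecomposition β J Γ m) {s : ℕ}
    (u : Fin s → Finset (Site d)) :
    Tendsto (fun n => ∫ ω, upCond β J u n ω ∂(Γ : Measure (Config d))) atTop
      (𝓝 (∫ ρ, upProd u ρ ∂m)) := by
  have := h.1
  simp only [h.integral_eq (measurable_upCond_right u _) (abs_upCond_le u _)]
  have hm : ∀ n, Measurable fun ρ : State d =>
      ∫ ω, upCond β J u n ω ∂(ρ : Measure (Config d)) := fun n =>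
    (measurable_integral_state (measurable_upCond u n)).comp measurable_prodMk_left
  refine tendsto_integral_of_dominated_convergence (fun _ => 1)
    (fun n => (hm n).aestronglyMeasurable) (integrable_const _)
    (fun n => .of_forall fun ρ => abs_integral_le (abs_upCond_le u n)) ?_
  filter_upwards [h.2.1] with ρ hρ using hρ.tendsto_integral_upCond u

lemma IsPureDecomposition.unique {m' : Measure (State d)} (h : IsPureDecomposition β J Γ m)
    (h' : IsPureDecomposition β J Γ m') : m = m' := by
  have := h.1
  have := h'.1
  exact measure_state_ext fun s u => tendsto_nhds_unique (h.tendsto_moment u) (h'.tendsto_moment u)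

lemma IsGibbs.existsUnique_isPureDecomposition (h : IsGibbs β J Γ) :
    ∃! m : Measure (State d), IsPureDecomposition β J Γ m :=
  ⟨_, h.isPureDecomposition_map, fun _ h' => h'.unique h.isPureDecomposition_map⟩

lemma IsGibbs.isPureDecomposition (h : IsGibbs β J Γ) :
    IsPureDecomposition β J Γ (pureDecomposition β J Γ) := by
  have hex : ∃ m, IsPureDecomposition β J Γ m := h.existsUnique_isPureDecomposition.exists
  rw [pureDecomposition, dif_pos hex]
  exact hex.choose_spec

lemma pureDecomposition_of_not_isGibbs (h : ¬ IsGibbs β J Γ) : pureDecomposition β J Γ = 0 := by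
  rw [pureDecomposition, dif_neg]
  rintro ⟨m, hm⟩
  exact h hm.isGibbs

lemma pureDecomposition_univ_le (β : ℝ) (J : Couplings d) (Γ : State d) :
    pureDecomposition β J Γ Set.univ ≤ 1 := by
  by_cases h : IsGibbs β J Γ
  · have := h.isPureDecomposition.1
    exact prob_le_one
  · simp [pureDecomposition_of_not_isGibbs h]

instance (β : ℝ) (J : Couplings d) (Γ : State d) : IsFiniteMeasure (pureDecomposition β J Γ) :=
  ⟨(pureDecomposition_univ_le β J Γ).trans_lt ENNReal.one_lt_top⟩

/-- Moments are pointwise limits of measurable functions, cut off to 0 outside the measurable set of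
Gibbs pairs. -/
lemma measurable_pureDecomposition (β : ℝ) :
    Measurable fun p : Couplings d × State d => pureDecomposition β p.1 p.2 := by
  classical
  refine measurable_of_moments _ fun s u => ?_
  let g : ℕ → Couplings d × State d → ℝ := fun n p =>
    if IsGibbs β p.1 p.2 then ∫ ω, upCond β p.1 u n ω ∂(p.2 : Measure (Config d)) else 0
  refine measurable_of_tendsto_metrizable (f := g) (fun n => ?_) (tendsto_pi_nhds.2 fun p => ?_)
  · exact Measurable.ite (measurableSet_isGibbs β)
      (measurable_integral_state (measurable_upCond u n)) measurable_const
  · by_cases h : IsGibbs β p.1 p.2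
    · simpa only [g, if_pos h] using h.isPureDecomposition.tendsto_moment u
    · simp [g, if_neg h, pureDecomposition_of_not_isGibbs h]

/-- The decomposition into pure states as a kernel. -/
noncomputable def pureKernel (d : ℕ) (β : ℝ) : Kernel (Couplings d × State d) (State d) :=
  ⟨fun p => pureDecomposition β p.1 p.2, measurable_pureDecomposition β⟩

instance (β : ℝ) : IsFiniteKernel (pureKernel d β) :=
  ⟨1, ENNReal.one_lt_top, fun p => pureDecomposition_univ_le β p.1 p.2⟩

lemma measurable_pureDecomposition_prod (β : ℝ) {B : Set (State d × State d)}
    (hB : MeasurableSet B) :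
    Measurable fun p : Couplings d × State d =>
      ((pureDecomposition β p.1 p.2).prod (pureDecomposition β p.1 p.2)) B := by
  refine (congrArg Measurable (funext fun p => ?_)).mp
    ((pureKernel d β ×ₖ pureKernel d β).measurable_coe hB)
  rw [Kernel.prod_apply]
  rfl

end Uniqueness

end EA

namespace EA

variable {d : ℕ}

/-! ### Finite-volume Gibbs measures -/

section Permutation

variable {φ : Equiv.Perm (Site d)} {W W' : Finset (Site d)}

/-- Configurations in `W` and in its preimage under a permutation of the sites. -/
def permConfig (hW : ∀ x, x ∈ W' ↔ φ x ∈ W) : (W → ℤˣ) ≃ (W' → ℤˣ) :=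
  ((φ.subtypeEquiv (p := (· ∈ W')) (q := (· ∈ W)) hW).arrowCongr (Equiv.refl ℤˣ)).symm

lemma glue_comp_perm (hW : ∀ x, x ∈ W' ↔ φ x ∈ W) (η : W → ℤˣ) (ω : Config d) :
    glue W η ω ∘ φ = glue W' (permConfig hW η) (ω ∘ φ) := by
  funext x
  by_cases hx : x ∈ W'
  · rw [glue_of_mem _ _ hx, Function.comp_apply, glue_of_mem _ _ ((hW x).1 hx)]
    rfl
  · rw [glue_of_notMem _ _ hx, Function.comp_apply,
      glue_of_notMem _ _ fun h => hx ((hW x).2 h)]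
    rfl

lemma measurable_comp_perm (φ : Equiv.Perm (Site d)) :
    Measurable fun σ : Config d => (σ ∘ φ : Config d) :=
  measurable_pi_lambda _ fun x => measurable_pi_apply (φ x)

lemma boltzmann_map_perm (hW : ∀ x, x ∈ W' ↔ φ x ∈ W) {β : ℝ} {H H' : Config d → ℝ}
    (hH : ∀ σ : Config d, H' (σ ∘ φ) = H σ) (ω : Config d) :
    (boltzmann W β H ω).map (fun σ => (σ ∘ φ : Config d)) = boltzmann W' β H' (ω ∘ φ) := by
  have hw : ∀ η, weight W' β H' (ω ∘ φ) (permConfig hW η) = weight W β H ω η := by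
    intro η
    unfold weight
    rw [← glue_comp_perm, hH]
    congr 1
    rw [← Equiv.sum_comp (permConfig hW)]
    exact Finset.sum_congr rfl fun η' _ => by rw [← glue_comp_perm, hH]
  ext A hA
  rw [← lintegral_indicator_one hA, ← lintegral_indicator_one hA, lintegral_map
    (measurable_one.indicator hA) (measurable_comp_perm φ), lintegral_boltzmann,
    lintegral_boltzmann, ← Equiv.sum_comp (permConfig hW)]
  exact Finset.sum_congr rfl fun η _ => by rw [hw, glue_comp_perm hW]

end Permutation

/-- Detailed balance. Resampling in `W` changes `H` by the same amount as the local Hamiltonian, so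
the joint weight of old and new spins is symmetric under their exchange. -/
lemma integral_localMean_boltzmann {Λ W : Finset (Site d)} (hWΛ : W ⊆ Λ) (β : ℝ) (J : Couplings d)
    {H : Config d → ℝ} (hH : Exterior W fun σ => H σ - localHamiltonian J W σ) (ω : Config d)
    (f : Config d → ℝ) :
    ∫ σ, localMean β J W f σ ∂boltzmann Λ β H ω = ∫ σ, f σ ∂boltzmann Λ β H ω := by
  classical
  rw [integral_boltzmann, integral_boltzmann]
  let L := localHamiltonian J W
  -- Exchanges the old spins in `W` with the resampled ones.
  let swap : (Λ → ℤˣ) × (W → ℤˣ) → (Λ → ℤˣ) × (W → ℤˣ) := fun p =>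
    (fun x => if h : (x : Site d) ∈ W then p.2 ⟨x, h⟩ else p.1 x, fun x => p.1 ⟨x, hWΛ x.2⟩)
  have hswap : Function.Involutive swap := by
    rintro ⟨ξ, η⟩
    refine Prod.ext (funext fun x => ?_) (funext fun x => ?_)
    · by_cases h : (x : Site d) ∈ W <;> simp [swap, h]
    · simp [swap]
  have hglue : ∀ ξ η, glue Λ (swap (ξ, η)).1 ω = glue W η (glue Λ ξ ω) := by
    intro ξ η
    funext x
    by_cases hx : x ∈ W
    · rw [glue_of_mem _ _ hx, glue_of_mem _ _ (hWΛ hx)]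
      simp [swap, hx]
    · rw [glue_of_notMem _ _ hx]
      by_cases hx' : x ∈ Λ
      · rw [glue_of_mem _ _ hx', glue_of_mem _ _ hx']
        simp [swap, hx]
      · rw [glue_of_notMem _ _ hx', glue_of_notMem _ _ hx']
  have hglue' : ∀ ξ η, glue W (swap (ξ, η)).2 (glue W η (glue Λ ξ ω)) = glue Λ ξ ω := by
    intro ξ η
    rw [glue_glue]
    funext x
    by_cases hx : x ∈ W
    · rw [glue_of_mem _ _ hx, glue_of_mem _ _ (hWΛ hx)]
    · rw [glue_of_notMem _ _ hx]
  let T : (Λ → ℤˣ) × (W → ℤˣ) → ℝ := fun p =>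
    weight Λ β H ω p.1 * (weight W β L (glue Λ p.1 ω) p.2 * f (glue W p.2 (glue Λ p.1 ω)))
  have hT : ∀ p, T (swap p) = weight Λ β H ω p.1 * (weight W β L (glue Λ p.1 ω) p.2 *
      f (glue Λ p.1 ω)) := by
    rintro ⟨ξ, η⟩
    simp only [T, hglue, hglue', weight_glue]
    rw [← mul_assoc, ← mul_assoc]
    congr 1
    unfold weight
    rw [hglue, ← glue_glue W (swap (ξ, η)).2 η, hglue']
    have h1 : H (glue W η (glue Λ ξ ω)) - L (glue W η (glue Λ ξ ω)) =
      H (glue Λ ξ ω) - L (glue Λ ξ ω) := hH η _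
    rw [div_mul_div_comm, div_mul_div_comm, ← Real.exp_add, ← Real.exp_add]
    congr 2
    linear_combination (-β) * h1
  calc ∑ ξ, weight Λ β H ω ξ * localMean β J W f (glue Λ ξ ω)
      = ∑ p, T p := by
        rw [Fintype.sum_prod_type]
        refine Finset.sum_congr rfl fun ξ _ => ?_
        rw [localMean, Finset.mul_sum]
    _ = ∑ p, T (swap p) := (Equiv.sum_comp (hswap.toPerm swap) T).symm
    _ = ∑ ξ, weight Λ β H ω ξ * f (glue Λ ξ ω) := by
        simp only [hT]
        rw [Fintype.sum_prod_type]
        refine Finset.sum_congr rfl fun ξ _ => ?_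
        simp only
        rw [← Finset.mul_sum, ← Finset.sum_mul, sum_weight, one_mul]

/-! ### Periodic boxes -/

section Periodic

variable {a b : Site d}

lemma wrap_mem (hab : a ≤ b) (x : Site d) : wrap a b x ∈ Finset.Icc a b := by
  rw [Finset.mem_Icc, Pi.le_def, Pi.le_def]
  constructor <;> intro i <;> have h : a i ≤ b i := hab i <;>
    have h1 := Int.emod_nonneg (x i - a i) (show b i - a i + 1 ≠ 0 by omega) <;>
    have h2 := Int.emod_lt_of_pos (x i - a i) (show 0 < b i - a i + 1 by omega) <;>
    simp only [wrap] <;> omega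

lemma wrap_of_mem {x : Site d} (hx : x ∈ Finset.Icc a b) : wrap a b x = x := by
  rw [Finset.mem_Icc, Pi.le_def, Pi.le_def] at hx
  funext i
  have h1 := hx.1 i
  have h2 := hx.2 i
  rw [wrap, Int.emod_eq_of_lt (by omega) (by omega)]
  omega

lemma wrap_wrap_add (x v : Site d) : wrap a b (wrap a b x + v) = wrap a b (x + v) := by
  funext i
  simp only [wrap, Pi.add_apply]
  congr 1
  rw [show a i + (x i - a i) % (b i - a i + 1) + v i - a i =
    (x i - a i) % (b i - a i + 1) + v i by ring, Int.emod_add_emod]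
  congr 1
  ring

/-- The rotation of the torus `[a, b]` by `v`, extended by the identity. -/
noncomputable def rotate (hab : a ≤ b) (v : Site d) : Equiv.Perm (Site d) where
  toFun x := if x ∈ Finset.Icc a b then wrap a b (x + v) else x
  invFun x := if x ∈ Finset.Icc a b then wrap a b (x + -v) else x
  left_inv x := by
    by_cases hx : x ∈ Finset.Icc a b
    · simp only [if_pos hx, if_pos (wrap_mem hab _)]
      rw [wrap_wrap_add, add_neg_cancel_right, wrap_of_mem hx]
    · simp only [if_neg hx]
  right_inv x := by
    by_cases hx : x ∈ Finset.Icc a b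
    · simp only [if_pos hx, if_pos (wrap_mem hab _)]
      rw [wrap_wrap_add, neg_add_cancel_right, wrap_of_mem hx]
    · simp only [if_neg hx]

lemma rotate_of_mem (hab : a ≤ b) (v : Site d) {x : Site d} (hx : x ∈ Finset.Icc a b) :
    rotate hab v x = wrap a b (x + v) := if_pos hx

lemma mem_Icc_iff_rotate (hab : a ≤ b) (v x : Site d) :
    x ∈ Finset.Icc a b ↔ rotate hab v x ∈ Finset.Icc a b := by
  by_cases hx : x ∈ Finset.Icc a b
  · simp only [hx, rotate_of_mem hab v hx, wrap_mem hab]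
  · have : rotate hab v x = x := if_neg hx
    rw [this]

/-- The action of a permutation of the sites on the couplings. -/
def permCouplings (φ : Equiv.Perm (Site d)) (J : Couplings d) : Couplings d :=
  fun e => J (φ e.1, e.2)

/-- A torus edge is given by its base point and direction, so permuting base points also carries the
edges that close up across a face. -/
lemma periodicHamiltonian_rotate (hab : a ≤ b) (v : Site d) (J : Couplings d) (σ : Config d) :
    periodicHamiltonian (permCouplings (rotate hab v) J) a b (σ ∘ rotate hab v) =
      periodicHamiltonian J a b σ := by
  unfold periodicHamiltonian
  congr 1
  refine Finset.sum_equiv (rotate hab v) (fun x => mem_Icc_iff_rotate hab v x) fun x hx => ?_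
  refine Finset.sum_congr rfl fun i _ => ?_
  simp only [permCouplings, spin, Function.comp_apply]
  rw [rotate_of_mem hab v (wrap_mem hab _), wrap_wrap_add, rotate_of_mem hab v hx, wrap_wrap_add,
    add_right_comm]

lemma periodicGibbs_map_rotate (hab : a ≤ b) (v : Site d) (β : ℝ) (J : Couplings d) :
    (periodicGibbs β J a b).map (fun σ => (σ ∘ rotate hab v : Config d)) =
      periodicGibbs β (permCouplings (rotate hab v) J) a b :=
  boltzmann_map_perm (fun x => mem_Icc_iff_rotate hab v x) (periodicHamiltonian_rotate hab v J) _

instance (β : ℝ) (J : Couplings d) (a b : Site d) : IsProbabilityMeasure (periodicGibbs β J a b) :=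
  inferInstanceAs (IsProbabilityMeasure (boltzmann _ _ _ _))

lemma mem_touchingEdges {W : Finset (Site d)} {e : Edge d} :
    e ∈ touchingEdges W ↔ e.1 ∈ W ∨ Edge.head e ∈ W := by
  simp only [touchingEdges, Finset.mem_union, Finset.mem_product, Finset.mem_univ, and_true,
    Finset.mem_image]
  refine or_congr_right ⟨?_, fun h => ⟨(Edge.head e, e.2), h, ?_⟩⟩
  · rintro ⟨e', he', rfl⟩
    simpa [Edge.head] using he'
  · simp [Edge.head]

/-- The endpoints of the edges that touch `W`. -/
def touchingSites (W : Finset (Site d)) : Finset (Site d) :=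
  (touchingEdges W).image (fun e => e.1) ∪ (touchingEdges W).image Edge.head

lemma exterior_periodicHamiltonian_sub {W : Finset (Site d)}
    (hW : touchingSites W ⊆ Finset.Icc a b) (J : Couplings d) :
    Exterior W fun σ => periodicHamiltonian J a b σ - localHamiltonian J W σ := by
  have h1 : ∀ e ∈ touchingEdges W, e.1 ∈ Finset.Icc a b := fun e he =>
    hW (Finset.mem_union_left _ (Finset.mem_image_of_mem _ he))
  have h2 : ∀ e ∈ touchingEdges W, Edge.head e ∈ Finset.Icc a b := fun e he =>
    hW (Finset.mem_union_right _ (Finset.mem_image_of_mem _ he))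
  let t : Config d → Edge d → ℝ := fun σ e =>
    J e * spin σ e.1 * spin σ (wrap a b (Edge.head e))
  have hper : ∀ σ, periodicHamiltonian J a b σ = -∑ e ∈ Finset.Icc a b ×ˢ Finset.univ, t σ e :=
    fun σ => by
      rw [Finset.sum_product]
      rfl
  have hloc : ∀ σ, localHamiltonian J W σ = -∑ e ∈ touchingEdges W, t σ e := fun σ => by
    unfold localHamiltonian
    congr 1
    refine Finset.sum_congr rfl fun e he => ?_
    simp only [t, wrap_of_mem (h2 e he), edgeSpin, mul_assoc]
  have hsub : touchingEdges W ⊆ Finset.Icc a b ×ˢ Finset.univ := fun e he => by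
    simpa using h1 e he
  have hdiff : ∀ σ, periodicHamiltonian J a b σ - localHamiltonian J W σ =
      -∑ e ∈ (Finset.Icc a b ×ˢ Finset.univ) \ touchingEdges W, t σ e := fun σ => by
    rw [hper, hloc, ← Finset.sum_sdiff hsub]
    ring
  intro η σ
  simp only [hdiff]
  congr 1
  refine Finset.sum_congr rfl fun e he => ?_
  rw [Finset.mem_sdiff, mem_touchingEdges, not_or, Finset.mem_product] at he
  obtain ⟨⟨heb, -⟩, he1, he2⟩ := he
  -- If the wrapped endpoint y were in `W`, the box would contain y - eᵢ, the base of an edge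
  -- touching `W`. On the torus that site is `e.1`, so the edge does not wrap and its head lies in
  -- `W`.
  have he3 : wrap a b (Edge.head e) ∉ W := by
    intro hmem
    set y := wrap a b (Edge.head e) with hy
    have h3 : (y - Pi.single e.2 1, e.2) ∈ touchingEdges W := by
      rw [mem_touchingEdges]
      right
      simpa [Edge.head] using hmem
    have h4 := wrap_of_mem (h1 _ h3)
    simp only at h4
    rw [sub_eq_add_neg, hy, wrap_wrap_add, Edge.head, add_neg_cancel_right, wrap_of_mem heb,
      ← sub_eq_add_neg, eq_sub_iff_add_eq] at h4
    rw [Edge.head, h4] at he2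
    exact he2 (by rw [hy, Edge.head] at hmem; exact hmem)
  simp only [t, spin, glue_of_notMem _ _ he1, glue_of_notMem _ _ he3]

lemma integral_localMean_periodicGibbs {W : Finset (Site d)}
    (hW : touchingSites W ⊆ Finset.Icc a b) (hW' : W ⊆ Finset.Icc a b) (β : ℝ) (J : Couplings d)
    (f : Config d → ℝ) :
    ∫ σ, localMean β J W f σ ∂periodicGibbs β J a b = ∫ σ, f σ ∂periodicGibbs β J a b :=
  integral_localMean_boltzmann hW' β J (exterior_periodicHamiltonian_sub hW J) _ f

end Periodic

end EA

namespace EA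

variable {d : ℕ}

/-! ### Metastates -/

/-- Evaluation of a function of finitely many couplings and spins. -/
def evalTest {E : Finset (Edge d)} {W : Finset (Site d)} (h : ((E → ℝ) × (W → ℤˣ)) →ᵇ ℝ)
    (J : Couplings d) (σ : Config d) : ℝ := h (fun e => J e, fun x => σ x)

section Test

variable {E : Finset (Edge d)} {W : Finset (Site d)}

lemma measurable_evalTest (h : ((E → ℝ) × (W → ℤˣ)) →ᵇ ℝ) :
    Measurable fun p : Couplings d × Config d => evalTest h p.1 p.2 := by
  refine h.continuous.measurable.comp (Measurable.prodMk ?_ ?_)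
  · exact measurable_pi_lambda _ fun e => (measurable_pi_apply _).comp measurable_fst
  · exact measurable_pi_lambda _ fun x => (measurable_pi_apply _).comp measurable_snd

lemma measurable_evalTest_right (h : ((E → ℝ) × (W → ℤˣ)) →ᵇ ℝ) (J : Couplings d) :
    Measurable (evalTest h J) :=
  (measurable_evalTest h).comp (measurable_prodMk_left (x := J))

lemma abs_evalTest_le (h : ((E → ℝ) × (W → ℤˣ)) →ᵇ ℝ) (J : Couplings d) (σ : Config d) :
    |evalTest h J σ| ≤ ‖h‖ := h.norm_coe_le_norm _

/-- The product of the means of test functions in independent replicas. -/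
noncomputable def testMean {s : ℕ} (h : Fin s → ((E → ℝ) × (W → ℤˣ)) →ᵇ ℝ) (J : Couplings d)
    (μ : Measure (Config d)) : ℝ :=
  ∏ i, ∫ σ, evalTest (h i) J σ ∂μ

lemma measurable_testMean {s : ℕ} (h : Fin s → ((E → ℝ) × (W → ℤˣ)) →ᵇ ℝ) :
    Measurable fun p : Couplings d × State d => testMean h p.1 (p.2 : Measure (Config d)) :=
  Finset.measurable_fun_prod _ fun i _ => measurable_integral_state (measurable_evalTest (h i))

lemma abs_testMean_le {s : ℕ} (h : Fin s → ((E → ℝ) × (W → ℤˣ)) →ᵇ ℝ) (J : Couplings d)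
    (μ : Measure (Config d)) [IsProbabilityMeasure μ] : |testMean h J μ| ≤ ∏ i, ‖h i‖ := by
  rw [testMean, Finset.abs_prod]
  exact Finset.prod_le_prod (fun _ _ => abs_nonneg _)
    fun i _ => abs_integral_le (abs_evalTest_le (h i) J)

end Test

/-- Convergence in the definition of a metastate along the boxes `[a k, b k]`. -/
def ConvergesAlong (β : ℝ) (ν : Measure (Couplings d)) (κ : Kernel (Couplings d) (State d))
    (a b : ℕ → Site d) : Prop :=
  ∀ (E : Finset (Edge d)) (W : Finset (Site d)) (s : ℕ)
    (F : ((E → ℝ) × (Fin s → W → ℤˣ)) →ᵇ ℝ),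
    Tendsto
      (fun k => ∫ J, ∫ σ : Fin s → Config d,
          F (fun e => J e, fun i x => σ i x)
        ∂Measure.pi (fun _ => periodicGibbs β J (a k) (b k)) ∂ν)
      atTop
      (𝓝 (∫ J, ∫ Γ, ∫ σ : Fin s → Config d,
          F (fun e => J e, fun i x => σ i x)
        ∂Measure.pi (fun _ => (Γ : Measure (Config d))) ∂(κ J) ∂ν))

section Metastate

variable {β : ℝ} {ν : Measure (Couplings d)} [IsProbabilityMeasure ν]
  {κ : Kernel (Couplings d) (State d)} [IsMarkovKernel κ] {a b : ℕ → Site d}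

/-- A product of observables of different replicas integrates to the product of their means.
Metastate convergence thus controls polynomials in the random expectations. -/
lemma ConvergesAlong.tendsto_testMean (hκ : ConvergesAlong β ν κ a b) {E : Finset (Edge d)}
    {W : Finset (Site d)} {s : ℕ} (h : Fin s → ((E → ℝ) × (W → ℤˣ)) →ᵇ ℝ) :
    Tendsto (fun k => ∫ J, testMean h J (periodicGibbs β J (a k) (b k)) ∂ν) atTop
      (𝓝 (∫ p, testMean h p.1 (p.2 : Measure (Config d)) ∂(ν ⊗ₘ κ))) := by
  have hcont : Continuous fun p : (E → ℝ) × (Fin s → W → ℤˣ) => ∏ i, h i (p.1, p.2 i) :=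
    continuous_finsetProd _ fun i _ => (h i).continuous.comp
      (continuous_fst.prodMk ((continuous_apply i).comp continuous_snd))
  have hb : ∀ p : (E → ℝ) × (Fin s → W → ℤˣ), ‖∏ i, h i (p.1, p.2 i)‖ ≤ ∏ i, ‖h i‖ := fun p => by
    rw [norm_prod]
    exact Finset.prod_le_prod (fun _ _ => norm_nonneg _) fun i _ => (h i).norm_coe_le_norm _
  have key := hκ E W s (BoundedContinuousFunction.ofNormedAddCommGroup _ hcont _ hb)
  have hpi : ∀ (J : Couplings d) (μ : Measure (Config d)) [IsProbabilityMeasure μ],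
      ∫ σ : Fin s → Config d, BoundedContinuousFunction.ofNormedAddCommGroup _ hcont _ hb
        (fun e => J e, fun i x => σ i x) ∂Measure.pi (fun _ => μ) = testMean h J μ := fun J μ _ =>
    integral_fintype_prod_eq_prod (fun (i : Fin s) (σ : Config d) => evalTest (h i) J σ)
  simp only [hpi] at key
  rwa [Measure.integral_compProd (Bounded.integrable (measurable_testMean h)
    fun p => abs_testMean_le h p.1 (p.2 : Measure (Config d)))]

lemma eventually_subset_Icc (ha : Tendsto a atTop atBot) (hb : Tendsto b atTop atTop)
    (S : Finset (Site d)) : ∀ᶠ k in atTop, S ⊆ Finset.Icc (a k) (b k) := by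
  have h : ∀ x ∈ S, ∀ᶠ k in atTop, x ∈ Finset.Icc (a k) (b k) := fun x _ => by
    filter_upwards [ha.eventually_le_atBot x, hb.eventually_ge_atTop x] with k h1 h2
    exact Finset.mem_Icc.2 ⟨h1, h2⟩
  exact (S.eventually_all).2 h

/-! #### The DLR equations -/

lemma localMean_congr {J J' : Couplings d} {W : Finset (Site d)} {f : Config d → ℝ}
    {σ σ' : Config d} (hJ : ∀ e ∈ touchingEdges W, J e = J' e)
    (hσ : ∀ x ∈ touchingSites W, σ x = σ' x)
    (hf : ∀ η, f (glue W η σ) = f (glue W η σ')) :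
    localMean β J W f σ = localMean β J' W f σ' := by
  have hg : ∀ η, ∀ x ∈ touchingSites W, spin (glue W η σ) x = spin (glue W η σ') x := by
    intro η x hx
    by_cases hxW : x ∈ W
    · simp only [spin, glue_of_mem _ _ hxW]
    · simp only [spin, glue_of_notMem _ _ hxW, hσ x hx]
  have hH : ∀ η, localHamiltonian J W (glue W η σ) = localHamiltonian J' W (glue W η σ') := by
    intro η
    unfold localHamiltonian
    congr 1
    refine Finset.sum_congr rfl fun e he => ?_
    rw [hJ e he, edgeSpin, edgeSpin, hg η _ (Finset.mem_union_left _ (Finset.mem_image_of_mem _ he)),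
      hg η _ (Finset.mem_union_right _ (Finset.mem_image_of_mem _ he))]
  simp only [localMean, weight, hH, hf]

/-- Extension of couplings by `0`. -/
def extendCouplings {E : Finset (Edge d)} (j : E → ℝ) : Couplings d :=
  fun e => if h : e ∈ E then j ⟨e, h⟩ else 0

lemma continuous_extendCouplings {E : Finset (Edge d)} :
    Continuous (extendCouplings (E := E)) := by
  refine continuous_pi fun e => ?_
  by_cases h : e ∈ E
  · simpa [extendCouplings, h] using continuous_apply _
  · simpa [extendCouplings, h] using continuous_const

lemma continuous_localMean (β : ℝ) (W : Finset (Site d)) (f : Config d → ℝ) (σ : Config d) :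
    Continuous fun J => localMean β J W f σ := by
  have hH : ∀ τ : Config d, Continuous fun J => Real.exp (-β * localHamiltonian J W τ) := by
    intro τ
    unfold localHamiltonian
    fun_prop
  refine continuous_finsetSum _ fun η _ => Continuous.mul ?_ continuous_const
  refine (hH _).div (continuous_finsetSum _ fun η' _ => hH _) fun J => ?_
  exact (Finset.sum_pos (fun _ _ => Real.exp_pos _) Finset.univ_nonempty).ne'

lemma upInd_congr {U : Finset (Site d)} {σ σ' : Config d} (h : ∀ x ∈ U, σ x = σ' x) :
    upInd U σ = upInd U σ' := by
  have : σ ∈ allUp U ↔ σ' ∈ allUp U := by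
    refine forall₂_congr fun x hx => ?_
    rw [h x hx]
  by_cases hσ : σ ∈ allUp U
  · simp [upInd, hσ, this.1 hσ]
  · simp [upInd, hσ, mt this.2 hσ]

/-- By the finite range of the interaction, the defect in a DLR equation is a bounded continuous
function of finitely many couplings and spins, hence an admissible test function. -/
lemma exists_dlrTest (β : ℝ) (W U : Finset (Site d)) :
    ∃ (V : Finset (Site d)) (h : ((touchingEdges W → ℝ) × (V → ℤˣ)) →ᵇ ℝ), ∀ J σ,
      evalTest h J σ = localMean β J W (upInd U) σ - upInd U σ := by
  classical
  let V := touchingSites W ∪ U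
  have hcont : Continuous fun p : (touchingEdges W → ℝ) × (V → ℤˣ) =>
      localMean β (extendCouplings p.1) W (upInd U) (glue V p.2 fun _ => 1) -
        upInd U (glue V p.2 fun _ => 1) := by
    -- The spin space is discrete, so continuity is only needed in the couplings.
    refine continuous_prod_of_discrete_right.2 fun s => ?_
    have h1 := (continuous_localMean β W (upInd U) (glue V s fun _ => 1)).comp
      (continuous_extendCouplings (E := touchingEdges W))
    simp only [Function.comp_def] at h1
    change Continuous fun j : touchingEdges W → ℝ => localMean β (extendCouplings j) W (upInd U)
      (glue V s fun _ => 1) - upInd U (glue V s fun _ => 1)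
    exact h1.sub continuous_const
  refine ⟨V, BoundedContinuousFunction.ofNormedAddCommGroup _ hcont (1 + 1) fun p => ?_, ?_⟩
  · exact (abs_sub _ _).trans (add_le_add (abs_localMean_le _ _ _ (abs_upInd_le U) _)
      (abs_upInd_le U _))
  · intro J σ
    have hσ : ∀ x ∈ V, glue V (fun x => σ x) (fun _ => 1) x = σ x := fun x hx =>
      glue_of_mem _ _ hx
    have h1 : ∀ x ∈ U, glue V (fun x => σ x) (fun _ => 1) x = σ x := fun x hx =>
      hσ x (Finset.mem_union_right _ hx)
    change localMean β (extendCouplings fun e => J e) W (upInd U) (glue V (fun x => σ x) fun _ => 1)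
      - upInd U (glue V (fun x => σ x) fun _ => 1) = _
    rw [upInd_congr h1]
    congr 1
    refine localMean_congr (fun e he => ?_) (fun x hx => ?_) fun η => ?_
    · simp [extendCouplings, he]
    · exact hσ x (Finset.mem_union_left _ hx)
    · refine upInd_congr fun x hx => ?_
      by_cases hxW : x ∈ W
      · rw [glue_of_mem _ _ hxW, glue_of_mem _ _ hxW]
      · rw [glue_of_notMem _ _ hxW, glue_of_notMem _ _ hxW, h1 x hx]

/-- With two replicas the test mean is the square of the expected defect. It vanishes in every large
box, so its limiting mean is 0, and nonnegativity makes the defect vanish almost surely. -/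
lemma ConvergesAlong.ae_isGibbs (hκ : ConvergesAlong β ν κ a b) (ha : Tendsto a atTop atBot)
    (hb : Tendsto b atTop atTop) : ∀ᵐ p ∂(ν ⊗ₘ κ), IsGibbs β p.1 p.2 := by
  classical
  simp only [isGibbs_iff_integral]
  refine ae_all_iff.2 fun W => ae_all_iff.2 fun U => ?_
  obtain ⟨V, h, hh⟩ := exists_dlrTest β W U
  have hint : ∀ (J : Couplings d) (μ : Measure (Config d)) [IsProbabilityMeasure μ],
      ∫ σ, evalTest h J σ ∂μ = ∫ ω, localMean β J W (upInd U) ω ∂μ - ∫ ω, upInd U ω ∂μ := by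
    intro J μ _
    simp only [hh]
    exact integral_sub (Bounded.integrable (measurable_localMean β J W (measurable_upInd U))
      (abs_localMean_le β J W (abs_upInd_le U)))
      (Bounded.integrable (measurable_upInd U) (abs_upInd_le U))
  have hlim := hκ.tendsto_testMean (fun _ : Fin 2 => h)
  have h0 : (fun k => ∫ J, testMean (fun _ : Fin 2 => h) J (periodicGibbs β J (a k) (b k)) ∂ν)
      =ᶠ[atTop] fun _ => 0 := by
    filter_upwards [eventually_subset_Icc ha hb (touchingSites W ∪ W)] with k hk
    refine integral_eq_zero_of_ae (.of_forall fun J => ?_)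
    simp only [testMean, hint]
    rw [integral_localMean_periodicGibbs (Finset.union_subset_left hk)
      (Finset.union_subset_right hk)]
    simp
  have hz := tendsto_nhds_unique (hlim.congr' h0) tendsto_const_nhds
  rw [integral_eq_zero_iff_of_nonneg] at hz
  · filter_upwards [hz] with p hp
    simp only [testMean, hint, Finset.prod_const, Finset.card_univ, Fintype.card_fin,
      Pi.zero_apply] at hp
    exact sub_eq_zero.1 (pow_eq_zero_iff two_ne_zero |>.1 hp)
  · intro p
    simp only [testMean, Finset.prod_const, Finset.card_univ, Fintype.card_fin, Pi.zero_apply]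
    positivity
  · exact Bounded.integrable (measurable_testMean _)
      fun p => abs_testMean_le _ p.1 (p.2 : Measure (Config d))

end Metastate

end EA

namespace EA

variable {d : ℕ}

/-! ### Translation invariance -/

/-- The translation of configurations. -/
def shiftConfig (v : Site d) (σ : Config d) : Config d := σ ∘ Equiv.addRight v

/-- The translation of couplings. -/
def shiftCouplings (v : Site d) (J : Couplings d) : Couplings d :=
  permCouplings (Equiv.addRight v) J

lemma measurable_shiftConfig (v : Site d) : Measurable (shiftConfig v) :=
  measurable_comp_perm _

lemma measurable_permCouplings (φ : Equiv.Perm (Site d)) :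
    Measurable (permCouplings φ) :=
  measurable_pi_lambda _ fun _ => measurable_pi_apply _

/-- The translation of states. -/
noncomputable def shiftState (v : Site d) (Γ : State d) : State d :=
  Γ.map (measurable_shiftConfig v).aemeasurable

lemma coe_shiftState (v : Site d) (Γ : State d) :
    (shiftState v Γ : Measure (Config d)) = (Γ : Measure (Config d)).map (shiftConfig v) := rfl

lemma measurable_shiftState (v : Site d) : Measurable (shiftState (d := d) v) := by
  refine measurable_state fun U => ?_
  simp only [coe_shiftState, Measure.map_apply (measurable_shiftConfig v) (measurableSet_allUp U)]
  exact measurable_state_apply (measurable_shiftConfig v (measurableSet_allUp U))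

lemma integral_shiftState (v : Site d) (Γ : State d) {f : Config d → ℝ} (hf : Measurable f) :
    ∫ σ, f σ ∂(shiftState v Γ : Measure (Config d)) =
      ∫ σ, f (shiftConfig v σ) ∂(Γ : Measure (Config d)) := by
  rw [coe_shiftState, integral_map (measurable_shiftConfig v).aemeasurable
    hf.aestronglyMeasurable]

/-- The translation of couplings and states. -/
noncomputable def shiftPair (v : Site d) (p : Couplings d × State d) : Couplings d × State d :=
  (shiftCouplings v p.1, shiftState v p.2)

lemma measurable_shiftPair (v : Site d) : Measurable (shiftPair (d := d) v) :=
  ((measurable_permCouplings _).comp measurable_fst).prodMk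
    ((measurable_shiftState v).comp measurable_snd)

instance (μ₀ : Measure ℝ) [IsProbabilityMeasure μ₀] : IsProbabilityMeasure (couplingLaw d μ₀) :=
  inferInstanceAs (IsProbabilityMeasure (Measure.infinitePi _))

/-- The action of a permutation of the sites on the couplings. -/
def permCouplingsEquiv (φ : Equiv.Perm (Site d)) : Couplings d ≃ᵐ Couplings d where
  toFun := permCouplings φ
  invFun := permCouplings φ.symm
  left_inv J := by funext e; simp [permCouplings]
  right_inv J := by funext e; simp [permCouplings]
  measurable_toFun := measurable_permCouplings φ
  measurable_invFun := measurable_permCouplings φ.symm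

/-- All permutations of sites are needed, since a rotation of a periodic box is not a translation of
the lattice. -/
lemma measurePreserving_permCouplings (μ₀ : Measure ℝ) [IsProbabilityMeasure μ₀]
    (φ : Equiv.Perm (Site d)) :
    MeasurePreserving (permCouplingsEquiv φ) (couplingLaw d μ₀) (couplingLaw d μ₀) := by
  refine ⟨(permCouplingsEquiv φ).measurable, ?_⟩
  let ε : Edge d ≃ Edge d := φ.symm.prodCongr (Equiv.refl _)
  have h := Measure.infinitePi_map_piCongrLeft (X := fun _ : Edge d => ℝ) (fun _ => μ₀) ε
  have hfun : ⇑(permCouplingsEquiv φ) = MeasurableEquiv.piCongrLeft (fun _ : Edge d => ℝ) ε := by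
    funext J e
    obtain ⟨e, rfl⟩ := ε.surjective e
    rw [MeasurableEquiv.piCongrLeft_apply_apply]
    change J (φ (φ.symm e.1), e.2) = J e
    rw [Equiv.apply_symm_apply]
  rw [hfun]
  exact h

section TestShift

variable {β : ℝ} {κ : Kernel (Couplings d) (State d)} [IsMarkovKernel κ] {a b : ℕ → Site d}
  {μ₀ : Measure ℝ} [IsProbabilityMeasure μ₀] {E : Finset (Edge d)} {W : Finset (Site d)}

lemma exists_shiftTest (v : Site d) (h : ((E → ℝ) × (W → ℤˣ)) →ᵇ ℝ) :
    ∃ h' : ((E.image (fun e => (e.1 + v, e.2)) → ℝ) × (W.image (· + v) → ℤˣ)) →ᵇ ℝ,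
      ∀ J σ, evalTest h' J σ = evalTest h (shiftCouplings v J) (shiftConfig v σ) := by
  let g : C((E.image (fun e => (e.1 + v, e.2)) → ℝ) × (W.image (· + v) → ℤˣ),
      (E → ℝ) × (W → ℤˣ)) :=
    ⟨fun p => (fun e => p.1 ⟨(e.1.1 + v, e.1.2), Finset.mem_image_of_mem _ e.2⟩,
      fun x => p.2 ⟨x.1 + v, Finset.mem_image_of_mem _ x.2⟩), by fun_prop⟩
  exact ⟨h.compContinuous g, fun J σ => rfl⟩

lemma integral_testMean_rotate (β : ℝ) (μ₀ : Measure ℝ) [IsProbabilityMeasure μ₀] {s : ℕ}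
    (h : Fin s → ((E → ℝ) × (W → ℤˣ)) →ᵇ ℝ) {a b : Site d} (hab : a ≤ b) (v : Site d) :
    ∫ J, ∏ i, ∫ σ, evalTest (h i) (permCouplings (rotate hab v) J) (σ ∘ rotate hab v)
        ∂periodicGibbs β J a b ∂couplingLaw d μ₀ =
      ∫ J, testMean h J (periodicGibbs β J a b) ∂couplingLaw d μ₀ := by
  rw [← (measurePreserving_permCouplings μ₀ (rotate hab v)).integral_comp'
    (g := fun J => testMean h J (periodicGibbs β J a b))]
  refine integral_congr_ae (.of_forall fun J => ?_)
  simp only [testMean]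
  refine Finset.prod_congr rfl fun i _ => ?_
  change ∫ σ, evalTest (h i) (permCouplings (rotate hab v) J) (σ ∘ rotate hab v)
    ∂periodicGibbs β J a b = ∫ σ, evalTest (h i) (permCouplings (rotate hab v) J) σ
    ∂periodicGibbs β (permCouplings (rotate hab v) J) a b
  rw [← periodicGibbs_map_rotate hab v, integral_map (measurable_comp_perm _).aemeasurable
    (measurable_evalTest_right _ _).aestronglyMeasurable]

/-- Rotating the torus leaves the mean in each finite box unchanged, and in large boxes the rotation
acts on the finitely many relevant sites as the translation by `v`. -/
lemma ConvergesAlong.integral_testMean_shift (hκ : ConvergesAlong β (couplingLaw d μ₀) κ a b)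
    (hab : ∀ k, a k ≤ b k) (ha : Tendsto a atTop atBot) (hb : Tendsto b atTop atTop) (v : Site d)
    {s : ℕ} (h : Fin s → ((E → ℝ) × (W → ℤˣ)) →ᵇ ℝ) :
    ∫ p, testMean h (shiftPair v p).1 ((shiftPair v p).2 : Measure (Config d))
        ∂(couplingLaw d μ₀ ⊗ₘ κ) =
      ∫ p, testMean h p.1 (p.2 : Measure (Config d)) ∂(couplingLaw d μ₀ ⊗ₘ κ) := by
  choose h' hh' using fun i => exists_shiftTest v (h i)
  have h1 : ∀ p : Couplings d × State d,
      testMean h (shiftPair v p).1 ((shiftPair v p).2 : Measure (Config d)) =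
        testMean h' p.1 (p.2 : Measure (Config d)) := fun p => by
    simp only [testMean, hh', shiftPair]
    exact Finset.prod_congr rfl fun i _ =>
      integral_shiftState v p.2 (measurable_evalTest_right (h i) _)
  simp only [h1]
  refine tendsto_nhds_unique (hκ.tendsto_testMean h')
    ((hκ.tendsto_testMean h).congr' ?_)
  -- Once the box contains these sites and their translates, no wrapping occurs on them.
  let S := E.image (fun e => e.1) ∪ W
  filter_upwards [eventually_subset_Icc ha hb (S ∪ S.image (· + v))] with k hk
  rw [← integral_testMean_rotate β μ₀ h (hab k) v]
  have hrot : ∀ x ∈ S, rotate (hab k) v x = x + v := fun x hx => by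
    rw [rotate_of_mem (hab k) v (hk (Finset.mem_union_left _ hx)),
      wrap_of_mem (hk (Finset.mem_union_right _ (Finset.mem_image_of_mem _ hx)))]
  refine integral_congr_ae (.of_forall fun J => ?_)
  simp only [testMean]
  refine Finset.prod_congr rfl fun i _ => integral_congr_ae (.of_forall fun σ => ?_)
  simp only [hh']
  refine congrArg (h i) (Prod.ext (funext fun e => ?_) (funext fun x => ?_))
  · simp only [permCouplings, shiftCouplings, Equiv.coe_addRight]
    rw [hrot _ (Finset.mem_union_left _ (Finset.mem_image_of_mem _ e.2))]
  · simp only [shiftConfig, Function.comp_apply, Equiv.coe_addRight]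
    rw [hrot _ (Finset.mem_union_right _ x.2)]

end TestShift

/-- A finite measure on couplings and states is determined by the means of test functions. -/
lemma measure_pair_ext {P Q : Measure (Couplings d × State d)} [IsFiniteMeasure P]
    [IsFiniteMeasure Q]
    (h : ∀ (E : Finset (Edge d)) (W : Finset (Site d)) (s : ℕ)
      (h : Fin s → ((E → ℝ) × (W → ℤˣ)) →ᵇ ℝ),
      ∫ p, testMean h p.1 (p.2 : Measure (Config d)) ∂P =
        ∫ p, testMean h p.1 (p.2 : Measure (Config d)) ∂Q) : P = Q := by
  classical
  have hres : ∀ E : Finset (Edge d), Measurable fun p : Couplings d × State d => E.restrict p.1 :=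
    fun E => (Finset.measurable_restrict E).comp measurable_fst
  have hmom : ∀ (E : Finset (Edge d)) (Φ : (E → ℝ) →ᵇ ℝ≥0) (s : ℕ) (u : Fin s → Finset (Site d)),
      ∫ p, (Φ (E.restrict p.1) : ℝ) * upProd u p.2 ∂P =
        ∫ p, (Φ (E.restrict p.1) : ℝ) * upProd u p.2 ∂Q := by
    intro E Φ s u
    let W := Finset.univ.biUnion u
    have hΦ : Continuous fun q : (E → ℝ) × (W → ℤˣ) => (Φ q.1 : ℝ) := by fun_prop
    have hU : ∀ i, Continuous fun q : (E → ℝ) × (W → ℤˣ) =>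
        upInd (u i) (glue W q.2 fun _ => 1) := fun i =>
      continuous_prod_of_discrete_right.2 fun s => by
        change Continuous fun _ : E → ℝ => upInd (u i) (glue W s fun _ => 1)
        exact continuous_const
    -- One extra replica carries the function of the couplings, which is constant in the spins.
    let t : Fin (s + 1) → ((E → ℝ) × (W → ℤˣ)) →ᵇ ℝ := Fin.cons
      (BoundedContinuousFunction.ofNormedAddCommGroup _ hΦ (nndist Φ 0) fun q => by
        rw [Real.norm_eq_abs, abs_of_nonneg (NNReal.coe_nonneg _)]
        exact_mod_cast NNReal.upper_bound Φ q.1)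
      fun i => BoundedContinuousFunction.ofNormedAddCommGroup _ (hU i) 1 fun q => abs_upInd_le _ _
    have ht : ∀ p : Couplings d × State d, testMean t p.1 (p.2 : Measure (Config d)) =
        (Φ (E.restrict p.1) : ℝ) * upProd u p.2 := by
      intro p
      rw [testMean, Fin.prod_univ_succ, upProd]
      congr 1
      · have : ∀ σ, evalTest (t 0) p.1 σ = (Φ (E.restrict p.1) : ℝ) := fun σ => rfl
        simp only [this]
        simp
      · refine Finset.prod_congr rfl fun i _ => ?_
        rw [← integral_upInd]
        refine integral_congr_ae (.of_forall fun σ => ?_)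
        refine upInd_congr (U := u i) (σ := glue W (fun x => σ x) fun _ => 1) fun x hx => ?_
        exact glue_of_mem _ _ (Finset.mem_biUnion.2 ⟨i, Finset.mem_univ i, hx⟩)
    simpa only [ht] using h E W (s + 1) t
  have hA : ∀ (E : Finset (Edge d)) (Φ : (E → ℝ) →ᵇ ℝ≥0) (A : Set (State d)), MeasurableSet A →
      ∫⁻ p in Prod.snd ⁻¹' A, Φ (E.restrict p.1) ∂P =
        ∫⁻ p in Prod.snd ⁻¹' A, Φ (E.restrict p.1) ∂Q := by
    intro E Φ A hA
    have hΦm : Measurable fun p : Couplings d × State d => (Φ (E.restrict p.1) : ℝ≥0) :=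
      Φ.continuous.measurable.comp (hres E)
    have hfin : ∀ (R : Measure (Couplings d × State d)) [IsFiniteMeasure R],
        IsFiniteMeasure (R.withDensity fun p => (Φ (E.restrict p.1) : ℝ≥0∞)) := fun R _ => by
      refine isFiniteMeasure_withDensity (ne_of_lt ?_)
      refine (lintegral_mono (g := fun _ => ((nndist Φ 0 : ℝ≥0) : ℝ≥0∞)) fun p =>
        ENNReal.coe_le_coe.2 (NNReal.upper_bound Φ _)).trans_lt ?_
      rw [lintegral_const]
      exact ENNReal.mul_lt_top ENNReal.coe_lt_top (measure_lt_top _ _)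
    have := hfin P
    have := hfin Q
    have heq : (P.withDensity fun p => (Φ (E.restrict p.1) : ℝ≥0∞)).map Prod.snd =
        (Q.withDensity fun p => (Φ (E.restrict p.1) : ℝ≥0∞)).map Prod.snd := by
      refine measure_state_ext fun s u => ?_
      rw [integral_map measurable_snd.aemeasurable (measurable_upProd u).aestronglyMeasurable,
        integral_map measurable_snd.aemeasurable (measurable_upProd u).aestronglyMeasurable,
        integral_withDensity_eq_integral_smul hΦm, integral_withDensity_eq_integral_smul hΦm]
      simpa only [NNReal.smul_def, smul_eq_mul] using hmom E Φ s u
    have := congrArg (fun R => R A) heq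
    simpa only [Measure.map_apply measurable_snd hA,
      withDensity_apply _ (measurable_snd hA)] using this
  have hfst : ∀ A : Set (State d), MeasurableSet A →
      (P.restrict (Prod.snd ⁻¹' A)).map Prod.fst = (Q.restrict (Prod.snd ⁻¹' A)).map Prod.fst := by
    intro A hAm
    -- With the event for the state fixed, the measure on couplings is determined by its marginals
    -- on finite sets of edges.
    refine IsProjectiveLimit.unique (P := fun E : Finset (Edge d) =>
      ((P.restrict (Prod.snd ⁻¹' A)).map Prod.fst).map E.restrict) (fun E => rfl) fun E => ?_
    change ((Q.restrict (Prod.snd ⁻¹' A)).map Prod.fst).map E.restrict =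
      ((P.restrict (Prod.snd ⁻¹' A)).map Prod.fst).map E.restrict
    refine ext_of_forall_lintegral_eq_of_IsFiniteMeasure fun Φ => ?_
    have hm : Measurable fun z : E → ℝ => (Φ z : ℝ≥0∞) := Φ.continuous.measurable.coe_nnreal_ennreal
    rw [Measure.map_map (Finset.measurable_restrict E) measurable_fst,
      Measure.map_map (Finset.measurable_restrict E) measurable_fst,
      lintegral_map hm ((Finset.measurable_restrict E).comp measurable_fst),
      lintegral_map hm ((Finset.measurable_restrict E).comp measurable_fst)]
    exact (hA E Φ A hAm).symm
  refine Measure.ext_prod fun {B A} hB hAm => ?_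
  have := congrArg (fun R => R B) (hfst A hAm)
  simp only [Measure.map_apply measurable_fst hB, Measure.restrict_apply (measurable_fst hB)] at this
  exact this

theorem ConvergesAlong.map_shiftPair {β : ℝ} {κ : Kernel (Couplings d) (State d)}
    [IsMarkovKernel κ] {a b : ℕ → Site d} {μ₀ : Measure ℝ} [IsProbabilityMeasure μ₀]
    (hκ : ConvergesAlong β (couplingLaw d μ₀) κ a b)
    (hab : ∀ k, a k ≤ b k) (ha : Tendsto a atTop atBot) (hb : Tendsto b atTop atTop)
    (v : Site d) :
    (couplingLaw d μ₀ ⊗ₘ κ).map (shiftPair v) = couplingLaw d μ₀ ⊗ₘ κ := by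
  have hm := measurable_shiftPair (d := d) v
  have := Measure.isProbabilityMeasure_map (μ := couplingLaw d μ₀ ⊗ₘ κ) hm.aemeasurable
  refine measure_pair_ext fun E W s h => ?_
  rw [integral_map hm.aemeasurable (measurable_testMean h).aestronglyMeasurable]
  exact hκ.integral_testMean_shift hab ha hb v h

end EA

namespace EA

variable {d : ℕ}

/-! ### Equivariance of the pure state decomposition -/

lemma shiftConfig_zero (σ : Config d) : shiftConfig 0 σ = σ := by
  funext x; simp [shiftConfig]

lemma shiftConfig_add (v w : Site d) (σ : Config d) :
    shiftConfig (v + w) σ = shiftConfig v (shiftConfig w σ) := by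
  funext x; simp [shiftConfig, add_assoc]

lemma shiftCouplings_neg (v : Site d) (J : Couplings d) :
    shiftCouplings (-v) (shiftCouplings v J) = J := by
  funext e; simp [shiftCouplings, permCouplings]

lemma shiftConfig_neg (v : Site d) (σ : Config d) : shiftConfig (-v) (shiftConfig v σ) = σ := by
  rw [← shiftConfig_add, neg_add_cancel, shiftConfig_zero]

lemma map_shiftConfig_neg (v : Site d) (μ : Measure (Config d)) :
    (μ.map (shiftConfig v)).map (shiftConfig (-v)) = μ := by
  rw [Measure.map_map (measurable_shiftConfig _) (measurable_shiftConfig _)]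
  simp [Function.comp_def, shiftConfig_neg]

lemma shiftState_zero (Γ : State d) : shiftState 0 Γ = Γ := by
  refine Subtype.ext ?_
  change (Γ : Measure (Config d)).map (shiftConfig 0) = Γ
  rw [funext shiftConfig_zero]
  exact Measure.map_id'

lemma shiftState_add (v w : Site d) (Γ : State d) :
    shiftState (v + w) Γ = shiftState v (shiftState w Γ) := by
  refine Subtype.ext ?_
  change (Γ : Measure (Config d)).map _ = ((Γ : Measure (Config d)).map _).map _
  rw [Measure.map_map (measurable_shiftConfig _) (measurable_shiftConfig _)]
  exact congrArg (fun g => (Γ : Measure (Config d)).map g) (funext fun σ => shiftConfig_add v w σ)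

/-- The translation of states as an equivalence. -/
noncomputable def shiftStateEquiv (v : Site d) : State d ≃ᵐ State d where
  toFun := shiftState v
  invFun := shiftState (-v)
  left_inv Γ := by rw [← shiftState_add, neg_add_cancel, shiftState_zero]
  right_inv Γ := by rw [← shiftState_add, add_neg_cancel, shiftState_zero]
  measurable_toFun := measurable_shiftState v
  measurable_invFun := measurable_shiftState (-v)

lemma spin_shiftConfig (v : Site d) (σ : Config d) (x : Site d) :
    spin (shiftConfig v σ) x = spin σ (x + v) := rfl

lemma edgeSpin_shiftConfig (v : Site d) (σ : Config d) (e : Edge d) :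
    edgeSpin (shiftConfig v σ) e = edgeSpin σ (e.1 + v, e.2) := by
  simp only [edgeSpin, spin_shiftConfig, Edge.head]
  rw [add_right_comm]

lemma localHamiltonian_shift (v : Site d) (J : Couplings d) {W W' : Finset (Site d)}
    (hW : ∀ x, x ∈ W' ↔ x + v ∈ W) (σ : Config d) :
    localHamiltonian (shiftCouplings v J) W' (shiftConfig v σ) = localHamiltonian J W σ := by
  unfold localHamiltonian
  congr 1
  refine Finset.sum_equiv ((Equiv.addRight v).prodCongr (Equiv.refl _)) (fun e => ?_) fun e _ => ?_
  · simp only [mem_touchingEdges, hW, Edge.head, Equiv.prodCongr_apply, Prod.map,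
      Equiv.coe_addRight, Equiv.refl_apply, add_right_comm]
  · rw [edgeSpin_shiftConfig]
    rfl

variable {β : ℝ} {J : Couplings d} {Γ ρ : State d}

lemma boltzmann_map_shift (β : ℝ) (J : Couplings d) (v : Site d) {W W' : Finset (Site d)}
    (hW : ∀ x, x ∈ W' ↔ x + v ∈ W) (ω : Config d) :
    (boltzmann W β (localHamiltonian J W) ω).map (shiftConfig v) =
      boltzmann W' β (localHamiltonian (shiftCouplings v J) W') (shiftConfig v ω) :=
  boltzmann_map_perm (φ := Equiv.addRight v) hW (localHamiltonian_shift v J hW) ω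

lemma measurable_boltzmann_apply (β : ℝ) (J : Couplings d) (W : Finset (Site d))
    {A : Set (Config d)} (hA : MeasurableSet A) :
    Measurable fun ω => boltzmann W β (localHamiltonian J W) ω A := by
  have h : Measurable fun ω => gibbsKernel β W (J, ω) A :=
    ((gibbsKernel β W).measurable_coe hA).comp (measurable_prodMk_left (x := J))
  exact h

lemma map_shift_mem_gibbsMeasures {μ : Measure (Config d)} (h : μ ∈ gibbsMeasures β J)
    (v : Site d) : μ.map (shiftConfig v) ∈ gibbsMeasures β (shiftCouplings v J) := by
  classical
  have := h.1
  refine ⟨Measure.isProbabilityMeasure_map (measurable_shiftConfig v).aemeasurable,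
    fun W' A hA => ?_⟩
  have hW : ∀ x, x ∈ W' ↔ x + v ∈ W'.image (· + v) := fun x => by simp
  rw [Measure.map_apply (measurable_shiftConfig v) hA, h.2 (W'.image (· + v)) _
    (measurable_shiftConfig v hA), lintegral_map (measurable_boltzmann_apply β _ W' hA)
    (measurable_shiftConfig v)]
  refine lintegral_congr fun ω => ?_
  rw [← boltzmann_map_shift β J v hW ω, Measure.map_apply (measurable_shiftConfig v) hA]

lemma IsGibbs.shift (h : IsGibbs β J Γ) (v : Site d) :
    IsGibbs β (shiftCouplings v J) (shiftState v Γ) :=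
  map_shift_mem_gibbsMeasures h v

lemma IsPure.shift (h : IsPure β J ρ) (v : Site d) :
    IsPure β (shiftCouplings v J) (shiftState v ρ) := by
  refine mem_extremePoints_iff_left.2 ⟨h.isGibbs.shift v, fun μ₁ h₁ μ₂ h₂ hs => ?_⟩
  obtain ⟨a, b, ha, hb, hab, hs⟩ := hs
  have h₁' := map_shift_mem_gibbsMeasures h₁ (-v)
  have h₂' := map_shift_mem_gibbsMeasures h₂ (-v)
  rw [shiftCouplings_neg] at h₁' h₂'
  have hρ : (ρ : Measure (Config d)) ∈ openSegment ℝ≥0 (μ₁.map (shiftConfig (-v)))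
      (μ₂.map (shiftConfig (-v))) := by
    refine ⟨a, b, ha, hb, hab, ?_⟩
    rw [← map_shiftConfig_neg v (ρ : Measure (Config d)), ← coe_shiftState, ← hs,
      Measure.map_add _ _ (measurable_shiftConfig _), Measure.map_smul, Measure.map_smul]
  have := (mem_extremePoints_iff_left.1 h).2 _ h₁' _ h₂' hρ
  rw [coe_shiftState, ← this]
  have := map_shiftConfig_neg (-v) μ₁
  rw [neg_neg] at this
  exact this.symm

lemma IsPureDecomposition.shift {m : Measure (State d)} (h : IsPureDecomposition β J Γ m)
    (v : Site d) :
    IsPureDecomposition β (shiftCouplings v J) (shiftState v Γ) (m.map (shiftState v)) := by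
  have := h.1
  have hm := measurable_shiftState (d := d) v
  refine ⟨Measure.isProbabilityMeasure_map hm.aemeasurable, ?_, fun A hA => ?_⟩
  -- Translation is a measurable equivalence, so measurability of the set of pure states is not
  -- required here.
  · exact (shiftStateEquiv v).measurableEmbedding.ae_map_iff.2 (h.2.1.mono fun ρ hρ => hρ.shift v)
  · rw [coe_shiftState, Measure.map_apply (measurable_shiftConfig v) hA,
      h.2.2 _ (measurable_shiftConfig v hA), lintegral_map (measurable_state_apply hA) hm]
    refine lintegral_congr fun ρ => ?_
    rw [coe_shiftState, Measure.map_apply (measurable_shiftConfig v) hA]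

/-- Translating a decomposition gives a decomposition of the translate, and uniqueness identifies
the two. -/
lemma IsGibbs.pureDecomposition_shift (h : IsGibbs β J Γ) (v : Site d) :
    pureDecomposition β (shiftCouplings v J) (shiftState v Γ) =
      (pureDecomposition β J Γ).map (shiftState v) :=
  ((h.shift v).isPureDecomposition).unique (h.isPureDecomposition.shift v)

end EA

namespace EA

variable {d : ℕ}

/-! ### The laws of pairs of pure states and of pairs of replicas -/

/-- Invariance passes through an equivariant kernel. It is used twice: from coupling–state pairs to
pairs of pure states, and from these to pairs of configurations. -/
lemma map_comp_measure_of_equivariant {α γ : Type*} [MeasurableSpace α] [MeasurableSpace γ]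
    {P : Measure α} {K : Kernel α γ} {T : α → α} {S : γ → γ} (hT : MeasurePreserving T P P)
    (hS : Measurable S) (h : ∀ᵐ a ∂P, (K a).map S = K (T a)) : (K ∘ₘ P).map S = K ∘ₘ P := by
  refine Measure.ext fun B hB => ?_
  rw [Measure.map_apply hS hB, Measure.bind_apply (hS hB) K.aemeasurable,
    Measure.bind_apply hB K.aemeasurable, ← hT.lintegral_comp (K.measurable_coe hB)]
  refine lintegral_congr_ae (h.mono fun a ha => ?_)
  simp only
  rw [← ha, Measure.map_apply hS hB]

/-- The translation of pairs of states. -/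
noncomputable def shiftStates (v : Site d) : State d × State d → State d × State d :=
  Prod.map (shiftState v) (shiftState v)

/-- The translation of pairs of configurations. -/
def shiftConfigs (v : Site d) : Config d × Config d → Config d × Config d :=
  Prod.map (shiftConfig v) (shiftConfig v)

lemma measurable_shiftStates (v : Site d) : Measurable (shiftStates (d := d) v) :=
  (measurable_shiftState v).prodMap (measurable_shiftState v)

lemma measurable_shiftConfigs (v : Site d) : Measurable (shiftConfigs (d := d) v) :=
  (measurable_shiftConfig v).prodMap (measurable_shiftConfig v)

/-- Two independent pure states in the decomposition of a random Gibbs measure. -/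
noncomputable def pureKernel₂ (d : ℕ) (β : ℝ) :
    Kernel (Couplings d × State d) (State d × State d) :=
  pureKernel d β ×ₖ pureKernel d β

lemma pureKernel₂_apply (β : ℝ) (p : Couplings d × State d) :
    pureKernel₂ d β p = (pureDecomposition β p.1 p.2).prod (pureDecomposition β p.1 p.2) :=
  Kernel.prod_apply _ _ _

/-- Two independent configurations, distributed according to a pair of states. -/
noncomputable def replicaKernel (d : ℕ) : Kernel (State d × State d) (Config d × Config d) :=
  stateKernel d ∥ₖ stateKernel d

lemma replicaKernel_apply (q : State d × State d) :
    replicaKernel d q = (q.1 : Measure (Config d)).prod (q.2 : Measure (Config d)) :=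
  Kernel.parallelComp_apply _ _ _

instance : IsMarkovKernel (replicaKernel d) :=
  inferInstanceAs (IsMarkovKernel (stateKernel d ∥ₖ stateKernel d))

section Laws

variable {β : ℝ} {P : Measure (Couplings d × State d)}

lemma isProbabilityMeasure_pureKernel₂ [IsProbabilityMeasure P]
    (hG : ∀ᵐ p ∂P, IsGibbs β p.1 p.2) :
    IsProbabilityMeasure (pureKernel₂ d β ∘ₘ P) := by
  refine ⟨?_⟩
  rw [Measure.bind_apply MeasurableSet.univ (Kernel.aemeasurable _)]
  have : ∀ᵐ p ∂P, pureKernel₂ d β p Set.univ = 1 := hG.mono fun p hp => by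
    have := hp.isPureDecomposition.1
    rw [pureKernel₂_apply]
    exact measure_univ
  rw [lintegral_congr_ae this]
  simp

lemma isPreservingAction_shiftStates (hG : ∀ᵐ p ∂P, IsGibbs β p.1 p.2)
    (hP : ∀ v, P.map (shiftPair v) = P) :
    IsPreservingAction shiftStates (pureKernel₂ d β ∘ₘ P) where
  zero q := Prod.ext (shiftState_zero _) (shiftState_zero _)
  add v w q := Prod.ext (shiftState_add _ _ _) (shiftState_add _ _ _)
  preserving v := by
    refine ⟨measurable_shiftStates v, map_comp_measure_of_equivariant
      ⟨measurable_shiftPair v, hP v⟩ (measurable_shiftStates v) (hG.mono fun p hp => ?_)⟩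
    have h := hp.pureDecomposition_shift v
    rw [pureKernel₂_apply, pureKernel₂_apply, shiftStates,
      ← Measure.map_prod_map _ _ (measurable_shiftState v) (measurable_shiftState v), ← h]
    rfl

lemma IsPreservingAction.replicas {R : Measure (State d × State d)}
    (hR : IsPreservingAction shiftStates R) :
    IsPreservingAction shiftConfigs (replicaKernel d ∘ₘ R) where
  zero q := Prod.ext (shiftConfig_zero _) (shiftConfig_zero _)
  add v w q := Prod.ext (shiftConfig_add _ _ _) (shiftConfig_add _ _ _)
  preserving v := by
    refine ⟨measurable_shiftConfigs v, map_comp_measure_of_equivariant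
      (hR.preserving v) (measurable_shiftConfigs v) (.of_forall fun q => ?_)⟩
    rw [replicaKernel_apply, replicaKernel_apply, shiftConfigs,
      ← Measure.map_prod_map _ _ (measurable_shiftConfig v) (measurable_shiftConfig v)]
    rfl

lemma ae_isPure_pureKernel₂ (hG : ∀ᵐ p ∂P, IsGibbs β p.1 p.2) :
    ∀ᵐ p ∂P, ∀ᵐ q ∂pureKernel₂ d β p, IsPure β p.1 q.1 ∧ IsPure β p.1 q.2 := by
  filter_upwards [hG] with p hp
  have h := hp.isPureDecomposition.2.1
  rw [pureKernel₂_apply]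
  exact (Measure.quasiMeasurePreserving_fst.ae h).and (Measure.quasiMeasurePreserving_snd.ae h)

end Laws

end EA

namespace EA

variable {d : ℕ}

/-! ### Averaged decay of correlations -/

/-- The truncated correlation `ρ(f g) - ρ(f) ρ(g)`. -/
noncomputable def corr (ρ : State d) (f g : Config d → ℝ) : ℝ :=
  (∫ σ, f σ * g σ ∂(ρ : Measure (Config d))) -
    (∫ σ, f σ ∂(ρ : Measure (Config d))) * ∫ σ, g σ ∂(ρ : Measure (Config d))

/-- `f` depends on the spins near the origin. -/
def IsLocal (f : Config d → ℝ) : Prop :=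
  ∃ c, ∀ n y, y ∉ cube d (n + c) → Exterior (cube d n) fun σ => f (shiftConfig y σ)

/-- The largest correlation of `f` with a translate of `g` by a vector outside the cube. -/
noncomputable def corrSup (f g : Config d → ℝ) (r : ℕ) (ρ : State d) : ℝ :=
  ⨆ y : Site d, if y ∈ cube d r then 0 else |corr ρ f fun σ => g (shiftConfig y σ)|

section Corr

variable {f g : Config d → ℝ} {ρ : State d}

lemma measurable_integral_state_const (hf : Measurable f) :
    Measurable fun ρ : State d => ∫ σ, f σ ∂(ρ : Measure (Config d)) := by
  have h := measurable_integral_state (d := d) (X := Unit) (f := fun p => f p.2)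
    (hf.comp measurable_snd)
  exact h.comp (measurable_prodMk_left (x := ()) : Measurable fun ρ : State d => ((), ρ))

lemma measurable_corr (hf : Measurable f) (hg : Measurable g) :
    Measurable fun ρ : State d => corr ρ f g := by
  exact (measurable_integral_state_const (hf.mul hg)).sub
    ((measurable_integral_state_const hf).mul (measurable_integral_state_const hg))

lemma abs_mul_le_one {a b : ℝ} (ha : |a| ≤ 1) (hb : |b| ≤ 1) : |a * b| ≤ 1 := by
  rw [abs_mul]
  exact mul_le_one₀ ha (abs_nonneg _) hb

lemma abs_corr_le (hf : ∀ σ, |f σ| ≤ 1) (hg : ∀ σ, |g σ| ≤ 1) : |corr ρ f g| ≤ 2 := by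
  have h1 := abs_integral_le (μ := (ρ : Measure (Config d))) (f := fun σ => f σ * g σ) (C := 1)
    fun σ => abs_mul_le_one (hf σ) (hg σ)
  have h2 := abs_mul_le_one (abs_integral_le (μ := (ρ : Measure (Config d))) hf)
    (abs_integral_le (μ := (ρ : Measure (Config d))) hg)
  exact (abs_sub _ _).trans (by linarith)

/-- An exterior `g` sees `f` only through its conditional mean, so the correlation is the integral
of `g` against the deviation of that mean. The bound is the same for all such `g`. -/
lemma IsPure.abs_corr_le_sqrt {β : ℝ} {J : Couplings d} (h : IsPure β J ρ) (hf : Measurable f)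
    (hf1 : ∀ σ, |f σ| ≤ 1) (hg : Measurable g) (hg1 : ∀ σ, |g σ| ≤ 1) {n : ℕ}
    (hgn : Exterior (cube d n) g) : |corr ρ f g| ≤ √(tailVar β J ρ f n) := by
  have hlm := measurable_localMean β J (cube d n) hf
  have hlb := abs_localMean_le β J (cube d n) hf1
  have hi : ∀ {u : Config d → ℝ}, Measurable u → (∀ σ, |u σ| ≤ 1) →
      Integrable u (ρ : Measure (Config d)) := fun hu hu1 => Bounded.integrable hu hu1
  set c := ∫ σ, f σ ∂(ρ : Measure (Config d)) with hc
  have h1 : corr ρ f g = ∫ σ, g σ * (localMean β J (cube d n) f σ - c)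
      ∂(ρ : Measure (Config d)) := by
    simp only [mul_sub]
    have hmul : Measurable fun σ => g σ * localMean β J (cube d n) f σ := hg.mul hlm
    rw [integral_sub (hi hmul fun σ => abs_mul_le_one (hg1 σ) (hlb σ))
      ((hi hg hg1).mul_const c), integral_mul_const,
      h.isGibbs.integral_mul_localMean hf hf1 hg hg1 hgn, corr, ← hc, mul_comm c]
    simp only [mul_comm]
  rw [h1]
  refine (abs_integral_le_integral_abs).trans (le_trans ?_
    (h.integral_abs_localMean_sub_le hf hf1 n))
  refine integral_mono_of_nonneg (.of_forall fun σ => abs_nonneg _)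
    (((hi hlm hlb).sub (integrable_const c)).abs) (.of_forall fun σ => ?_)
  simp only [abs_mul]
  exact mul_le_of_le_one_left (abs_nonneg _) (hg1 σ)

lemma corr_shift (hf : Measurable f) (hg : Measurable g) (x y : Site d) :
    corr ρ (fun σ => f (shiftConfig x σ)) (fun σ => g (shiftConfig (y + x) σ)) =
      corr (shiftState x ρ) f fun σ => g (shiftConfig y σ) := by
  have hgy : Measurable fun σ => g (shiftConfig y σ) := hg.comp (measurable_shiftConfig y)
  have hfg : Measurable fun σ => f σ * g (shiftConfig y σ) := hf.mul hgy
  simp only [corr]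
  rw [integral_shiftState x ρ hfg, integral_shiftState x ρ hf,
    integral_shiftState x ρ hgy]
  simp only [shiftConfig_add]

lemma measurable_corrSup (hf : Measurable f) (hg : Measurable g) (r : ℕ) :
    Measurable (corrSup (d := d) f g r) := by
  refine Measurable.iSup fun y => ?_
  split_ifs
  · exact measurable_const
  · exact (measurable_corr hf (hg.comp (measurable_shiftConfig y))).abs

lemma abs_ite_corr_le (hf : ∀ σ, |f σ| ≤ 1) (hg : ∀ σ, |g σ| ≤ 1) (r : ℕ) (y : Site d) :
    (if y ∈ cube d r then 0 else |corr ρ f fun σ => g (shiftConfig y σ)|) ≤ 2 := by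
  split_ifs
  · norm_num
  · exact abs_corr_le hf fun σ => hg _

lemma abs_corr_le_corrSup (hf : ∀ σ, |f σ| ≤ 1) (hg : ∀ σ, |g σ| ≤ 1) {r : ℕ} {y : Site d}
    (hy : y ∉ cube d r) :
    |corr ρ f fun σ => g (shiftConfig y σ)| ≤ corrSup f g r ρ := by
  have hb : BddAbove (Set.range fun y : Site d =>
      if y ∈ cube d r then 0 else |corr ρ f fun σ => g (shiftConfig y σ)|) :=
    ⟨2, by rintro _ ⟨y, rfl⟩; exact abs_ite_corr_le hf hg r y⟩
  have := le_ciSup hb y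
  rwa [if_neg hy] at this

lemma corrSup_nonneg (r : ℕ) : 0 ≤ corrSup f g r ρ :=
  Real.iSup_nonneg fun y => by split_ifs <;> positivity

lemma corrSup_le (hf : ∀ σ, |f σ| ≤ 1) (hg : ∀ σ, |g σ| ≤ 1) (r : ℕ) : corrSup f g r ρ ≤ 2 :=
  ciSup_le fun y => abs_ite_corr_le hf hg r y

/-- A far translate of a local `g` is exterior to a large cube, and the bound by `tailVar` does not
depend on which translate is taken. -/
lemma IsPure.tendsto_corrSup {β : ℝ} {J : Couplings d} (h : IsPure β J ρ) (hf : Measurable f)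
    (hf1 : ∀ σ, |f σ| ≤ 1) (hg : Measurable g) (hg1 : ∀ σ, |g σ| ≤ 1) (hgl : IsLocal g) :
    Tendsto (fun r => corrSup f g r ρ) atTop (𝓝 0) := by
  obtain ⟨c, hc⟩ := hgl
  refine (tendsto_add_atTop_iff_nat c).1 ?_
  have h0 : Tendsto (fun n => √(tailVar β J ρ f n)) atTop (𝓝 0) := by
    have := (Real.continuous_sqrt.tendsto 0).comp (h.tendsto_tailVar hf hf1)
    rwa [Real.sqrt_zero] at this
  refine squeeze_zero (fun n => corrSup_nonneg _) (fun n => ciSup_le fun y => ?_) h0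
  split_ifs with hy
  · positivity
  · exact h.abs_corr_le_sqrt hf hf1 (hg.comp (measurable_shiftConfig y)) (fun σ => hg1 _) (hc n y hy)

/-- The average over the cube of the absolute correlations of the translates of `f` and `g`. -/
noncomputable def avgCorr (ρ : State d) (f g : Config d → ℝ) (n : ℕ) : ℝ :=
  (∑ x ∈ cube d n, ∑ y ∈ cube d n,
    |corr ρ (fun σ => f (shiftConfig x σ)) fun σ => g (shiftConfig y σ)|) /
      ((cube d n).card : ℝ) ^ 2

/-- Each x has at most |`cube d r`| partners y with y - x in `cube d r`, each contributing at most
2. The other correlations are moved to the origin by translating the state by x and bounded by its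
`corrSup`. -/
lemma avgCorr_le {Ω : Type*} {T : Site d → Ω → Ω} {π : Ω → State d}
    (hπ : ∀ v ω, π (T v ω) = shiftState v (π ω)) (hf : Measurable f)
    (hf1 : ∀ σ, |f σ| ≤ 1) (hg : Measurable g) (hg1 : ∀ σ, |g σ| ≤ 1) (r n : ℕ) (ω : Ω) :
    avgCorr (π ω) f g n ≤ 2 * (cube d r).card / (cube d n).card +
      cubeAvg T (fun ω => corrSup f g r (π ω)) n ω := by
  have hpos := card_cube_pos d n
  have hx : ∀ x ∈ cube d n, ∑ y ∈ cube d n,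
      |corr (π ω) (fun σ => f (shiftConfig x σ)) fun σ => g (shiftConfig y σ)| ≤
        2 * (cube d r).card + (cube d n).card * corrSup f g r (π (T x ω)) := by
    intro x _
    have hterm : ∀ y ∈ cube d n,
        |corr (π ω) (fun σ => f (shiftConfig x σ)) fun σ => g (shiftConfig y σ)| ≤
          (if y - x ∈ cube d r then 2 else 0) + corrSup f g r (π (T x ω)) := by
      intro y _
      have := corr_shift (ρ := π ω) hf hg x (y - x)
      rw [sub_add_cancel] at this
      rw [this, hπ]
      split_ifs with hy
      · exact (abs_corr_le hf1 fun σ => hg1 _).trans (le_add_of_nonneg_right (corrSup_nonneg _))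
      · rw [zero_add]
        exact abs_corr_le_corrSup hf1 hg1 hy
    refine (Finset.sum_le_sum hterm).trans ?_
    rw [Finset.sum_add_distrib, Finset.sum_const, nsmul_eq_mul, ← Finset.sum_filter,
      Finset.sum_const, nsmul_eq_mul, mul_comm _ (2 : ℝ)]
    have hcard : ((cube d n).filter fun y => y - x ∈ cube d r).card ≤ (cube d r).card :=
      Finset.card_le_card_of_injOn (· - x) (fun y hy => (Finset.mem_filter.1 hy).2)
        fun a _ b _ hab => by simpa using hab
    gcongr
  have hsum := Finset.sum_le_sum hx
  rw [Finset.sum_add_distrib, Finset.sum_const, nsmul_eq_mul, ← Finset.mul_sum] at hsum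
  rw [avgCorr, cubeAvg, div_le_iff₀ (by positivity)]
  refine hsum.trans (le_of_eq ?_)
  field_simp

/-- The mean of `corrSup` at radius r tends to 0. By the maximal inequality, almost surely some r
makes its averages over all cubes small; the near pairs are then negligible as the cube grows. -/
theorem IsPreservingAction.ae_tendsto_avgCorr (hd : 1 ≤ d) {Ω : Type*} [MeasurableSpace Ω]
    {T : Site d → Ω → Ω} {μ : Measure Ω} [IsFiniteMeasure μ] (hT : IsPreservingAction T μ)
    {π : Ω → State d} (hπm : Measurable π) (hπ : ∀ v ω, π (T v ω) = shiftState v (π ω))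
    (hf : Measurable f) (hf1 : ∀ σ, |f σ| ≤ 1) (hg : Measurable g) (hg1 : ∀ σ, |g σ| ≤ 1)
    (h0 : ∀ᵐ ω ∂μ, Tendsto (fun r => corrSup f g r (π ω)) atTop (𝓝 0)) :
    ∀ᵐ ω ∂μ, Tendsto (avgCorr (π ω) f g) atTop (𝓝 0) := by
  have hm : ∀ r, Measurable fun ω => corrSup f g r (π ω) := fun r =>
    (measurable_corrSup hf hg r).comp hπm
  have hint : Tendsto (fun r => ∫⁻ ω, ENNReal.ofReal (corrSup f g r (π ω)) ∂μ) atTop (𝓝 0) := by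
    have := tendsto_lintegral_of_dominated_convergence (μ := μ) (f := fun _ => 0) (fun _ => 2)
      (fun r => (hm r).ennreal_ofReal)
      (fun r => .of_forall fun ω => by
        simpa using ENNReal.ofReal_le_ofReal (corrSup_le (ρ := π ω) hf1 hg1 r))
      (by simpa using ENNReal.mul_ne_top (by simp) (measure_ne_top μ _))
      (h0.mono fun ω hω => by simpa [Function.comp_def] using (ENNReal.continuous_ofReal.tendsto 0).comp hω)
    simpa using this
  have hsmall : ∀ ε : ℝ, 0 < ε → ∀ᵐ ω ∂μ, ∃ r, ∀ n,
      cubeAvg T (fun ω => corrSup f g r (π ω)) n ω < ε := by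
    intro ε hε
    have hlim : Tendsto (fun r => 5 ^ d * (∫⁻ ω, ENNReal.ofReal (corrSup f g r (π ω)) ∂μ) /
        ENNReal.ofReal ε) atTop (𝓝 (5 ^ d * 0 / ENNReal.ofReal ε)) :=
      ENNReal.Tendsto.div_const (ENNReal.Tendsto.const_mul hint (by simp)) (by simp [hε])
    rw [mul_zero, ENNReal.zero_div] at hlim
    rw [ae_iff, ← nonpos_iff_eq_zero]
    refine ge_of_tendsto' hlim fun r => (measure_mono fun ω hω => ?_).trans
      (hT.measure_exists_le_cubeAvg (hm r) (fun ω => corrSup_nonneg r) hε)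
    simp only [Set.mem_ofPred_eq, not_exists, not_forall, not_lt] at hω ⊢
    exact hω r
  have hcard : ∀ r : ℕ, Tendsto (fun n => 2 * ((cube d r).card : ℝ) / (cube d n).card) atTop (𝓝 0) :=
    fun r => tendsto_const_nhds.div_atTop (tendsto_card_cube_atTop hd)
  have hall : ∀ᵐ ω ∂μ, ∀ k : ℕ, ∃ r, ∀ n,
      cubeAvg T (fun ω => corrSup f g r (π ω)) n ω < 1 / ((k : ℝ) + 1) :=
    ae_all_iff.2 fun k => hsmall _ (by positivity)
  filter_upwards [hall] with ω hω
  have hnn : ∀ n, 0 ≤ avgCorr (π ω) f g n := fun n => by unfold avgCorr; positivity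
  refine tendsto_order.2 ⟨fun a ha => .of_forall fun n => ha.trans_le (hnn n), fun a ha => ?_⟩
  obtain ⟨k, hk⟩ := exists_nat_one_div_lt (half_pos ha)
  obtain ⟨r, hr⟩ := hω k
  filter_upwards [(tendsto_order.1 (hcard r)).2 (a / 2) (half_pos ha)] with n hn
  have := avgCorr_le hπ hf hf1 hg hg1 r n ω
  linarith [hr n]

end Corr

end EA

namespace EA

variable {d : ℕ}

/-! ### Constancy of overlaps -/

/-- By dominated convergence the limit has variance 0, hence equals its mean. -/
lemma exists_ae_tendsto_const {Ω : Type*} [MeasurableSpace Ω] {μ : Measure Ω}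
    [IsProbabilityMeasure μ] {A : ℕ → Ω → ℝ} (hA : ∀ n, Measurable (A n)) {C : ℝ}
    (hC : ∀ n ω, |A n ω| ≤ C) (hlim : ∀ᵐ ω ∂μ, ∃ c, Tendsto (fun n => A n ω) atTop (𝓝 c))
    (hvar : Tendsto (fun n => ∫ ω, (A n ω - ∫ ω, A n ω ∂μ) ^ 2 ∂μ) atTop (𝓝 0)) :
    ∃ c, ∀ᵐ ω ∂μ, Tendsto (fun n => A n ω) atTop (𝓝 c) := by
  obtain ⟨L, hL, hAL⟩ := measurable_limit_of_tendsto_metrizable_ae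
    (fun n => (hA n).aemeasurable) hlim
  have hmean : Tendsto (fun n => ∫ ω, A n ω ∂μ) atTop (𝓝 (∫ ω, L ω ∂μ)) :=
    tendsto_integral_of_dominated_convergence (fun _ => C)
      (fun n => (hA n).aestronglyMeasurable) (integrable_const _)
      (fun n => .of_forall fun ω => hC n ω) hAL
  have hmC : ∀ n, |∫ ω, A n ω ∂μ| ≤ C := fun n => by
    simpa using norm_integral_le_of_norm_le_const (μ := μ) (f := A n) (C := C)
      (.of_forall fun ω => hC n ω)
  have hsq := tendsto_integral_of_dominated_convergence (μ := μ)
    (F := fun n ω => (A n ω - ∫ ω, A n ω ∂μ) ^ 2) (f := fun ω => (L ω - ∫ ω, L ω ∂μ) ^ 2)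
    (fun _ => (C + C) ^ 2)
    (fun n => (((hA n).sub_const _).pow_const 2).aestronglyMeasurable) (integrable_const _)
    (fun n => .of_forall fun ω => by
      rw [Real.norm_eq_abs]
      exact abs_pow_two_le ((abs_sub _ _).trans (add_le_add (hC n ω) (hmC n))))
    (hAL.mono fun ω hω => (hω.sub hmean).pow 2)
  have hzero := tendsto_nhds_unique hsq hvar
  have hLC : ∀ᵐ ω ∂μ, |L ω| ≤ C := hAL.mono fun ω hω =>
    le_of_tendsto' hω.abs fun n => hC n ω
  have hint : Integrable (fun ω => (L ω - ∫ ω, L ω ∂μ) ^ 2) μ := by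
    refine Integrable.of_bound ((hL.sub_const _).pow_const 2).aestronglyMeasurable
      ((C + |∫ ω, L ω ∂μ|) ^ 2) (hLC.mono fun ω hω => ?_)
    rw [Real.norm_eq_abs]
    exact abs_pow_two_le ((abs_sub _ _).trans (by gcongr))
  rw [integral_eq_zero_iff_of_nonneg (fun ω => sq_nonneg _) hint] at hzero
  refine ⟨∫ ω, L ω ∂μ, ?_⟩
  filter_upwards [hAL, hzero] with ω h1 h2
  have : L ω = ∫ ω, L ω ∂μ := by
    have := pow_eq_zero_iff two_ne_zero |>.1 h2
    linarith
  rwa [← this]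

section Variance

variable {ρ₁ ρ₂ : State d}

lemma integral_replica_mul (u v : Config d → ℝ) :
    ∫ p, u p.1 * v p.2 ∂((ρ₁ : Measure (Config d)).prod (ρ₂ : Measure (Config d))) =
      (∫ σ, u σ ∂(ρ₁ : Measure (Config d))) * ∫ σ, v σ ∂(ρ₂ : Measure (Config d)) :=
  integral_prod_mul u v

/-- Replicas are independent, so each covariance is a difference of products over the two states,
and changing one factor at a time leaves one truncated correlation per state. -/
lemma integral_replica_sum_sq_le {K : Type*} (s : Finset K) {u : K → Config d → ℝ}
    (hu : ∀ k, Measurable (u k)) (hu1 : ∀ k σ, |u k σ| ≤ 1) :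
    ∫ p, (∑ k ∈ s, u k p.1 * u k p.2 - ∫ p, ∑ k ∈ s, u k p.1 * u k p.2
        ∂((ρ₁ : Measure (Config d)).prod (ρ₂ : Measure (Config d)))) ^ 2
        ∂((ρ₁ : Measure (Config d)).prod (ρ₂ : Measure (Config d))) ≤
      ∑ k ∈ s, ∑ l ∈ s, (|corr ρ₁ (u k) (u l)| + |corr ρ₂ (u k) (u l)|) := by
  set Q := (ρ₁ : Measure (Config d)).prod (ρ₂ : Measure (Config d)) with hQ
  have hm : ∀ k, Measurable fun p : Config d × Config d => u k p.1 * u k p.2 := fun k =>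
    ((hu k).comp measurable_fst).mul ((hu k).comp measurable_snd)
  have hb : ∀ k (p : Config d × Config d), |u k p.1 * u k p.2| ≤ 1 := fun k p =>
    abs_mul_le_one (hu1 k _) (hu1 k _)
  have hi : ∀ k, Integrable (fun p : Config d × Config d => u k p.1 * u k p.2) Q := fun k =>
    Bounded.integrable (hm k) (hb k)
  have hi2 : ∀ k l, Integrable (fun p : Config d × Config d =>
      (u k p.1 * u k p.2) * (u l p.1 * u l p.2)) Q := fun k l =>
    Bounded.integrable ((hm k).mul (hm l)) fun p => abs_mul_le_one (hb k p) (hb l p)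
  have hS : ∀ p : Config d × Config d, |∑ k ∈ s, u k p.1 * u k p.2| ≤ s.card := fun p =>
    (Finset.abs_sum_le_sum_abs _ _).trans
      ((Finset.sum_le_sum fun k _ => hb k p).trans (by simp))
  rw [integral_sub_integral_sq (Finset.measurable_fun_sum _ fun k _ => hm k) hS]
  have h1 : ∫ p, (∑ k ∈ s, u k p.1 * u k p.2) ^ 2 ∂Q =
      ∑ k ∈ s, ∑ l ∈ s, (∫ σ, u k σ * u l σ ∂(ρ₁ : Measure (Config d))) *
        ∫ σ, u k σ * u l σ ∂(ρ₂ : Measure (Config d)) := by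
    simp only [sq, Finset.sum_mul_sum]
    rw [integral_finsetSum _ fun k _ => integrable_finsetSum _ fun l _ => hi2 k l]
    refine Finset.sum_congr rfl fun k _ => ?_
    rw [integral_finsetSum _ fun l _ => hi2 k l]
    refine Finset.sum_congr rfl fun l _ => ?_
    rw [← integral_replica_mul (fun σ => u k σ * u l σ) fun σ => u k σ * u l σ]
    exact integral_congr_ae (.of_forall fun p => by simp only; ring)
  have h2 : ∫ p, ∑ k ∈ s, u k p.1 * u k p.2 ∂Q =
      ∑ k ∈ s, (∫ σ, u k σ ∂(ρ₁ : Measure (Config d))) *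
        ∫ σ, u k σ ∂(ρ₂ : Measure (Config d)) := by
    rw [integral_finsetSum _ fun k _ => hi k]
    exact Finset.sum_congr rfl fun k _ => integral_replica_mul (u k) (u k)
  rw [h1, h2, sq, Finset.sum_mul_sum, ← Finset.sum_sub_distrib]
  refine Finset.sum_le_sum fun k _ => ?_
  rw [← Finset.sum_sub_distrib]
  refine Finset.sum_le_sum fun l _ => ?_
  have hb1 : ∀ (ρ : State d) k, |∫ σ, u k σ ∂(ρ : Measure (Config d))| ≤ 1 := fun ρ k =>
    abs_integral_le (hu1 k)
  have hb2 : |∫ σ, u k σ * u l σ ∂(ρ₂ : Measure (Config d))| ≤ 1 :=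
    abs_integral_le fun σ => abs_mul_le_one (hu1 k σ) (hu1 l σ)
  unfold corr
  set a₁ := ∫ σ, u k σ ∂(ρ₁ : Measure (Config d)) with ha₁
  set b₁ := ∫ σ, u l σ ∂(ρ₁ : Measure (Config d)) with hb₁
  set a₂ := ∫ σ, u k σ ∂(ρ₂ : Measure (Config d))
  set b₂ := ∫ σ, u l σ ∂(ρ₂ : Measure (Config d))
  set c₁ := ∫ σ, u k σ * u l σ ∂(ρ₁ : Measure (Config d))
  set c₂ := ∫ σ, u k σ * u l σ ∂(ρ₂ : Measure (Config d))
  have e : c₁ * c₂ - a₁ * a₂ * (b₁ * b₂) =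
      (c₁ - a₁ * b₁) * c₂ + (a₁ * b₁) * (c₂ - a₂ * b₂) := by ring
  rw [e]
  refine (le_abs_self _).trans ((abs_add_le _ _).trans ?_)
  rw [abs_mul, abs_mul (a₁ * b₁)]
  exact add_le_add (mul_le_of_le_one_right (abs_nonneg _) hb2)
    (mul_le_of_le_one_left (abs_nonneg _) (abs_mul_le_one (hb1 ρ₁ k) (hb1 ρ₁ l)))

end Variance

/-- The observable of two replicas that is averaged in an overlap. -/
def overlapObs {ι : Type*} [Fintype ι] (f : ι → Config d → ℝ) (p : Config d × Config d) : ℝ :=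
  ∑ i, f i p.1 * f i p.2

section Overlap

variable {ι : Type*} [Fintype ι] {f : ι → Config d → ℝ} {ρ₁ ρ₂ : State d}

lemma measurable_overlapObs (hf : ∀ i, Measurable (f i)) : Measurable (overlapObs f) :=
  Finset.measurable_fun_sum _ fun i _ =>
    ((hf i).comp measurable_fst).mul ((hf i).comp measurable_snd)

lemma abs_overlapObs_le (hf1 : ∀ i σ, |f i σ| ≤ 1) (p : Config d × Config d) :
    |overlapObs f p| ≤ Fintype.card ι :=
  (Finset.abs_sum_le_sum_abs _ _).trans
    ((Finset.sum_le_sum fun i _ => abs_mul_le_one (hf1 i _) (hf1 i _)).trans (by simp))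

/-- Existence of the limit is assumed from the ergodic theorem; decay of averaged correlations makes
the variance vanish and hence the limit constant. -/
lemma exists_ae_tendsto_overlap (hf : ∀ i, Measurable (f i)) (hf1 : ∀ i σ, |f i σ| ≤ 1)
    (h₁ : ∀ i j, Tendsto (avgCorr ρ₁ (f i) (f j)) atTop (𝓝 0))
    (h₂ : ∀ i j, Tendsto (avgCorr ρ₂ (f i) (f j)) atTop (𝓝 0))
    (hlim : ∀ᵐ p ∂((ρ₁ : Measure (Config d)).prod (ρ₂ : Measure (Config d))),
      ∃ c, Tendsto (fun n => cubeAvg shiftConfigs (overlapObs f) n p) atTop (𝓝 c)) :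
    ∃ c, ∀ᵐ p ∂((ρ₁ : Measure (Config d)).prod (ρ₂ : Measure (Config d))),
      Tendsto (fun n => cubeAvg shiftConfigs (overlapObs f) n p) atTop (𝓝 c) := by
  refine exists_ae_tendsto_const
    (fun n => measurable_cubeAvg measurable_shiftConfigs (measurable_overlapObs hf) n)
    (abs_cubeAvg_le _ (abs_overlapObs_le hf1)) hlim ?_
  have h0 : Tendsto (fun n => ∑ i, ∑ j, (avgCorr ρ₁ (f i) (f j) n + avgCorr ρ₂ (f i) (f j) n))
      atTop (𝓝 0) := by
    have := tendsto_finsetSum (Finset.univ : Finset ι) fun i _ =>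
      tendsto_finsetSum (Finset.univ : Finset ι) fun j _ => (h₁ i j).add (h₂ i j)
    simpa using this
  refine squeeze_zero (fun n => integral_nonneg fun p => sq_nonneg _) (fun n => ?_) h0
  have hpos := card_cube_pos d n
  let u : Site d × ι → Config d → ℝ := fun k σ => f k.2 (shiftConfig k.1 σ)
  have hA : ∀ p, cubeAvg shiftConfigs (overlapObs f) n p =
      (∑ k ∈ cube d n ×ˢ Finset.univ, u k p.1 * u k p.2) * ((cube d n).card : ℝ)⁻¹ := fun p => by
    rw [Finset.sum_product]
    rfl
  have hbound := integral_replica_sum_sq_le (ρ₁ := ρ₁) (ρ₂ := ρ₂) (cube d n ×ˢ Finset.univ)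
    (u := u) (fun k => (hf k.2).comp (measurable_shiftConfig k.1)) fun k σ => hf1 _ _
  simp only [hA, integral_mul_const, ← sub_mul, mul_pow]
  refine (mul_le_mul_of_nonneg_right hbound (by positivity)).trans (le_of_eq ?_)
  simp only [avgCorr, ← add_div, ← Finset.sum_div, ← Finset.sum_add_distrib]
  rw [inv_pow, ← div_eq_mul_inv]
  congr 1
  simp only [Finset.sum_product_right]
  refine Finset.sum_congr rfl fun i _ => ?_
  rw [Finset.sum_comm]

end Overlap

end EA

namespace EA

variable {d : ℕ}

/-! ### Spin and edge overlaps -/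

lemma abs_spin (σ : Config d) (x : Site d) : |spin σ x| = 1 := by
  rcases Int.units_eq_one_or (σ x) with h | h <;> simp [spin, h]

lemma abs_edgeSpin (σ : Config d) (e : Edge d) : |edgeSpin σ e| = 1 := by
  rw [edgeSpin, abs_mul, abs_spin, abs_spin, one_mul]

lemma exterior_spin {W : Finset (Site d)} {x : Site d} (hx : x ∉ W) :
    Exterior W fun σ => spin σ x := fun η ω => by
  simp only [spin, glue_of_notMem _ _ hx]

lemma isLocal_spin : IsLocal fun σ : Config d => spin σ 0 := by
  refine ⟨0, fun n y hy => ?_⟩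
  simp only [spin_shiftConfig, zero_add]
  exact exterior_spin hy

lemma single_mem_cube (i : Fin d) : (Pi.single i 1 : Site d) ∈ cube d 1 := by
  rw [mem_cube]
  intro j
  by_cases h : j = i
  · subst h; simp
  · simp [Pi.single_eq_of_ne h]

lemma isLocal_edgeSpin (i : Fin d) : IsLocal fun σ : Config d => edgeSpin σ (0, i) := by
  refine ⟨1, fun n y hy => ?_⟩
  have hy1 : y ∉ cube d n := fun h => hy (cube_mono (Nat.le_succ n) h)
  have hy2 : y + Pi.single i 1 ∉ cube d n := fun h => hy <| by
    simpa using add_mem_cube h (neg_mem_cube (single_mem_cube i))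
  intro η ω
  have h1 := exterior_spin hy1 η ω
  have h2 := exterior_spin hy2 η ω
  simp only at h1 h2
  simp only [edgeSpin_shiftConfig]
  rw [zero_add, edgeSpin, edgeSpin, Edge.head, h1, h2]

/-- The single spin whose translates are averaged in the spin overlap. -/
def spinObs (d : ℕ) (_ : Unit) (σ : Config d) : ℝ := spin σ 0

/-- The edge variables whose translates are averaged in the edge overlap. -/
def edgeObs (d : ℕ) (i : Fin d) (σ : Config d) : ℝ := edgeSpin σ (0, i)

lemma averagedMixing_of_avgCorr {ρ : State d}
    (h : Tendsto (avgCorr ρ (spinObs d ()) (spinObs d ())) atTop (𝓝 0)) : AveragedMixing ρ := by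
  have : ∀ (σ : Config d) x, spinObs d () (shiftConfig x σ) = spin σ x := fun σ x => by
    rw [spinObs, spin_shiftConfig, zero_add]
  unfold avgCorr at h
  unfold AveragedMixing
  simpa only [corr, this] using h

lemma spinOverlap_eq_cubeAvg (n : ℕ) (p : Config d × Config d) :
    spinOverlap (cube d n) p.1 p.2 = cubeAvg shiftConfigs (overlapObs (spinObs d)) n p := by
  simp [spinOverlap, cubeAvg, overlapObs, spinObs, shiftConfigs, spin_shiftConfig]

lemma mem_innerEdges {W : Finset (Site d)} {e : Edge d} :
    e ∈ innerEdges W ↔ e.1 ∈ W ∧ Edge.head e ∈ W := by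
  simp [innerEdges]

lemma innerEdges_subset (W : Finset (Site d)) : innerEdges W ⊆ W ×ˢ Finset.univ :=
  Finset.filter_subset _ _

lemma cube_prod_subset_innerEdges (n : ℕ) :
    cube d n ×ˢ Finset.univ ⊆ innerEdges (cube d (n + 1)) := fun e he => by
  have h := (Finset.mem_product.1 he).1
  exact mem_innerEdges.2 ⟨cube_mono (Nat.le_succ n) h, add_mem_cube h (single_mem_cube e.2)⟩

/-- Each site is the base of d edges, and edges based in one cube are inner edges of the next, so
the loss is a boundary effect. -/
lemma tendsto_card_innerEdges_div (d : ℕ) :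
    Tendsto (fun n : ℕ => ((innerEdges (cube d n)).card : ℝ) / (cube d n).card) atTop (𝓝 d) := by
  refine (tendsto_add_atTop_iff_nat 1).1 ?_
  have hle : ∀ n, ((innerEdges (cube d (n + 1))).card : ℝ) ≤ d * (cube d (n + 1)).card := by
    intro n
    have := Finset.card_le_card (innerEdges_subset (cube d (n + 1)))
    rw [Finset.card_product, Finset.card_univ, Fintype.card_fin, mul_comm] at this
    exact_mod_cast this
  have hge : ∀ n, (d : ℝ) * (cube d n).card ≤ (innerEdges (cube d (n + 1))).card := by
    intro n
    have := Finset.card_le_card (cube_prod_subset_innerEdges (d := d) n)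
    rw [Finset.card_product, Finset.card_univ, Fintype.card_fin, mul_comm] at this
    exact_mod_cast this
  have hlim : Tendsto (fun n : ℕ => (d : ℝ) * (((cube d (n + 1)).card : ℝ) / (cube d n).card)⁻¹)
      atTop (𝓝 d) := by
    simpa using ((tendsto_card_cube_add_div d 1).inv₀ one_ne_zero).const_mul (d : ℝ)
  refine tendsto_of_tendsto_of_tendsto_of_le_of_le hlim tendsto_const_nhds (fun n => ?_) fun n => ?_
  · simp only
    rw [inv_div, ← mul_div_assoc]
    exact div_le_div_of_nonneg_right (hge n) (card_cube_pos d _).le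
  · exact (div_le_iff₀ (card_cube_pos d _)).2 (hle n)

/-- The cube average runs over all edges based in the cube, including those that leave it. Each
excess term has modulus 1, so their number bounds the error. -/
lemma abs_sum_innerEdges_sub_le (n : ℕ) (p : Config d × Config d) :
    |(∑ e ∈ innerEdges (cube d n), edgeSpin p.1 e * edgeSpin p.2 e) / (cube d n).card -
      cubeAvg shiftConfigs (overlapObs (edgeObs d)) n p| ≤
        d - ((innerEdges (cube d n)).card : ℝ) / (cube d n).card := by
  have hpos := card_cube_pos d n
  have hsub := innerEdges_subset (cube d n)
  have hA : cubeAvg shiftConfigs (overlapObs (edgeObs d)) n p =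
      (∑ e ∈ cube d n ×ˢ Finset.univ, edgeSpin p.1 e * edgeSpin p.2 e) / (cube d n).card := by
    simp [Finset.sum_product, cubeAvg, overlapObs, edgeObs, shiftConfigs, edgeSpin_shiftConfig]
  have hcard : (((cube d n ×ˢ Finset.univ) \ innerEdges (cube d n)).card : ℝ) =
      (cube d n).card * d - (innerEdges (cube d n)).card := by
    rw [Finset.card_sdiff_of_subset hsub, Nat.cast_sub (Finset.card_le_card hsub),
      Finset.card_product]
    simp
  have hd : (d : ℝ) - ((innerEdges (cube d n)).card : ℝ) / (cube d n).card =
      (((cube d n ×ˢ Finset.univ) \ innerEdges (cube d n)).card : ℝ) / (cube d n).card := by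
    rw [hcard]; field_simp
  rw [hA, hd, ← sub_div, ← Finset.sum_sdiff hsub, sub_add_cancel_right, abs_div, abs_neg,
    abs_of_pos hpos]
  refine div_le_div_of_nonneg_right ((Finset.abs_sum_le_sum_abs _ _).trans ?_) hpos.le
  simp [abs_mul, abs_edgeSpin]

lemma tendsto_edgeOverlap (hd : 1 ≤ d) {p : Config d × Config d} {c : ℝ}
    (h : Tendsto (fun n => cubeAvg shiftConfigs (overlapObs (edgeObs d)) n p) atTop (𝓝 c)) :
    Tendsto (fun n => edgeOverlap (cube d n) p.1 p.2) atTop (𝓝 (c / d)) := by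
  have hr := tendsto_card_innerEdges_div d
  have hdiff : Tendsto (fun n => (∑ e ∈ innerEdges (cube d n), edgeSpin p.1 e * edgeSpin p.2 e) /
      (cube d n).card - cubeAvg shiftConfigs (overlapObs (edgeObs d)) n p) atTop (𝓝 0) := by
    refine squeeze_zero_norm (fun n => abs_sum_innerEdges_sub_le n p) ?_
    simpa using hr.const_sub (d : ℝ)
  have hnum := hdiff.add h
  simp only [sub_add_cancel, zero_add] at hnum
  have hd0 : (d : ℝ) ≠ 0 := by exact_mod_cast (Nat.one_le_iff_ne_zero.1 hd)
  refine (hnum.div hr hd0).congr fun n => ?_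
  have hpos := (card_cube_pos d n).ne'
  rw [edgeOverlap, Pi.div_apply, div_div_div_cancel_right₀ hpos]

end EA

/-! ### Averaged mixing and constant overlaps for pairs of pure states -/

namespace EA

variable {d : ℕ}

section PurePairs

variable {β : ℝ} {P : Measure (Couplings d × State d)} [IsProbabilityMeasure P]

lemma measurable_spinObs (i : Unit) : Measurable (spinObs d i) := measurable_spin 0

lemma measurable_edgeObs (i : Fin d) : Measurable (edgeObs d i) := measurable_edgeSpin (0, i)

lemma abs_spinObs_le (i : Unit) (σ : Config d) : |spinObs d i σ| ≤ 1 := (abs_spin σ 0).le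

lemma abs_edgeObs_le (i : Fin d) (σ : Config d) : |edgeObs d i σ| ≤ 1 := (abs_edgeSpin σ _).le

/-- Pairs of pure states in the decomposition of a translation invariant family of random Gibbs
measures: averaged decay of correlations and constancy of the averages of a two replica observable.
-/
lemma ae_avgCorr_and_overlap (hd : 1 ≤ d) (hG : ∀ᵐ p ∂P, IsGibbs β p.1 p.2)
    (hP : ∀ v, P.map (shiftPair v) = P) {ι : Type*} [Fintype ι] {f : ι → Config d → ℝ}
    (hf : ∀ i, Measurable (f i)) (hf1 : ∀ i σ, |f i σ| ≤ 1) (hfl : ∀ i, IsLocal (f i)) :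
    ∀ᵐ p ∂P, ∀ᵐ q ∂pureKernel₂ d β p,
      (∀ i j, Tendsto (avgCorr q.1 (f i) (f j)) atTop (𝓝 0)) ∧
      (∀ i j, Tendsto (avgCorr q.2 (f i) (f j)) atTop (𝓝 0)) ∧
      ∃ c, ∀ᵐ s ∂((q.1 : Measure (Config d)).prod (q.2 : Measure (Config d))),
        Tendsto (fun n => cubeAvg shiftConfigs (overlapObs f) n s) atTop (𝓝 c) := by
  have hR := isPreservingAction_shiftStates hG hP
  have := isProbabilityMeasure_pureKernel₂ hG
  have hmix : ∀ (π : State d × State d → State d), Measurable π →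
      (∀ v q, π (shiftStates v q) = shiftState v (π q)) →
      (∀ᵐ p ∂P, ∀ᵐ q ∂pureKernel₂ d β p, IsPure β p.1 (π q)) →
      ∀ᵐ q ∂(pureKernel₂ d β ∘ₘ P), ∀ i j, Tendsto (avgCorr (π q) (f i) (f j)) atTop (𝓝 0) := by
    intro π hπm hπ hpure
    -- Purity refers to the couplings, which the law of the pair of states forgets. Its consequence,
    -- the decay of `corrSup`, is a measurable property of the states alone and passes to that law.
    refine ae_all_iff.2 fun i => ae_all_iff.2 fun j =>
      hR.ae_tendsto_avgCorr hd hπm hπ (hf i) (hf1 i) (hf j) (hf1 j)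
        (Measure.ae_comp_of_ae_ae ?_ ?_)
    · exact measurableSet_tendsto _ fun r => (measurable_corrSup (hf i) (hf j) r).comp hπm
    · filter_upwards [hpure] with p hp
      filter_upwards [hp] with q hq
      exact hq.tendsto_corrSup (hf i) (hf1 i) (hf j) (hf1 j) (hfl j)
  have hpure := ae_isPure_pureKernel₂ hG
  have h1 := hmix Prod.fst measurable_fst (fun _ _ => rfl)
    (hpure.mono fun p hp => hp.mono fun q hq => hq.1)
  have h2 := hmix Prod.snd measurable_snd (fun _ _ => rfl)
    (hpure.mono fun p hp => hp.mono fun q hq => hq.2)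
  have hlim := Measure.ae_ae_of_ae_comp (hR.replicas.ae_exists_tendsto_cubeAvg
    (measurable_overlapObs hf) (abs_overlapObs_le hf1))
  have hall : ∀ᵐ q ∂(pureKernel₂ d β ∘ₘ P), (∀ i j, Tendsto (avgCorr q.1 (f i) (f j)) atTop (𝓝 0)) ∧
      (∀ i j, Tendsto (avgCorr q.2 (f i) (f j)) atTop (𝓝 0)) ∧
      ∃ c, ∀ᵐ s ∂((q.1 : Measure (Config d)).prod (q.2 : Measure (Config d))),
        Tendsto (fun n => cubeAvg shiftConfigs (overlapObs f) n s) atTop (𝓝 c) := by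
    filter_upwards [h1, h2, hlim] with q hq1 hq2 hq
    rw [replicaKernel_apply] at hq
    exact ⟨hq1, hq2, exists_ae_tendsto_overlap hf hf1 hq1 hq2 hq⟩
  exact Measure.ae_ae_of_ae_comp hall

theorem ae_mixing_and_overlapConstant (hd : 1 ≤ d) (hG : ∀ᵐ p ∂P, IsGibbs β p.1 p.2)
    (hP : ∀ v, P.map (shiftPair v) = P) :
    ∀ᵐ p ∂P, ∀ᵐ q ∂((pureDecomposition β p.1 p.2).prod (pureDecomposition β p.1 p.2)),
      AveragedMixing q.1 ∧ AveragedMixing q.2 ∧ OverlapConstant edgeOverlap q.1 q.2 ∧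
        OverlapConstant spinOverlap q.1 q.2 := by
  filter_upwards [
    ae_avgCorr_and_overlap hd hG hP measurable_spinObs abs_spinObs_le fun _ => isLocal_spin,
    ae_avgCorr_and_overlap hd hG hP measurable_edgeObs abs_edgeObs_le isLocal_edgeSpin]
    with p hs he
  rw [pureKernel₂_apply] at hs he
  filter_upwards [hs, he] with q ⟨hs1, hs2, c, hc⟩ ⟨_, _, c', hc'⟩
  refine ⟨averagedMixing_of_avgCorr (hs1 () ()), averagedMixing_of_avgCorr (hs2 () ()),
    ⟨c' / d, hc'.mono fun s h => tendsto_edgeOverlap hd h⟩, ⟨c, hc.mono fun s h => ?_⟩⟩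
  simpa only [spinOverlap_eq_cubeAvg] using h

end PurePairs

end EA

/-- Pure state decompositions of states in a metastate of the Edwards–Anderson model: existence and
uniqueness, measurability, average decay of correlations, and constancy of overlaps. -/
theorem mainTheorem9 (d : ℕ) (hd : 1 ≤ d) (β : ℝ) (hβ : 0 ≤ β)
    (μ₀ : Measure ℝ) [IsProbabilityMeasure μ₀] (hsymm : μ₀.map (fun t => -t) = μ₀)
    (κ : Kernel (EA.Couplings d) (EA.State d)) [IsMarkovKernel κ]
    (hκ : EA.IsMetastate β (EA.couplingLaw d μ₀) κ) :
    -- every Gibbs measure has a unique decomposition into pure states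
    (∀ (J : EA.Couplings d) (Γ : EA.State d), EA.IsGibbs β J Γ →
      ∃! m : Measure (EA.State d), EA.IsPureDecomposition β J Γ m) ∧
    -- the states sampled from the metastate are Gibbs measures
    (∀ᵐ p ∂(EA.couplingLaw d μ₀ ⊗ₘ κ), EA.IsGibbs β p.1 p.2) ∧
    -- measurability of the decomposition
    (∀ B : Set (EA.State d × EA.State d), MeasurableSet B →
      Measurable (fun p : EA.Couplings d × EA.State d =>
        ((EA.pureDecomposition β p.1 p.2).prod (EA.pureDecomposition β p.1 p.2)) B)) ∧
    -- decay of correlations and constancy of the overlaps of pure states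
    (∀ᵐ p ∂(EA.couplingLaw d μ₀ ⊗ₘ κ),
      ∀ᵐ q ∂((EA.pureDecomposition β p.1 p.2).prod (EA.pureDecomposition β p.1 p.2)),
        EA.AveragedMixing q.1 ∧ EA.AveragedMixing q.2 ∧
        EA.OverlapConstant EA.edgeOverlap q.1 q.2 ∧
        EA.OverlapConstant EA.spinOverlap q.1 q.2) := by
  obtain ⟨a, b, hab, ha, hb, hκ⟩ := hκ
  have hκ : EA.ConvergesAlong β (EA.couplingLaw d μ₀) κ a b := hκ
  have hG := hκ.ae_isGibbs ha hb
  exact ⟨fun J Γ h => h.existsUnique_isPureDecomposition, hG,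
    fun B hB => EA.measurable_pureDecomposition_prod β hB,
    EA.ae_mixing_and_overlapConstant hd hG fun v => hκ.map_shiftPair hab ha hb v⟩
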